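/- Let $M$ be a closed (compact, without boundary) smooth manifold of dimension $n$. For a smooth Riemannian metric $g$ on $M$, a smooth function $f:M\to\mathbb R$ and a number $\tau>0$ put $$\mathcal W(g,f,\tau)=\int_M\big[\tau(|\nabla f|^2+R)+f-n\big](4\pi\tau)^{-n/2}e^{-f}\,dV,$$ where $R$ is the scalar curvature of $g$, $|\nabla f|^2=g^{ij}\nabla_i f\nabla_j f$, and $dV$ is the Riemannian volume measure of $g$. Let $(g(s),f(s),\tau(s))$, $|s|<\varepsilon$, be a smooth one-parameter family of such data (that is, $g(s)$ and $f(s)$ depend smoothly on $(s,x)\in(-\varepsilon,\varepsilon)\times M$, and $\tau(s)>0$ depends smoothly on $s$), with $(g,f,\tau)=(g(0),f(0),\tau(0))$ and $$v_{ij}=\tfrac{d}{ds}\big|_{s=0}g_{ij}(s),\qquad h=\tfrac{d}{ds}\big|_{s=0}f(s),\qquad \sigma=\tfrac{d}{ds}\big|_{s=0}\tau(s).$$ Then the integrand of $\mathcal W(g(s),f(s),\tau(s))$ is integrable for $|s|<\varepsilon$, the integrand below is integrable, and $s\mapsto\mathcal W(g(s),f(s),\tau(s))$ is differentiable at $s=0$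 with derivative $$\delta\mathcal W(v_{ij},h,\sigma)=\int_M\Big[\sigma(R+|\nabla f|^2)-\tau\,v_{ij}(R_{ij}+\nabla_i\nabla_j f)+h+\big[\tau(2\Delta f-|\nabla f|^2+R)+f-n\big]\Big(\frac v2-h-\frac{n\sigma}{2\tau}\Big)\Big](4\pi\tau)^{-n/2}e^{-f}\,dV .$$ Here all geometric quantities are those of $g=g(0)$: $R_{ij}$ is the Ricci tensor, $\nabla_i\nabla_j f$ the Hessian of $f$, $\Delta f=g^{ij}\nabla_i\nabla_j f$, $v=g^{ij}v_{ij}$, and $v_{ij}T_{ij}$ stands for $g^{ik}g^{jl}v_{ij}T_{kl}$. -/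

import Mathlib

open Set MeasureTheory
open scoped Manifold ContDiff Bundle

/-! Riemannian geometry in local coordinates on an `n`-dimensional smooth manifold `M`, the
Riemannian volume measure, and Perelman's functional `W`. -/

namespace PerelmanEntropy

noncomputable section

/-! ### Tensor calculus for a matrix of metric coefficients on (an open subset of) `ℝⁿ`

`G y i j` are the metric coefficients `g_ij` at the point `y` and `(G y)⁻¹ i j` are `g^ij`. -/

/-- The partial derivative `∂_k u` at `y`. -/
def partialDeriv {n : ℕ} (k : Fin n) (u : EuclideanSpace ℝ (Fin n) → ℝ)
    (y : EuclideanSpace ℝ (Fin n)) : ℝ :=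
  fderiv ℝ u y (EuclideanSpace.single k 1)

/-- The Christoffel symbol
`Γ^k_ij = (1/2) g^kl (∂_i g_jl + ∂_j g_il - ∂_l g_ij)` of the Levi-Civita connection. -/
def christoffel {n : ℕ} (G : EuclideanSpace ℝ (Fin n) → Matrix (Fin n) (Fin n) ℝ)
    (k i j : Fin n) (y : EuclideanSpace ℝ (Fin n)) : ℝ :=
  (1 / 2) * ∑ l, (G y)⁻¹ k l *
    (partialDeriv i (fun z => G z j l) y + partialDeriv j (fun z => G z i l) y
      - partialDeriv l (fun z => G z i j) y)

/-- The components of the curvature tensor, `R(∂_i, ∂_j) ∂_k = riemann G l k i j • ∂_l`, where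
`R(X, Y) = ∇_X ∇_Y - ∇_Y ∇_X - ∇_[X,Y]`. -/
def riemann {n : ℕ} (G : EuclideanSpace ℝ (Fin n) → Matrix (Fin n) (Fin n) ℝ)
    (l k i j : Fin n) (y : EuclideanSpace ℝ (Fin n)) : ℝ :=
  partialDeriv i (christoffel G l j k) y - partialDeriv j (christoffel G l i k) y
    + ∑ m, (christoffel G l i m y * christoffel G m j k y
      - christoffel G l j m y * christoffel G m i k y)

/-- The Ricci tensor `R_jk`, the trace of `X ↦ R(X, ∂_j) ∂_k`
(so that round spheres have positive Ricci curvature). -/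
def ricci {n : ℕ} (G : EuclideanSpace ℝ (Fin n) → Matrix (Fin n) (Fin n) ℝ)
    (y : EuclideanSpace ℝ (Fin n)) : Matrix (Fin n) (Fin n) ℝ :=
  Matrix.of fun j k => ∑ i, riemann G i k i j y

/-- The Hessian `∇_i ∇_j u = ∂_i ∂_j u - Γ^k_ij ∂_k u`. -/
def hessian {n : ℕ} (G : EuclideanSpace ℝ (Fin n) → Matrix (Fin n) (Fin n) ℝ)
    (u : EuclideanSpace ℝ (Fin n) → ℝ) (y : EuclideanSpace ℝ (Fin n)) :
    Matrix (Fin n) (Fin n) ℝ :=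
  Matrix.of fun i j =>
    partialDeriv i (partialDeriv j u) y - ∑ k, christoffel G k i j y * partialDeriv k u y

/-- The trace `g^ij T_ij` of a covariant 2-tensor; `A` is the matrix `g_ij` at a point. -/
def metricTrace {n : ℕ} (A T : Matrix (Fin n) (Fin n) ℝ) : ℝ :=
  ∑ i, ∑ j, A⁻¹ i j * T i j

/-- The inner product `g^ik g^jl S_ij T_kl` of two covariant 2-tensors, written `S_ij T_ij` in
the usual shorthand; `A` is the matrix `g_ij` at a point. -/
def metricPairing {n : ℕ} (A S T : Matrix (Fin n) (Fin n) ℝ) : ℝ :=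
  ∑ i, ∑ j, ∑ k, ∑ l, A⁻¹ i k * A⁻¹ j l * S i j * T k l

/-! ### The same notions on a manifold -/

/-- A (not necessarily smooth) field of covariant 2-tensors on `M`. -/
abbrev TensorField (n : ℕ) (M : Type*) [TopologicalSpace M]
    [ChartedSpace (EuclideanSpace ℝ (Fin n)) M] : Type _ :=
  (x : M) → TangentSpace (𝓡 n) x →L[ℝ] TangentSpace (𝓡 n) x →L[ℝ] ℝ

/-- A smooth Riemannian metric on `M`. -/
abbrev Metric (n : ℕ) (M : Type*) [TopologicalSpace M]
    [ChartedSpace (EuclideanSpace ℝ (Fin n)) M] [IsManifold (𝓡 n) ∞ M] : Type _ :=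
  Bundle.ContMDiffRiemannianMetric (𝓡 n) ∞ (EuclideanSpace ℝ (Fin n))
    (fun x : M => TangentSpace (𝓡 n) x)

variable {n : ℕ} {M : Type*} [TopologicalSpace M] [ChartedSpace (EuclideanSpace ℝ (Fin n)) M]

/-- The coordinate vector field `∂_i` of the chart `φ`, at the point with coordinates `y`. -/
def coordVector (φ : OpenPartialHomeomorph M (EuclideanSpace ℝ (Fin n)))
    (y : EuclideanSpace ℝ (Fin n)) (i : Fin n) : TangentSpace (𝓡 n) (φ.symm y) :=
  mfderiv (𝓡 n) (𝓡 n) φ.symm y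
    ((EuclideanSpace.single i 1 : EuclideanSpace ℝ (Fin n)) : TangentSpace (𝓡 n) y)

/-- The components `T_ij = T(∂_i, ∂_j)` of a tensor field in the chart `φ`, as functions of the
coordinates. -/
def coeff (φ : OpenPartialHomeomorph M (EuclideanSpace ℝ (Fin n))) (T : TensorField n M)
    (y : EuclideanSpace ℝ (Fin n)) : Matrix (Fin n) (Fin n) ℝ :=
  Matrix.of fun i j => T (φ.symm y) (coordVector φ y i) (coordVector φ y j)

variable [IsManifold (𝓡 n) ∞ M]

/-- The components of the metric in the preferred chart at `x`, as functions of the coordinates. -/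
def localMetric (g : Metric n M) (x : M) :
    EuclideanSpace ℝ (Fin n) → Matrix (Fin n) (Fin n) ℝ :=
  coeff (chartAt (EuclideanSpace ℝ (Fin n)) x) g.inner

/-- The components `g_ij` at `x`, in the preferred chart at `x`. -/
def metricAt (g : Metric n M) (x : M) : Matrix (Fin n) (Fin n) ℝ :=
  localMetric g x (chartAt (EuclideanSpace ℝ (Fin n)) x x)

/-- The components `v_ij` at `x` of a covariant 2-tensor, in the preferred chart at `x`. -/
def tensorAt (v : TensorField n M) (x : M) : Matrix (Fin n) (Fin n) ℝ :=
  coeff (chartAt (EuclideanSpace ℝ (Fin n)) x) v (chartAt (EuclideanSpace ℝ (Fin n)) x x)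

/-- The components `R_ij` of the Ricci tensor at `x`, in the preferred chart at `x`. -/
def ricciAt (g : Metric n M) (x : M) : Matrix (Fin n) (Fin n) ℝ :=
  ricci (localMetric g x) (chartAt (EuclideanSpace ℝ (Fin n)) x x)

/-- The components `∇_i ∇_j f` of the Hessian at `x`, in the preferred chart at `x`. -/
def hessianAt (g : Metric n M) (f : M → ℝ) (x : M) : Matrix (Fin n) (Fin n) ℝ :=
  hessian (localMetric g x) (f ∘ (chartAt (EuclideanSpace ℝ (Fin n)) x).symm)
    (chartAt (EuclideanSpace ℝ (Fin n)) x x)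

/-- The differential `∂_i f` at `x`, in the preferred chart at `x`. -/
def diffAt (f : M → ℝ) (x : M) (i : Fin n) : ℝ :=
  partialDeriv i (f ∘ (chartAt (EuclideanSpace ℝ (Fin n)) x).symm)
    (chartAt (EuclideanSpace ℝ (Fin n)) x x)

/-- The scalar curvature `R = g^ij R_ij`. -/
def scalarCurvature (g : Metric n M) (x : M) : ℝ :=
  metricTrace (metricAt g x) (ricciAt g x)

/-- The Laplacian `Δ f = g^ij ∇_i ∇_j f`. -/
def laplacian (g : Metric n M) (f : M → ℝ) (x : M) : ℝ :=
  metricTrace (metricAt g x) (hessianAt g f x)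

/-- The squared length `|∇ f|² = g^ij ∂_i f ∂_j f`. -/
def gradSq (g : Metric n M) (f : M → ℝ) (x : M) : ℝ :=
  ∑ i, ∑ j, (metricAt g x)⁻¹ i j * diffAt f x i * diffAt f x j

/-- The trace `v = g^ij v_ij`. -/
def trace (g : Metric n M) (v : TensorField n M) (x : M) : ℝ :=
  metricTrace (metricAt g x) (tensorAt v x)

variable [MeasurableSpace M]

/-- The coordinate volume `√(det g_ij) dy¹ ⋯ dyⁿ` of the chart `φ`, transported to the domain of
`φ` (and zero outside of it). -/
def chartVolume (g : Metric n M) (φ : OpenPartialHomeomorph M (EuclideanSpace ℝ (Fin n))) :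
    Measure M :=
  ((volume.restrict φ.target).withDensity
    (fun y => ENNReal.ofReal (Real.sqrt (coeff φ g.inner y).det))).map φ.symm

/-- The Riemannian volume measure: the smallest measure that dominates the coordinate volume of
every chart of the atlas. The coordinate volumes agree on overlaps of charts, so on a second
countable manifold this is the measure that restricts to the coordinate volume on the domain of
each chart. -/
def riemannianVolume (g : Metric n M) : Measure M :=
  ⨆ φ ∈ atlas (EuclideanSpace ℝ (Fin n)) M, chartVolume g φ

/-- The integrand `[τ(|∇f|² + R) + f - n] (4πτ)^(-n/2) e^(-f)` of Perelman's functional. -/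
def entropyIntegrand (g : Metric n M) (f : M → ℝ) (τ : ℝ) (x : M) : ℝ :=
  (τ * (gradSq g f x + scalarCurvature g x) + f x - n)
    * ((4 * Real.pi * τ) ^ (-(n : ℝ) / 2) * Real.exp (-f x))

/-- Perelman's functional `W(g, f, τ)`. -/
def entropyW (g : Metric n M) (f : M → ℝ) (τ : ℝ) : ℝ :=
  ∫ x, entropyIntegrand g f τ x ∂(riemannianVolume g)

/-- The integrand of the first variation of `W` at `(g, f, τ)` in the direction `(v, h, σ)`. -/
def variationIntegrand (g : Metric n M) (f : M → ℝ) (τ : ℝ)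
    (v : TensorField n M) (h : M → ℝ) (σ : ℝ) (x : M) : ℝ :=
  (σ * (scalarCurvature g x + gradSq g f x)
      - τ * metricPairing (metricAt g x) (tensorAt v x) (ricciAt g x + hessianAt g f x)
      + h x
      + (τ * (2 * laplacian g f x - gradSq g f x + scalarCurvature g x) + f x - n)
        * (trace g v x / 2 - h x - n * σ / (2 * τ)))
    * ((4 * Real.pi * τ) ^ (-(n : ℝ) / 2) * Real.exp (-f x))

end

end PerelmanEntropy

open PerelmanEntropy

namespace PerelmanEntropy

/-! ### Derivatives of determinants and inverse matrices -/

section MatrixCalculus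

variable {n : ℕ}

/-! The derivative of the density `[τ(|∇f|² + R) + f - n] (4πτ)^(-n/2) e^(-f) dV` differs from the
claimed integrand by a divergence. Put `q = v/2 - h - nσ/(2τ)`, the logarithmic derivative of
`(4πτ)^(-n/2) e^(-f) dV`. Pointwise, `δR = -⟨v, Ric⟩ + div W` with the Palatini field `W^i = g^jk
δΓ^i_jk - g^ij δΓ^k_kj`, and `δ|∇f|² = -v(∇f, ∇f) + 2⟨∇f, ∇h⟩`. For `Y = W + v(∇f, ·) - 2q∇f` (index
raised) the weighted divergence `div Y - ⟨∇f, Y⟩` equals `div W + ⟨v, Hess f⟩ - v(∇f, ∇f) + 2⟨∇f,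
∇h⟩ - 2q(Δf - |∇f|²)`. Hence the derivative of the density is the claimed integrand plus
`τ(4πτ)^(-n/2)` times the divergence of `e^(-f) Y`, and the divergence integrates to zero on a
closed manifold. The identity is `weighted_divergence_entropyField`, and its consequence for the
density is `hasDerivAt_localEntropy`.

In coordinates `δΓ` is never expanded in terms of `v`. The compatibility relations for `∂_k g^ij`
and `∂_k √det g` are differentiated in the parameter, and commuting the two derivatives expresses
the derivatives of the raised `v` and of `v/2` through `δΓ` (`partialDeriv_raised`,
`partialDeriv_metricTrace_variation`). What remains is renaming of summation indices.

The curvature, Hessian and gradient at a point are defined in the preferred chart of that point, so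
their invariance under coordinate changes is proved too. The Koszul formula gives the law for `Γ`,
and differentiating it gives the laws for curvature and, with the chain rule, for Hessians. The
volume is a supremum of chart volumes; `restrict_riemannianVolume` identifies it with the coordinate
volume on each chart.

The divergence theorem is applied through a partition of unity `ρ_a` subordinate to charts.
Integration by parts inside a chart turns the divergence weighted by `ρ_a` into minus the flux
`e^(-f) Y·ρ_a`. This flux is independent of the chart (`entropyFlux_eq`), and the fluxes add up to
`e^(-f) Y·1 = 0`. -/

theorem det_updateCol_eq_sum (A : Matrix (Fin n) (Fin n) ℝ) (b : Fin n → ℝ) (i : Fin n) :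
    (A.updateCol i b).det = ∑ σ : Equiv.Perm (Fin n),
      ((Equiv.Perm.sign σ : ℤ) : ℝ) * ((∏ j ∈ Finset.univ.erase i, A (σ j) j) * b (σ i)) := by
  rw [Matrix.det_apply']
  refine Finset.sum_congr rfl fun σ _ => ?_
  congr 1
  rw [← Finset.prod_erase_mul _ _ (Finset.mem_univ i)]
  congr 1
  · refine Finset.prod_congr rfl fun j hj => ?_
    rw [Matrix.updateCol_ne (Finset.ne_of_mem_erase hj)]
  · simp

/-- Jacobi's formula. In the Leibniz expansion, the terms whose `i`-th factor is differentiated form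
the determinant with column `i` replaced by that of `B`, which Cramer's rule reads as a diagonal
entry of `adjugate * B`. -/
theorem hasDerivAt_det {A : ℝ → Matrix (Fin n) (Fin n) ℝ} {B : Matrix (Fin n) (Fin n) ℝ} {t : ℝ}
    (h : ∀ i j, HasDerivAt (fun s => A s i j) (B i j) t) :
    HasDerivAt (fun s => (A s).det) ((A t).adjugate * B).trace t := by
  have h1 : HasDerivAt (fun s => (A s).det) (∑ σ : Equiv.Perm (Fin n),
      ((Equiv.Perm.sign σ : ℤ) : ℝ) *
        (∑ i, (∏ j ∈ Finset.univ.erase i, A t (σ j) j) • B (σ i) i)) t := by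
    simp only [Matrix.det_apply']
    refine HasDerivAt.fun_sum fun σ _ => ?_
    exact (HasDerivAt.fun_finsetProd fun i _ => h (σ i) i).const_mul _
  convert h1 using 1
  simp only [Finset.mul_sum]
  rw [Finset.sum_comm, Matrix.trace]
  refine Finset.sum_congr rfl fun i _ => ?_
  have := det_updateCol_eq_sum (A t) (fun k => B k i) i
  rw [← Matrix.cramer_apply, Matrix.cramer_eq_adjugate_mulVec] at this
  simpa [Matrix.mulVec, dotProduct, Matrix.mul_apply] using this

theorem differentiableAt_adjugate {A : ℝ → Matrix (Fin n) (Fin n) ℝ} {t : ℝ}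
    (h : ∀ i j, DifferentiableAt ℝ (fun s => A s i j) t) (i j : Fin n) :
    DifferentiableAt ℝ (fun s => (A s).adjugate i j) t := by
  simp only [Matrix.adjugate_apply]
  refine (hasDerivAt_det (B := Matrix.of fun k l =>
    deriv (fun s => (A s).updateRow j (Pi.single i 1) k l) t) fun k l => ?_).differentiableAt
  refine DifferentiableAt.hasDerivAt ?_
  by_cases hk : k = j
  · subst hk; simp
  · simpa [Matrix.updateRow_ne hk] using h k l

theorem inv_apply_eq (A : Matrix (Fin n) (Fin n) ℝ) (i j : Fin n) :
    A⁻¹ i j = A.det⁻¹ * A.adjugate i j := by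
  simp [Matrix.inv_def]

/-- Cramer's formula gives differentiability; the value of the derivative is then forced by the
product rule applied to `A * A⁻¹ = 1`. -/
theorem hasDerivAt_inv {A : ℝ → Matrix (Fin n) (Fin n) ℝ} {B : Matrix (Fin n) (Fin n) ℝ} {t : ℝ}
    (h : ∀ i j, HasDerivAt (fun s => A s i j) (B i j) t) (hA : (A t).det ≠ 0) (i j : Fin n) :
    HasDerivAt (fun s => (A s)⁻¹ i j) (-((A t)⁻¹ * B * (A t)⁻¹) i j) t := by
  have hd := hasDerivAt_det h
  have hI : ∀ i j, DifferentiableAt ℝ (fun s => (A s)⁻¹ i j) t := fun i j => by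
    simp only [inv_apply_eq]
    exact (hd.differentiableAt.inv hA).mul
      (differentiableAt_adjugate (fun i j => (h i j).differentiableAt) i j)
  set D : Matrix (Fin n) (Fin n) ℝ := Matrix.of fun i j => deriv (fun s => (A s)⁻¹ i j) t with hD
  have hu : IsUnit (A t).det := isUnit_iff_ne_zero.2 hA
  have key : B * (A t)⁻¹ + A t * D = 0 := by
    ext i j
    have h1 : HasDerivAt (fun s => (A s * (A s)⁻¹) i j) ((B * (A t)⁻¹ + A t * D) i j) t := by
      simp only [Matrix.mul_apply, Matrix.add_apply, ← Finset.sum_add_distrib]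
      exact HasDerivAt.fun_sum fun k _ => (h i k).mul (hI k j).hasDerivAt
    -- Invertibility is known only at `t`, but it persists nearby by continuity of the determinant.
    have h2 : HasDerivAt (fun s => (A s * (A s)⁻¹) i j) 0 t := by
      refine (hasDerivAt_const t ((1 : Matrix (Fin n) (Fin n) ℝ) i j)).congr_of_eventuallyEq ?_
      filter_upwards [hd.continuousAt.eventually_ne hA] with s hs
      rw [Matrix.mul_nonsing_inv _ (isUnit_iff_ne_zero.2 hs)]
    exact h1.unique h2
  have hDe : D = -((A t)⁻¹ * B * (A t)⁻¹) := by
    have : (A t)⁻¹ * (A t * D) = (A t)⁻¹ * (-(B * (A t)⁻¹)) := by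
      rw [eq_neg_of_add_eq_zero_right key]
    rw [← Matrix.mul_assoc, Matrix.nonsing_inv_mul _ hu, Matrix.one_mul] at this
    rw [this, Matrix.mul_neg, Matrix.mul_assoc]
  have := (hI i j).hasDerivAt
  rwa [show deriv (fun s => (A s)⁻¹ i j) t = D i j from rfl, hDe] at this

variable {X : Type*} [NormedAddCommGroup X] [NormedSpace ℝ X] {S : Set X} {k : WithTop ℕ∞}

theorem contDiffOn_det {A : X → Matrix (Fin n) (Fin n) ℝ}
    (h : ∀ i j, ContDiffOn ℝ k (fun x => A x i j) S) : ContDiffOn ℝ k (fun x => (A x).det) S := by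
  simp only [Matrix.det_apply']
  exact ContDiffOn.sum fun σ _ => contDiffOn_const.mul (contDiffOn_prod fun i _ => h _ _)

theorem contDiffOn_inv {A : X → Matrix (Fin n) (Fin n) ℝ}
    (h : ∀ i j, ContDiffOn ℝ k (fun x => A x i j) S) (hA : ∀ x ∈ S, (A x).det ≠ 0) (i j : Fin n) :
    ContDiffOn ℝ k (fun x => (A x)⁻¹ i j) S := by
  simp only [inv_apply_eq]
  refine ((contDiffOn_det h).inv hA).mul ?_
  simp only [Matrix.adjugate_apply]
  refine contDiffOn_det fun k l => ?_
  by_cases hk : k = j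
  · subst hk; simpa using contDiffOn_const
  · simpa [Matrix.updateRow_ne hk] using h k l

end MatrixCalculus


theorem two_le_infty : (2 : WithTop ℕ∞) ≤ ∞ := WithTop.coe_le_coe.2 le_top

/-! ### Partial derivatives -/

section PartialDerivatives

open scoped Topology

variable {n : ℕ} {u w : EuclideanSpace ℝ (Fin n) → ℝ} {y : EuclideanSpace ℝ (Fin n)} {k : Fin n}

theorem hasDerivAt_line (hu : DifferentiableAt ℝ u y) :
    HasDerivAt (fun t : ℝ => u (y + t • EuclideanSpace.single k 1)) (partialDeriv k u y) 0 :=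
  hu.hasFDerivAt.hasLineDerivAt _

/-- Transfers the one-variable formulas for determinants and inverses to partial derivatives, by
restriction to a coordinate line. -/
theorem partialDeriv_eq_of_hasDerivAt_line (hu : DifferentiableAt ℝ u y) {c : ℝ}
    (h : HasDerivAt (fun t : ℝ => u (y + t • EuclideanSpace.single k 1)) c 0) :
    partialDeriv k u y = c :=
  (hasDerivAt_line hu).unique h

theorem partialDeriv_congr (h : u =ᶠ[𝓝 y] w) : partialDeriv k u y = partialDeriv k w y := by
  simp only [partialDeriv, h.fderiv_eq]

@[simp]
theorem partialDeriv_const (c : ℝ) : partialDeriv k (fun _ => c) y = 0 := by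
  simp [partialDeriv]

theorem partialDeriv_mul (hu : DifferentiableAt ℝ u y) (hw : DifferentiableAt ℝ w y) :
    partialDeriv k (fun z => u z * w z) y
      = partialDeriv k u y * w y + u y * partialDeriv k w y := by
  simp only [partialDeriv, fderiv_fun_mul hu hw]
  simp
  ring

theorem partialDeriv_sum {ι : Type*} (s : Finset ι) {u : ι → EuclideanSpace ℝ (Fin n) → ℝ}
    (hu : ∀ i ∈ s, DifferentiableAt ℝ (u i) y) :
    partialDeriv k (fun z => ∑ i ∈ s, u i z) y = ∑ i ∈ s, partialDeriv k (u i) y := by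
  simp only [partialDeriv, fderiv_fun_sum hu, sum_apply]

theorem fderiv_apply_eq_sum (a : EuclideanSpace ℝ (Fin n)) :
    fderiv ℝ u y a = ∑ k, a k * partialDeriv k u y := by
  have ha : a = ∑ k, a k • EuclideanSpace.single k (1 : ℝ) := by
    ext j
    simp [Finset.sum_apply, Pi.single_apply]
  conv_lhs => rw [ha]
  simp [partialDeriv]

theorem contDiffOn_partialDeriv {U : Set (EuclideanSpace ℝ (Fin n))} (hU : IsOpen U)
    (hu : ContDiffOn ℝ ∞ u U) (k : Fin n) : ContDiffOn ℝ ∞ (partialDeriv k u) U :=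
  (hu.fderiv_of_isOpen hU (by simp)).clm_apply contDiffOn_const

end PartialDerivatives

/-! ### Smooth one-parameter families of functions -/

section Families

open scoped Topology

variable {n : ℕ} {Ω : Set (ℝ × EuclideanSpace ℝ (Fin n))} {u : ℝ → EuclideanSpace ℝ (Fin n) → ℝ}
  {s : ℝ} {y : EuclideanSpace ℝ (Fin n)} {k : Fin n}

theorem eventually_mem_left (hΩ : IsOpen Ω) (h : (s, y) ∈ Ω) : ∀ᶠ t in 𝓝 s, (t, y) ∈ Ω :=
  (Continuous.prodMk_left y).continuousAt.preimage_mem_nhds (hΩ.mem_nhds h)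

theorem eventually_mem_right (hΩ : IsOpen Ω) (h : (s, y) ∈ Ω) : ∀ᶠ z in 𝓝 y, (s, z) ∈ Ω :=
  (Continuous.prodMk_right s).continuousAt.preimage_mem_nhds (hΩ.mem_nhds h)

theorem hasFDerivAt_slice (hΩ : IsOpen Ω) (hu : ContDiffOn ℝ ∞ (fun p : ℝ × _ => u p.1 p.2) Ω)
    (h : (s, y) ∈ Ω) : HasFDerivAt (u s)
      ((fderiv ℝ (fun p : ℝ × _ => u p.1 p.2) (s, y)).comp
        (ContinuousLinearMap.inr ℝ ℝ (EuclideanSpace ℝ (Fin n)))) y := by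
  have hd : DifferentiableAt ℝ (fun p : ℝ × _ => u p.1 p.2) (s, y) :=
    (hu.contDiffAt (hΩ.mem_nhds h)).differentiableAt (by simp)
  exact HasFDerivAt.comp (g := fun p : ℝ × _ => u p.1 p.2) y hd.hasFDerivAt
    (hasFDerivAt_prodMk_right s y)

theorem partialDeriv_slice (hΩ : IsOpen Ω) (hu : ContDiffOn ℝ ∞ (fun p : ℝ × _ => u p.1 p.2) Ω)
    (h : (s, y) ∈ Ω) : partialDeriv k (u s) y
      = fderiv ℝ (fun p : ℝ × _ => u p.1 p.2) (s, y) (0, EuclideanSpace.single k 1) := by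
  rw [partialDeriv, (hasFDerivAt_slice hΩ hu h).fderiv]
  simp

theorem hasDerivAt_slice (hΩ : IsOpen Ω) (hu : ContDiffOn ℝ ∞ (fun p : ℝ × _ => u p.1 p.2) Ω)
    (h : (s, y) ∈ Ω) : HasDerivAt (fun t => u t y)
      (fderiv ℝ (fun p : ℝ × _ => u p.1 p.2) (s, y) (1, 0)) s := by
  have hd : DifferentiableAt ℝ (fun p : ℝ × _ => u p.1 p.2) (s, y) :=
    (hu.contDiffAt (hΩ.mem_nhds h)).differentiableAt (by simp)
  have := HasFDerivAt.comp (g := fun p : ℝ × _ => u p.1 p.2) s hd.hasFDerivAt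
    (hasFDerivAt_prodMk_left (𝕜 := ℝ) s y)
  simpa [Function.comp_def] using this.hasDerivAt

theorem contDiffOn_partialDeriv_slice (hΩ : IsOpen Ω)
    (hu : ContDiffOn ℝ ∞ (fun p : ℝ × _ => u p.1 p.2) Ω) (k : Fin n) :
    ContDiffOn ℝ ∞ (fun p : ℝ × _ => partialDeriv k (u p.1) p.2) Ω := by
  refine ((hu.fderiv_of_isOpen hΩ (m := ∞) (by simp)).clm_apply
    (contDiffOn_const (c := ((0 : ℝ), EuclideanSpace.single k (1 : ℝ))))).congr fun p hp => ?_
  exact partialDeriv_slice hΩ hu hp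

theorem contDiffOn_deriv_slice (hΩ : IsOpen Ω)
    (hu : ContDiffOn ℝ ∞ (fun p : ℝ × _ => u p.1 p.2) Ω) :
    ContDiffOn ℝ ∞ (fun p : ℝ × _ => deriv (fun t => u t p.2) p.1) Ω := by
  refine ((hu.fderiv_of_isOpen hΩ (m := ∞) (by simp)).clm_apply
    (contDiffOn_const (c := ((1 : ℝ), (0 : EuclideanSpace ℝ (Fin n)))))).congr fun p hp => ?_
  exact (hasDerivAt_slice hΩ hu hp).deriv

/-- The derivative in the parameter commutes with partial derivatives. -/
theorem hasDerivAt_partialDeriv (hΩ : IsOpen Ω)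
    (hu : ContDiffOn ℝ ∞ (fun p : ℝ × _ => u p.1 p.2) Ω) (h : (s, y) ∈ Ω)
    {V : EuclideanSpace ℝ (Fin n) → ℝ}
    (hV : ∀ z, (s, z) ∈ Ω → HasDerivAt (fun t => u t z) (V z) s) (k : Fin n) :
    HasDerivAt (fun t => partialDeriv k (u t) y) (partialDeriv k V y) s := by
  set W : ℝ × EuclideanSpace ℝ (Fin n) → ℝ := fun p => u p.1 p.2 with hW
  have hc : ContDiffAt ℝ ∞ W (s, y) := hu.contDiffAt (hΩ.mem_nhds h)
  have h2 : HasFDerivAt (fderiv ℝ W) (fderiv ℝ (fderiv ℝ W) (s, y)) (s, y) :=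
    ((hc.fderiv_right (m := 1) two_le_infty).differentiableAt
      one_ne_zero).hasFDerivAt
  -- Schwarz's theorem on the product space: both sides are the second derivative of `W` in the
  -- directions `(1, 0)` and `(0, e_k)`, taken in opposite orders.
  have hsymm := hc.isSymmSndFDerivAt (by simpa using two_le_infty)
  have e1 : partialDeriv k V y
      = fderiv ℝ (fderiv ℝ W) (s, y) (0, EuclideanSpace.single k 1) (1, 0) := by
    have : V =ᶠ[𝓝 y] fun z => fderiv ℝ W (s, z) (1, 0) := by
      filter_upwards [eventually_mem_right hΩ h] with z hz
      exact (hV z hz).unique (hasDerivAt_slice hΩ hu hz)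
    rw [partialDeriv_congr this, partialDeriv]
    have h3 := (h2.comp y (hasFDerivAt_prodMk_right s y)).clm_apply
      (hasFDerivAt_const ((1 : ℝ), (0 : EuclideanSpace ℝ (Fin n))) y)
    have h4 := h3.fderiv
    simp only [Function.comp_def] at h4
    rw [h4]
    simp
  rw [e1, hsymm.eq]
  have h5 : HasDerivAt (fun t => fderiv ℝ W (t, y) (0, EuclideanSpace.single k 1))
      (fderiv ℝ (fderiv ℝ W) (s, y) (1, 0) (0, EuclideanSpace.single k 1)) s := by
    have h3 := (HasFDerivAt.comp (g := fderiv ℝ W) s h2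
      (hasFDerivAt_prodMk_left (𝕜 := ℝ) s y)).clm_apply
      (hasFDerivAt_const ((0 : ℝ), EuclideanSpace.single k (1 : ℝ)) s)
    simpa [Function.comp_def] using h3.hasDerivAt
  refine h5.congr_of_eventuallyEq ?_
  filter_upwards [eventually_mem_left hΩ h] with t ht
  exact partialDeriv_slice hΩ hu ht

end Families


/-! ### Christoffel symbols of a matrix of metric coefficients -/

/-- Smooth symmetric coefficients with positive determinant on an open set. -/
structure IsMetricOn {n : ℕ} (U : Set (EuclideanSpace ℝ (Fin n)))
    (G : EuclideanSpace ℝ (Fin n) → Matrix (Fin n) (Fin n) ℝ) : Prop where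
  isOpen : IsOpen U
  contDiffOn : ∀ i j, ContDiffOn ℝ ∞ (fun y => G y i j) U
  symm : ∀ y, (G y).IsSymm
  det_pos : ∀ y ∈ U, 0 < (G y).det

/-- Smooth one-parameter families of symmetric coefficients with positive determinant. -/
structure IsMetricFamilyOn {n : ℕ} (Ω : Set (ℝ × EuclideanSpace ℝ (Fin n)))
    (G : ℝ → EuclideanSpace ℝ (Fin n) → Matrix (Fin n) (Fin n) ℝ) : Prop where
  isOpen : IsOpen Ω
  contDiffOn : ∀ i j, ContDiffOn ℝ ∞ (fun p : ℝ × EuclideanSpace ℝ (Fin n) => G p.1 p.2 i j) Ω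
  symm : ∀ s y, (G s y).IsSymm
  det_pos : ∀ p ∈ Ω, 0 < (G p.1 p.2).det

/-- The matrix `Γ^m_kj` of the connection in the direction `∂_k`. -/
noncomputable def connectionMatrix {n : ℕ}
    (G : EuclideanSpace ℝ (Fin n) → Matrix (Fin n) (Fin n) ℝ)
    (y : EuclideanSpace ℝ (Fin n)) (k : Fin n) : Matrix (Fin n) (Fin n) ℝ :=
  Matrix.of fun m j => christoffel G m k j y

section Static

open scoped Topology

variable {n : ℕ} {U : Set (EuclideanSpace ℝ (Fin n))}
  {G : EuclideanSpace ℝ (Fin n) → Matrix (Fin n) (Fin n) ℝ} {y : EuclideanSpace ℝ (Fin n)}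

theorem IsMetricOn.differentiableAt (hG : IsMetricOn U G) (hy : y ∈ U) (i j : Fin n) :
    DifferentiableAt ℝ (fun z => G z i j) y :=
  ((hG.contDiffOn i j).contDiffAt (hG.isOpen.mem_nhds hy)).differentiableAt (by simp)

theorem IsMetricOn.contDiffOn_inv (hG : IsMetricOn U G) (i j : Fin n) :
    ContDiffOn ℝ ∞ (fun y => (G y)⁻¹ i j) U :=
  PerelmanEntropy.contDiffOn_inv hG.contDiffOn (fun y hy => (hG.det_pos y hy).ne') i j

theorem IsMetricOn.contDiffOn_christoffel (hG : IsMetricOn U G) (k i j : Fin n) :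
    ContDiffOn ℝ ∞ (christoffel G k i j) U := by
  unfold christoffel
  refine contDiffOn_const.mul (ContDiffOn.sum fun l _ => (hG.contDiffOn_inv k l).mul ?_)
  exact ((contDiffOn_partialDeriv hG.isOpen (hG.contDiffOn _ _) _).add
    (contDiffOn_partialDeriv hG.isOpen (hG.contDiffOn _ _) _)).sub
    (contDiffOn_partialDeriv hG.isOpen (hG.contDiffOn _ _) _)

theorem christoffel_symm (hS : ∀ y, (G y).IsSymm) (k i j : Fin n) :
    christoffel G k i j = christoffel G k j i := by
  funext y
  have h : ∀ l, partialDeriv l (fun z => G z i j) y = partialDeriv l (fun z => G z j i) y := by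
    intro l; congr 1; funext z; exact ((hS z).apply i j).symm
  simp only [christoffel, h]
  congr 1
  refine Finset.sum_congr rfl fun l _ => ?_
  ring

/-- Lowering the upper index cancels the inverse matrix in the definition of the Christoffel
symbols. -/
theorem sum_mul_christoffel (hG : IsMetricOn U G) (hy : y ∈ U) (m i j : Fin n) :
    ∑ k, G y m k * christoffel G k i j y = (1 / 2) *
      (partialDeriv i (fun z => G z j m) y + partialDeriv j (fun z => G z i m) y
        - partialDeriv m (fun z => G z i j) y) := by
  set b : Fin n → ℝ := fun l => partialDeriv i (fun z => G z j l) y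
    + partialDeriv j (fun z => G z i l) y - partialDeriv l (fun z => G z i j) y with hb
  have h : (G y).mulVec ((G y)⁻¹.mulVec b) = b := by
    rw [Matrix.mulVec_mulVec, Matrix.mul_nonsing_inv _ (hG.det_pos y hy).ne'.isUnit,
      Matrix.one_mulVec]
  have h2 := congrFun h m
  simp only [Matrix.mulVec, dotProduct] at h2
  refine Eq.trans ?_ (congrArg (1 / 2 * ·) h2)
  simp only [christoffel, hb]
  rw [Finset.mul_sum]
  refine Finset.sum_congr rfl fun k _ => ?_
  ring

/-- Metric compatibility `∇g = 0`. In the sum of the two lowered Christoffel symbols all partial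
derivatives cancel except two equal ones. -/
theorem partialDeriv_metric (hG : IsMetricOn U G) (hy : y ∈ U) (k i j : Fin n) :
    partialDeriv k (fun z => G z i j) y = (G y * connectionMatrix G y k
      + (connectionMatrix G y k).transpose * G y) i j := by
  have h : ∀ l a b, partialDeriv l (fun z => G z a b) y = partialDeriv l (fun z => G z b a) y := by
    intro l a b; congr 1; funext z; exact ((hG.symm z).apply a b).symm
  simp only [Matrix.add_apply, Matrix.mul_apply, connectionMatrix, Matrix.transpose_apply,
    Matrix.of_apply]
  have h2 : ∑ x, christoffel G x k i y * G y x j = ∑ x, G y j x * christoffel G x k i y :=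
    Finset.sum_congr rfl fun x _ => by rw [(hG.symm y).apply, mul_comm]
  rw [h2, sum_mul_christoffel hG hy, sum_mul_christoffel hG hy, h i k j, h k j i, h j k i]
  ring

/-- Compatibility for the inverse metric: with `Γ` the connection matrix in the direction `∂_k`,
conjugating `GΓ + ΓᵀG` by `G⁻¹` leaves `ΓG⁻¹ + G⁻¹Γᵀ`. -/
theorem partialDeriv_inv (hG : IsMetricOn U G) (hy : y ∈ U) (k i j : Fin n) :
    partialDeriv k (fun z => (G z)⁻¹ i j) y
      = -∑ l, (christoffel G i k l y * (G y)⁻¹ l j + (G y)⁻¹ i l * christoffel G j k l y) := by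
  have hu := (hG.det_pos y hy).ne'.isUnit
  have hd : DifferentiableAt ℝ (fun z => (G z)⁻¹ i j) y :=
    ((hG.contDiffOn_inv i j).contDiffAt (hG.isOpen.mem_nhds hy)).differentiableAt (by simp)
  refine partialDeriv_eq_of_hasDerivAt_line hd ?_
  have h0 : y + (0 : ℝ) • EuclideanSpace.single k (1 : ℝ) = y := by simp
  have := hasDerivAt_inv (A := fun t => G (y + t • EuclideanSpace.single k 1))
    (B := Matrix.of fun i j => partialDeriv k (fun z => G z i j) y) (t := 0)
    (fun i j => hasDerivAt_line (hG.differentiableAt hy i j))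
    (by simpa only [h0] using (hG.det_pos y hy).ne') i j
  simp only [h0] at this
  convert this using 1
  have e : (Matrix.of fun i j => partialDeriv k (fun z => G z i j) y)
      = G y * connectionMatrix G y k + (connectionMatrix G y k).transpose * G y := by
    ext i j
    exact partialDeriv_metric hG hy k i j
  have e2 : (G y)⁻¹ * (G y * connectionMatrix G y k + (connectionMatrix G y k).transpose * G y)
      * (G y)⁻¹ = connectionMatrix G y k * (G y)⁻¹
        + (G y)⁻¹ * (connectionMatrix G y k).transpose := by
    rw [Matrix.mul_add, Matrix.add_mul, Matrix.nonsing_inv_mul_cancel_left _ _ hu,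
      ← Matrix.mul_assoc, Matrix.mul_nonsing_inv_cancel_right _ _ hu]
  rw [e, e2]
  simp [Matrix.mul_apply, connectionMatrix, Finset.sum_add_distrib]

/-- The density `√(det g_ij)`. -/
noncomputable def density {n : ℕ} (G : EuclideanSpace ℝ (Fin n) → Matrix (Fin n) (Fin n) ℝ)
    (y : EuclideanSpace ℝ (Fin n)) : ℝ := √(G y).det

theorem IsMetricOn.density_pos (hG : IsMetricOn U G) (hy : y ∈ U) : 0 < density G y :=
  Real.sqrt_pos.2 (hG.det_pos y hy)

theorem IsMetricOn.contDiffOn_density (hG : IsMetricOn U G) : ContDiffOn ℝ ∞ (density G) U :=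
  (contDiffOn_det hG.contDiffOn).sqrt fun y hy => (hG.det_pos y hy).ne'

theorem hasDerivAt_sqrt_det {A : ℝ → Matrix (Fin n) (Fin n) ℝ} {B : Matrix (Fin n) (Fin n) ℝ}
    {t : ℝ} (h : ∀ i j, HasDerivAt (fun s => A s i j) (B i j) t) (hA : 0 < (A t).det) :
    HasDerivAt (fun s => √(A s).det) (√(A t).det * (((A t)⁻¹ * B).trace / 2)) t := by
  convert (hasDerivAt_det h).sqrt hA.ne' using 1
  have : (A t).adjugate = (A t).det • (A t)⁻¹ := by
    rw [Matrix.inv_def, smul_smul, Ring.inverse_eq_inv', mul_inv_cancel₀ hA.ne', one_smul]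
  rw [this, Matrix.smul_mul, Matrix.trace_smul, smul_eq_mul]
  nth_rewrite 2 [← Real.mul_self_sqrt hA.le]
  have := (Real.sqrt_pos.2 hA).ne'
  field_simp

/-- By Jacobi's formula the logarithmic derivative is half the trace of `G⁻¹ ∂_k G`, and
compatibility makes that trace twice the trace of the connection matrix. -/
theorem partialDeriv_density (hG : IsMetricOn U G) (hy : y ∈ U) (k : Fin n) :
    partialDeriv k (density G) y = density G y * ∑ l, christoffel G l k l y := by
  have hu := (hG.det_pos y hy).ne'.isUnit
  have hd : DifferentiableAt ℝ (density G) y :=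
    (hG.contDiffOn_density.contDiffAt (hG.isOpen.mem_nhds hy)).differentiableAt (by simp)
  refine partialDeriv_eq_of_hasDerivAt_line hd ?_
  have h0 : y + (0 : ℝ) • EuclideanSpace.single k (1 : ℝ) = y := by simp
  have := hasDerivAt_sqrt_det (A := fun t => G (y + t • EuclideanSpace.single k 1))
    (B := Matrix.of fun i j => partialDeriv k (fun z => G z i j) y) (t := 0)
    (fun i j => hasDerivAt_line (hG.differentiableAt hy i j))
    (by simpa only [h0] using hG.det_pos y hy)
  simp only [h0] at this
  refine this.congr_deriv ?_
  have e : (Matrix.of fun i j => partialDeriv k (fun z => G z i j) y)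
      = G y * connectionMatrix G y k + (connectionMatrix G y k).transpose * G y := by
    ext i j
    exact partialDeriv_metric hG hy k i j
  rw [e, Matrix.mul_add, Matrix.trace_add, Matrix.nonsing_inv_mul_cancel_left _ _ hu,
    Matrix.trace_mul_comm, Matrix.mul_assoc, Matrix.mul_nonsing_inv _ hu, Matrix.mul_one,
    Matrix.trace_transpose]
  simp [density, Matrix.trace, connectionMatrix]

/-- The divergence of a vector field with respect to the weighted measure `e^(-F) dV`. -/
theorem sum_partialDeriv_weighted (hG : IsMetricOn U G) (hy : y ∈ U)
    {F : EuclideanSpace ℝ (Fin n) → ℝ} (hF : DifferentiableAt ℝ F y)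
    {X : Fin n → EuclideanSpace ℝ (Fin n) → ℝ} (hX : ∀ i, DifferentiableAt ℝ (X i) y) :
    ∑ i, partialDeriv i (fun z => density G z * Real.exp (-F z) * X i z) y
      = density G y * Real.exp (-F y) * ((∑ i, partialDeriv i (X i) y
        + ∑ i, (∑ l, christoffel G l i l y) * X i y) - ∑ i, partialDeriv i F y * X i y) := by
  have hd : DifferentiableAt ℝ (density G) y :=
    (hG.contDiffOn_density.contDiffAt (hG.isOpen.mem_nhds hy)).differentiableAt (by simp)
  have he : DifferentiableAt ℝ (fun z => Real.exp (-F z)) y := hF.neg.exp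
  have he' : ∀ i, partialDeriv i (fun z => Real.exp (-F z)) y
      = -(Real.exp (-F y) * partialDeriv i F y) := fun i => by
    simp only [partialDeriv]
    rw [fderiv_exp hF.fun_neg, fderiv_fun_neg]
    simp
  rw [← Finset.sum_add_distrib, ← Finset.sum_sub_distrib, Finset.mul_sum]
  refine Finset.sum_congr rfl fun i _ => ?_
  rw [partialDeriv_mul (hd.fun_mul he) (hX i), partialDeriv_mul hd he, he',
    partialDeriv_density hG hy]
  ring

/-- For `S` the variation of the metric, the raised tensor `A⁻¹ S A⁻¹` is minus the derivative of
the inverse metric; this form is the one that appears when `g^ij` is differentiated. -/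
theorem metricPairing_eq_sum {A : Matrix (Fin n) (Fin n) ℝ} (hA : A.IsSymm)
    (S T : Matrix (Fin n) (Fin n) ℝ) :
    metricPairing A S T = ∑ k, ∑ l, (A⁻¹ * S * A⁻¹) k l * T k l := by
  have hI : ∀ a b, A⁻¹ a b = A⁻¹ b a := fun a b => by
    have := congrFun (congrFun (Matrix.transpose_nonsing_inv A) b) a
    rw [hA.eq] at this
    simpa using this
  simp only [metricPairing, Matrix.mul_apply, Finset.sum_mul]
  calc _ = ∑ i, ∑ k, ∑ j, ∑ l, A⁻¹ i k * A⁻¹ j l * S i j * T k l :=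
        Finset.sum_congr rfl fun i _ => Finset.sum_comm
    _ = ∑ k, ∑ i, ∑ j, ∑ l, A⁻¹ i k * A⁻¹ j l * S i j * T k l := Finset.sum_comm
    _ = ∑ k, ∑ i, ∑ l, ∑ j, A⁻¹ i k * A⁻¹ j l * S i j * T k l :=
        Finset.sum_congr rfl fun k _ => Finset.sum_congr rfl fun i _ => Finset.sum_comm
    _ = ∑ k, ∑ l, ∑ i, ∑ j, A⁻¹ i k * A⁻¹ j l * S i j * T k l :=
        Finset.sum_congr rfl fun k _ => Finset.sum_comm
    _ = ∑ k, ∑ l, ∑ j, ∑ i, A⁻¹ i k * A⁻¹ j l * S i j * T k l :=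
        Finset.sum_congr rfl fun k _ => Finset.sum_congr rfl fun l _ => Finset.sum_comm
    _ = _ := by
        refine Finset.sum_congr rfl fun k _ => Finset.sum_congr rfl fun l _ =>
          Finset.sum_congr rfl fun j _ => Finset.sum_congr rfl fun i _ => ?_
        rw [hI i k]
        ring

end Static


/-! ### The contracted Palatini identity -/

section Palatini

variable {n : ℕ}

theorem sum_reindex₄ {f g : Fin n → Fin n → Fin n → Fin n → ℝ}
    (e : Fin n × Fin n × Fin n × Fin n ≃ Fin n × Fin n × Fin n × Fin n)
    (h : ∀ i j k l, f i j k l = g (e (i, j, k, l)).1 (e (i, j, k, l)).2.1 (e (i, j, k, l)).2.2.1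
      (e (i, j, k, l)).2.2.2) :
    ∑ i, ∑ j, ∑ k, ∑ l, f i j k l = ∑ i, ∑ j, ∑ k, ∑ l, g i j k l := by
  have key : ∀ f : Fin n → Fin n → Fin n → Fin n → ℝ, ∑ i, ∑ j, ∑ k, ∑ l, f i j k l
      = ∑ x : Fin n × Fin n × Fin n × Fin n, f x.1 x.2.1 x.2.2.1 x.2.2.2 := fun f => by
    simp only [Fintype.sum_prod_type]
  rw [key, key]
  exact Fintype.sum_equiv e _ _ fun x => h x.1 x.2.1 x.2.2.1 x.2.2.2

theorem sum_rotate₃ (f : Fin n → Fin n → Fin n → ℝ) :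
    ∑ i, ∑ j, ∑ k, f i j k = ∑ k, ∑ i, ∑ j, f i j k := by
  rw [← (Finset.sum_comm (f := fun i k => ∑ j, f i j k))]
  exact Finset.sum_congr rfl fun i _ => Finset.sum_comm

/-- The index algebra behind `g^jk δR_jk = div W`. Here `a` stands for the inverse metric, `C` for
`δΓ` and `dC` for its partial derivatives, and the derivative of `a` has been replaced by its
expression in `Γ`. After expansion every term matches another one by renaming summation indices, in
some cases using the symmetry of `Γ`. -/
theorem palatini_contraction {a : Fin n → Fin n → ℝ} {Γ C : Fin n → Fin n → Fin n → ℝ}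
    {dC : Fin n → Fin n → Fin n → Fin n → ℝ} (hΓ : ∀ k i j, Γ k i j = Γ k j i) :
    ∑ j, ∑ k, a j k * ∑ i, (dC i i j k - dC j i i k + ∑ m, ((C i i m * Γ m j k + Γ i i m * C m j k)
        - (C i j m * Γ m i k + Γ i j m * C m i k)))
      = ∑ i, (∑ j, ∑ k, ((-∑ l, (Γ j i l * a l k + a j l * Γ k i l)) * C i j k + a j k * dC i i j k)
          - ∑ j, ((-∑ l, (Γ i i l * a l j + a i l * Γ j i l)) * ∑ k, C k k j
            + a i j * ∑ k, dC i k k j))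
        + ∑ i, (∑ l, Γ l i l) * (∑ j, ∑ k, a j k * C i j k - ∑ j, a i j * ∑ k, C k k j) := by
  have e1 : ∑ j, ∑ k, ∑ i, a j k * dC i i j k = ∑ i, ∑ j, ∑ k, a j k * dC i i j k := sum_rotate₃ _
  have e2 : ∑ j, ∑ k, ∑ i, a j k * dC j i i k = ∑ i, ∑ j, ∑ k, a i j * dC i k k j :=
    rfl
  have e3 : ∑ j, ∑ k, ∑ i, ∑ m, a j k * (C i i m * Γ m j k)
      = ∑ i, ∑ j, ∑ k, ∑ l, a i l * Γ j i l * C k k j :=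
    sum_reindex₄ ⟨fun x => (x.1, x.2.2.2, x.2.2.1, x.2.1), fun x => (x.1, x.2.2.2, x.2.2.1, x.2.1),
      fun _ => rfl, fun _ => rfl⟩ fun i j k l => by dsimp only [Equiv.coe_fn_mk]; ring
  have e4 : ∑ j, ∑ k, ∑ i, ∑ m, a j k * (Γ i i m * C m j k)
      = ∑ i, ∑ j, ∑ k, ∑ l, Γ l i l * (a j k * C i j k) :=
    sum_reindex₄ ⟨fun x => (x.2.2.2, x.1, x.2.1, x.2.2.1), fun x => (x.2.1, x.2.2.1, x.2.2.2, x.1),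
      fun _ => rfl, fun _ => rfl⟩ fun i j k l => by
        dsimp only [Equiv.coe_fn_mk]; rw [hΓ k k l]; ring
  have e5 : ∑ j, ∑ k, ∑ i, ∑ m, a j k * (C i j m * Γ m i k)
      = ∑ i, ∑ j, ∑ k, ∑ l, a j l * Γ k i l * C i j k :=
    sum_reindex₄ ⟨fun x => (x.2.2.1, x.1, x.2.2.2, x.2.1), fun x => (x.2.1, x.2.2.2, x.1, x.2.2.1),
      fun _ => rfl, fun _ => rfl⟩ fun i j k l => by dsimp only [Equiv.coe_fn_mk]; ring
  have e6 : ∑ j, ∑ k, ∑ i, ∑ m, a j k * (Γ i j m * C m i k)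
      = ∑ i, ∑ j, ∑ k, ∑ l, Γ j i l * a l k * C i j k :=
    sum_reindex₄ ⟨fun x => (x.2.2.2, x.2.2.1, x.2.1, x.1), fun x => (x.2.2.2, x.2.2.1, x.2.1, x.1),
      fun _ => rfl, fun _ => rfl⟩ fun i j k l => by
        dsimp only [Equiv.coe_fn_mk]; rw [hΓ k i l]; ring
  -- Both sides belong to the right-hand side of the claim and cancel there: the derivative of `a`
  -- in the trace part of the field against the correction from the volume density.
  have e7 : ∑ i, ∑ j, ∑ k, ∑ l, Γ i i l * a l j * C k k j
      = ∑ i, ∑ j, ∑ k, ∑ l, Γ l i l * (a i j * C k k j) :=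
    sum_reindex₄ ⟨fun x => (x.2.2.2, x.2.1, x.2.2.1, x.1), fun x => (x.2.2.2, x.2.1, x.2.2.1, x.1),
      fun _ => rfl, fun _ => rfl⟩ fun i j k l => by
        dsimp only [Equiv.coe_fn_mk]; rw [hΓ i i l]; ring
  simp only [Finset.mul_sum, Finset.sum_mul, mul_add, mul_sub, add_mul, neg_mul,
    Finset.sum_add_distrib, Finset.sum_sub_distrib, Finset.sum_neg_distrib]
  linarith only [e1, e2, e3, e4, e5, e6, e7]

end Palatini

/-! ### First variation of the local geometric quantities -/

section Families

open scoped Topology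

variable {n : ℕ} {Ω : Set (ℝ × EuclideanSpace ℝ (Fin n))}
  {G : ℝ → EuclideanSpace ℝ (Fin n) → Matrix (Fin n) (Fin n) ℝ} {s : ℝ}
  {y : EuclideanSpace ℝ (Fin n)}

theorem contDiffOn_slice {u : ℝ → EuclideanSpace ℝ (Fin n) → ℝ}
    (hu : ContDiffOn ℝ ∞ (fun p : ℝ × _ => u p.1 p.2) Ω) (s : ℝ) :
    ContDiffOn ℝ ∞ (u s) {z | (s, z) ∈ Ω} :=
  hu.comp (contDiff_const.prodMk contDiff_id).contDiffOn fun _ hz => hz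

theorem IsMetricFamilyOn.slice (hG : IsMetricFamilyOn Ω G) (s : ℝ) :
    IsMetricOn {z | (s, z) ∈ Ω} (G s) where
  isOpen := hG.isOpen.preimage (Continuous.prodMk_right s)
  contDiffOn i j := contDiffOn_slice (u := fun s z => G s z i j) (hG.contDiffOn i j) s
  symm := hG.symm s
  det_pos _ hz := hG.det_pos _ hz

theorem IsMetricFamilyOn.contDiffOn_inv (hG : IsMetricFamilyOn Ω G) (i j : Fin n) :
    ContDiffOn ℝ ∞ (fun p : ℝ × _ => (G p.1 p.2)⁻¹ i j) Ω :=
  PerelmanEntropy.contDiffOn_inv hG.contDiffOn (fun p hp => (hG.det_pos p hp).ne') i j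

theorem IsMetricFamilyOn.contDiffOn_density (hG : IsMetricFamilyOn Ω G) :
    ContDiffOn ℝ ∞ (fun p : ℝ × _ => density (G p.1) p.2) Ω :=
  (contDiffOn_det hG.contDiffOn).sqrt fun p hp => (hG.det_pos p hp).ne'

theorem IsMetricFamilyOn.contDiffOn_christoffel (hG : IsMetricFamilyOn Ω G) (k i j : Fin n) :
    ContDiffOn ℝ ∞ (fun p : ℝ × _ => christoffel (G p.1) k i j p.2) Ω := by
  unfold christoffel
  have h := fun l a b => contDiffOn_partialDeriv_slice (u := fun s z => G s z a b) hG.isOpen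
    (hG.contDiffOn a b) l
  exact contDiffOn_const.mul (ContDiffOn.sum fun l _ => (hG.contDiffOn_inv k l).mul
    (((h i j l).add (h j i l)).sub (h l i j)))

theorem IsMetricFamilyOn.contDiffOn_ricci (hG : IsMetricFamilyOn Ω G) (i j : Fin n) :
    ContDiffOn ℝ ∞ (fun p : ℝ × _ => ricci (G p.1) p.2 i j) Ω := by
  simp only [ricci, riemann, Matrix.of_apply]
  refine ContDiffOn.sum fun l _ => ContDiffOn.add (ContDiffOn.sub ?_ ?_)
    (ContDiffOn.sum fun m _ => ContDiffOn.sub (ContDiffOn.mul ?_ ?_) (ContDiffOn.mul ?_ ?_))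
  · exact contDiffOn_partialDeriv_slice (u := fun s => christoffel (G s) l i j) hG.isOpen
      (hG.contDiffOn_christoffel l i j) l
  · exact contDiffOn_partialDeriv_slice (u := fun s => christoffel (G s) l l j) hG.isOpen
      (hG.contDiffOn_christoffel l l j) i
  all_goals exact hG.contDiffOn_christoffel _ _ _

theorem IsMetricFamilyOn.contDiffOn_hessian (hG : IsMetricFamilyOn Ω G)
    {u : ℝ → EuclideanSpace ℝ (Fin n) → ℝ}
    (hu : ContDiffOn ℝ ∞ (fun p : ℝ × _ => u p.1 p.2) Ω) (i j : Fin n) :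
    ContDiffOn ℝ ∞ (fun p : ℝ × _ => hessian (G p.1) (u p.1) p.2 i j) Ω := by
  simp only [hessian, Matrix.of_apply]
  have h1 := fun k => contDiffOn_partialDeriv_slice hG.isOpen hu k
  exact (contDiffOn_partialDeriv_slice (u := fun s => partialDeriv j (u s)) hG.isOpen (h1 j) i).sub
    (ContDiffOn.sum fun k _ => (hG.contDiffOn_christoffel k i j).mul (h1 k))

/-- The variation `δΓ^k_ij` of the Christoffel symbols. -/
noncomputable def christoffelVariation
    (G : ℝ → EuclideanSpace ℝ (Fin n) → Matrix (Fin n) (Fin n) ℝ) (s : ℝ) (k i j : Fin n)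
    (y : EuclideanSpace ℝ (Fin n)) : ℝ :=
  deriv (fun t => christoffel (G t) k i j y) s

theorem christoffelVariation_symm (hS : ∀ s y, (G s y).IsSymm) (k i j : Fin n) :
    christoffelVariation G s k i j y = christoffelVariation G s k j i y := by
  simp only [christoffelVariation, christoffel_symm (hS _) k i j]

theorem hasDerivAt_christoffel (hG : IsMetricFamilyOn Ω G) (hy : (s, y) ∈ Ω) (k i j : Fin n) :
    HasDerivAt (fun t => christoffel (G t) k i j y) (christoffelVariation G s k i j y) s :=
  (hasDerivAt_slice hG.isOpen (hG.contDiffOn_christoffel k i j) hy).differentiableAt.hasDerivAt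

theorem contDiffOn_christoffelVariation (hG : IsMetricFamilyOn Ω G) (s : ℝ) (k i j : Fin n) :
    ContDiffOn ℝ ∞ (christoffelVariation G s k i j) {z | (s, z) ∈ Ω} :=
  contDiffOn_slice (u := fun s y => deriv (fun t => christoffel (G t) k i j y) s)
    (contDiffOn_deriv_slice hG.isOpen (hG.contDiffOn_christoffel k i j)) s

/-- The variation `δR_jk` of the Ricci tensor. -/
noncomputable def ricciVariation
    (G : ℝ → EuclideanSpace ℝ (Fin n) → Matrix (Fin n) (Fin n) ℝ) (s : ℝ) (j k : Fin n)
    (y : EuclideanSpace ℝ (Fin n)) : ℝ :=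
  ∑ i, (partialDeriv i (christoffelVariation G s i j k) y
    - partialDeriv j (christoffelVariation G s i i k) y
    + ∑ m, ((christoffelVariation G s i i m y * christoffel (G s) m j k y
        + christoffel (G s) i i m y * christoffelVariation G s m j k y)
      - (christoffelVariation G s i j m y * christoffel (G s) m i k y
        + christoffel (G s) i j m y * christoffelVariation G s m i k y)))

theorem hasDerivAt_ricci (hG : IsMetricFamilyOn Ω G) (hy : (s, y) ∈ Ω) (j k : Fin n) :
    HasDerivAt (fun t => ricci (G t) y j k) (ricciVariation G s j k y) s := by
  simp only [ricci, riemann, Matrix.of_apply, ricciVariation]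
  have h1 := fun k i j => hasDerivAt_christoffel hG hy k i j
  have h2 := fun l k i j => hasDerivAt_partialDeriv hG.isOpen (hG.contDiffOn_christoffel k i j) hy
    (fun z hz => hasDerivAt_christoffel hG hz k i j) l
  exact HasDerivAt.fun_sum fun i _ => ((h2 i i j k).sub (h2 j i i k)).add
    (HasDerivAt.fun_sum fun m _ => ((h1 i i m).mul (h1 m j k)).sub ((h1 i j m).mul (h1 m i k)))

/-- The vector field `g^jk δΓ^i_jk - g^ij δΓ^k_kj`, whose divergence is `g^jk δR_jk`. -/
noncomputable def palatiniField
    (G : ℝ → EuclideanSpace ℝ (Fin n) → Matrix (Fin n) (Fin n) ℝ) (s : ℝ) (i : Fin n)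
    (y : EuclideanSpace ℝ (Fin n)) : ℝ :=
  ∑ j, ∑ k, (G s y)⁻¹ j k * christoffelVariation G s i j k y
    - ∑ j, (G s y)⁻¹ i j * ∑ k, christoffelVariation G s k k j y

theorem contDiffOn_palatiniField (hG : IsMetricFamilyOn Ω G) (s : ℝ) (i : Fin n) :
    ContDiffOn ℝ ∞ (palatiniField G s i) {z | (s, z) ∈ Ω} := by
  unfold palatiniField
  exact (ContDiffOn.sum fun j _ => ContDiffOn.sum fun k _ =>
      ((hG.slice s).contDiffOn_inv j k).mul (contDiffOn_christoffelVariation hG s i j k)).sub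
    (ContDiffOn.sum fun j _ => ((hG.slice s).contDiffOn_inv i j).mul
      (ContDiffOn.sum fun k _ => contDiffOn_christoffelVariation hG s k k j))

theorem differentiableAt_of_contDiffOn {U : Set (EuclideanSpace ℝ (Fin n))} (hU : IsOpen U)
    {u : EuclideanSpace ℝ (Fin n) → ℝ} (hu : ContDiffOn ℝ ∞ u U) (hy : y ∈ U) :
    DifferentiableAt ℝ u y :=
  (hu.contDiffAt (hU.mem_nhds hy)).differentiableAt (by simp)

/-- The left side is the Riemannian divergence in coordinates, the trace of `Γ` being the
logarithmic derivative of the density. Derivatives of the inverse metric are eliminated by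
compatibility, and the rest is `palatini_contraction`. -/
theorem divergence_palatiniField (hG : IsMetricFamilyOn Ω G) (hy : (s, y) ∈ Ω) :
    ∑ i, partialDeriv i (palatiniField G s i) y
        + ∑ i, (∑ l, christoffel (G s) l i l y) * palatiniField G s i y
      = ∑ j, ∑ k, (G s y)⁻¹ j k * ricciVariation G s j k y := by
  have hs := hG.slice s
  have dI : ∀ i j, DifferentiableAt ℝ (fun z => (G s z)⁻¹ i j) y := fun i j =>
    differentiableAt_of_contDiffOn hs.isOpen (hs.contDiffOn_inv i j) hy
  have dC : ∀ k i j, DifferentiableAt ℝ (christoffelVariation G s k i j) y := fun k i j =>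
    differentiableAt_of_contDiffOn hs.isOpen (contDiffOn_christoffelVariation hG s k i j) hy
  simp only [ricciVariation]
  rw [palatini_contraction (a := fun i j => (G s y)⁻¹ i j)
    (Γ := fun k i j => christoffel (G s) k i j y) (C := fun k i j => christoffelVariation G s k i j y)
    (dC := fun l k i j => partialDeriv l (christoffelVariation G s k i j) y)
    fun k i j => congrFun (christoffel_symm (hG.symm s) k i j) y]
  congr 1
  refine Finset.sum_congr rfl fun i _ => ?_
  have hd1 : ∀ j k, DifferentiableAt ℝ
      (fun z => (G s z)⁻¹ j k * christoffelVariation G s i j k z) y := fun j k =>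
    (dI j k).mul (dC i j k)
  have hd2 : ∀ j, DifferentiableAt ℝ (fun z => ∑ k, christoffelVariation G s k k j z) y :=
    fun j => DifferentiableAt.fun_sum fun k _ => dC k k j
  have hd3 : ∀ j, DifferentiableAt ℝ
      (fun z => (G s z)⁻¹ i j * ∑ k, christoffelVariation G s k k j z) y := fun j =>
    (dI i j).mul (hd2 j)
  have e : partialDeriv i (palatiniField G s i) y
      = partialDeriv i (fun z => ∑ j, ∑ k, (G s z)⁻¹ j k * christoffelVariation G s i j k z) y
        - partialDeriv i (fun z => ∑ j, (G s z)⁻¹ i j * ∑ k, christoffelVariation G s k k j z) y := by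
    unfold palatiniField
    simp only [partialDeriv]
    rw [fderiv_fun_sub (DifferentiableAt.fun_sum fun j _ => DifferentiableAt.fun_sum fun k _ =>
      hd1 j k) (DifferentiableAt.fun_sum fun j _ => hd3 j)]
    rfl
  rw [e, partialDeriv_sum _ fun j _ => DifferentiableAt.fun_sum fun k _ => hd1 j k,
    partialDeriv_sum _ fun j _ => hd3 j]
  congr 1
  · refine Finset.sum_congr rfl fun j _ => ?_
    rw [partialDeriv_sum _ fun k _ => hd1 j k]
    refine Finset.sum_congr rfl fun k _ => ?_
    rw [partialDeriv_mul (dI j k) (dC i j k), partialDeriv_inv hs hy]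
  · refine Finset.sum_congr rfl fun j _ => ?_
    rw [partialDeriv_mul (dI i j) (hd2 j), partialDeriv_inv hs hy,
      partialDeriv_sum _ fun k _ => dC k k j]

end Families


/-! ### Index algebra for the divergence of a contracted 2-tensor -/

section Algebra

variable {n : ℕ}

theorem sum_reindex₃ {f g : Fin n → Fin n → Fin n → ℝ}
    (e : Fin n × Fin n × Fin n ≃ Fin n × Fin n × Fin n)
    (h : ∀ i j k, f i j k = g (e (i, j, k)).1 (e (i, j, k)).2.1 (e (i, j, k)).2.2) :
    ∑ i, ∑ j, ∑ k, f i j k = ∑ i, ∑ j, ∑ k, g i j k := by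
  have key : ∀ f : Fin n → Fin n → Fin n → ℝ, ∑ i, ∑ j, ∑ k, f i j k
      = ∑ x : Fin n × Fin n × Fin n, f x.1 x.2.1 x.2.2 := fun f => by
    simp only [Fintype.sum_prod_type]
  rw [key, key]
  exact Fintype.sum_equiv e _ _ fun x => h x.1 x.2.1 x.2.2

/-- A divergence rule for `w^ij f_j`, when `∂w` has connection terms in `Γ` and variation terms in
`C`. One `Γ` term cancels against the trace of `Γ` from the density, another turns `D` into a
Hessian, and the `C` terms form the remainder. With `a = C = 0` it also computes the divergence of a
gradient. -/
theorem divergence_raised_algebra {a w D : Fin n → Fin n → ℝ} {f : Fin n → ℝ}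
    {Γ C : Fin n → Fin n → Fin n → ℝ} (ha : ∀ i j, a i j = a j i)
    (hΓ : ∀ k i j, Γ k i j = Γ k j i) :
    ∑ i, ∑ j, ((∑ l, ((C i i l * a l j - Γ i i l * w l j) + (a i l * C j i l - w i l * Γ j i l)))
        * f j + w i j * D i j) + ∑ i, (∑ l, Γ l i l) * ∑ j, w i j * f j
      = ∑ k, ∑ l, w k l * (D k l - ∑ m, Γ m k l * f m)
        + ∑ i, f i * (∑ j, ∑ k, a j k * C i j k + ∑ j, a i j * ∑ k, C k k j) := by
  have t1 : ∑ i, ∑ j, ∑ l, C i i l * a l j * f j = ∑ i, ∑ j, ∑ k, f i * (a i j * C k k j) :=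
    sum_reindex₃ ⟨fun x => (x.2.1, x.2.2, x.1), fun x => (x.2.2, x.1, x.2.1),
      fun _ => rfl, fun _ => rfl⟩ fun i j l => by
        dsimp only [Equiv.coe_fn_mk]; rw [ha l j]; ring
  have t2 : ∑ i, ∑ j, ∑ l, Γ i i l * w l j * f j = ∑ i, ∑ j, ∑ l, Γ l i l * (w i j * f j) :=
    sum_reindex₃ ⟨fun x => (x.2.2, x.2.1, x.1), fun x => (x.2.2, x.2.1, x.1),
      fun _ => rfl, fun _ => rfl⟩ fun i j l => by
        dsimp only [Equiv.coe_fn_mk]; rw [hΓ i i l]; ring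
  have t3 : ∑ i, ∑ j, ∑ l, a i l * C j i l * f j = ∑ i, ∑ j, ∑ k, f i * (a j k * C i j k) :=
    sum_reindex₃ ⟨fun x => (x.2.1, x.1, x.2.2), fun x => (x.2.1, x.1, x.2.2),
      fun _ => rfl, fun _ => rfl⟩ fun i j l => by
        dsimp only [Equiv.coe_fn_mk]; ring
  have t4 : ∑ i, ∑ j, ∑ l, w i l * Γ j i l * f j = ∑ k, ∑ l, ∑ m, w k l * (Γ m k l * f m) :=
    sum_reindex₃ ⟨fun x => (x.1, x.2.2, x.2.1), fun x => (x.1, x.2.2, x.2.1),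
      fun _ => rfl, fun _ => rfl⟩ fun i j l => by
        dsimp only [Equiv.coe_fn_mk]; ring
  have t5 : ∑ i, ∑ l, ∑ j, Γ l i l * (w i j * f j) = ∑ i, ∑ j, ∑ l, Γ l i l * (w i j * f j) :=
    Finset.sum_congr rfl fun i _ => Finset.sum_comm
  simp only [Finset.mul_sum, Finset.sum_mul, mul_add, mul_sub, add_mul, sub_mul,
    Finset.sum_add_distrib, Finset.sum_sub_distrib]
  linarith only [t1, t2, t3, t4, t5]

end Algebra

/-! ### Local form of the entropy integrand -/

section LocalQuantities

variable {n : ℕ}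

/-- The scalar curvature of a matrix of metric coefficients. -/
noncomputable def localScalar (G : EuclideanSpace ℝ (Fin n) → Matrix (Fin n) (Fin n) ℝ)
    (y : EuclideanSpace ℝ (Fin n)) : ℝ :=
  metricTrace (G y) (ricci G y)

/-- The squared length of a gradient in coordinates. -/
noncomputable def localGradSq (G : EuclideanSpace ℝ (Fin n) → Matrix (Fin n) (Fin n) ℝ)
    (u : EuclideanSpace ℝ (Fin n) → ℝ) (y : EuclideanSpace ℝ (Fin n)) : ℝ :=
  ∑ i, ∑ j, (G y)⁻¹ i j * partialDeriv i u y * partialDeriv j u y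

/-- The Laplacian in coordinates. -/
noncomputable def localLaplacian (G : EuclideanSpace ℝ (Fin n) → Matrix (Fin n) (Fin n) ℝ)
    (u : EuclideanSpace ℝ (Fin n) → ℝ) (y : EuclideanSpace ℝ (Fin n)) : ℝ :=
  metricTrace (G y) (hessian G u y)

/-- The entropy integrand in coordinates. -/
noncomputable def localEntropy (G : EuclideanSpace ℝ (Fin n) → Matrix (Fin n) (Fin n) ℝ)
    (u : EuclideanSpace ℝ (Fin n) → ℝ) (τ : ℝ) (y : EuclideanSpace ℝ (Fin n)) : ℝ :=
  (τ * (localGradSq G u y + localScalar G y) + u y - n)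
    * ((4 * Real.pi * τ) ^ (-(n : ℝ) / 2) * Real.exp (-u y))

/-- The integrand of the first variation in coordinates. -/
noncomputable def localVariation (G : EuclideanSpace ℝ (Fin n) → Matrix (Fin n) (Fin n) ℝ)
    (u : EuclideanSpace ℝ (Fin n) → ℝ) (τ : ℝ)
    (V : EuclideanSpace ℝ (Fin n) → Matrix (Fin n) (Fin n) ℝ)
    (H : EuclideanSpace ℝ (Fin n) → ℝ) (σ : ℝ) (y : EuclideanSpace ℝ (Fin n)) : ℝ :=
  (σ * (localScalar G y + localGradSq G u y)
      - τ * metricPairing (G y) (V y) (ricci G y + hessian G u y)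
      + H y
      + (τ * (2 * localLaplacian G u y - localGradSq G u y + localScalar G y) + u y - n)
        * (metricTrace (G y) (V y) / 2 - H y - n * σ / (2 * τ)))
    * ((4 * Real.pi * τ) ^ (-(n : ℝ) / 2) * Real.exp (-u y))

end LocalQuantities

/-! ### Divergence identities along a family of metrics -/

section LocalVariation

open scoped Topology

variable {n : ℕ} {Ω : Set (ℝ × EuclideanSpace ℝ (Fin n))}
  {G : ℝ → EuclideanSpace ℝ (Fin n) → Matrix (Fin n) (Fin n) ℝ} {s : ℝ}
  {V : EuclideanSpace ℝ (Fin n) → Matrix (Fin n) (Fin n) ℝ}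
  {F : ℝ → EuclideanSpace ℝ (Fin n) → ℝ} {H : EuclideanSpace ℝ (Fin n) → ℝ}
  {y : EuclideanSpace ℝ (Fin n)}

/-- The variation is only given pointwise; its smoothness is inherited from the family, since it
must coincide with the parameter derivative. -/
theorem contDiffOn_of_hasDerivAt (hΩ : IsOpen Ω)
    (hF : ContDiffOn ℝ ∞ (fun p : ℝ × _ => F p.1 p.2) Ω)
    (hH : ∀ z, (s, z) ∈ Ω → HasDerivAt (fun t => F t z) (H z) s) :
    ContDiffOn ℝ ∞ H {z | (s, z) ∈ Ω} :=
  (contDiffOn_slice (u := fun s z => deriv (fun t => F t z) s)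
    (contDiffOn_deriv_slice hΩ hF) s).congr fun z hz => (hH z hz).deriv.symm

theorem inv_symm {A : Matrix (Fin n) (Fin n) ℝ} (hA : A.IsSymm) (i j : Fin n) :
    A⁻¹ i j = A⁻¹ j i := by
  have := congrFun (congrFun (Matrix.transpose_nonsing_inv A) j) i
  rwa [hA.eq] at this

theorem metricTrace_eq_trace (A T : Matrix (Fin n) (Fin n) ℝ) :
    metricTrace A T = (A⁻¹ * T.transpose).trace := by
  simp [metricTrace, Matrix.trace, Matrix.mul_apply]

/-- The variation of a metric is symmetric. -/
theorem variation_symm (hG : IsMetricFamilyOn Ω G) (hy : (s, y) ∈ Ω)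
    (hV : ∀ z, (s, z) ∈ Ω → ∀ i j, HasDerivAt (fun t => G t z i j) (V z i j) s) :
    (V y).IsSymm := by
  ext i j
  refine (hV y hy j i).unique ?_
  have := hV y hy i j
  simp only [← fun t => (hG.symm t y).apply i j] at this
  exact this

theorem contDiffOn_raised (hG : IsMetricFamilyOn Ω G)
    (hV : ∀ z, (s, z) ∈ Ω → ∀ i j, HasDerivAt (fun t => G t z i j) (V z i j) s) (i j : Fin n) :
    ContDiffOn ℝ ∞ (fun z => ((G s z)⁻¹ * V z * (G s z)⁻¹) i j) {z | (s, z) ∈ Ω} := by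
  simp only [Matrix.mul_apply]
  have hI := (hG.slice s).contDiffOn_inv
  have hV' : ∀ i j, ContDiffOn ℝ ∞ (fun z => V z i j) {z | (s, z) ∈ Ω} := fun i j =>
    contDiffOn_of_hasDerivAt (F := fun t z => G t z i j) hG.isOpen (hG.contDiffOn i j)
      fun z hz => hV z hz i j
  exact ContDiffOn.sum fun k _ => (ContDiffOn.sum fun l _ => (hI i l).mul (hV' l k)).mul (hI k j)

/-- Up to sign the raised variation is the parameter derivative of the inverse metric. Its spatial
derivative is therefore the parameter derivative of the compatibility relation `partialDeriv_inv`,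
which brings in `δΓ` without any formula for it. -/
theorem partialDeriv_raised (hG : IsMetricFamilyOn Ω G) (hy : (s, y) ∈ Ω)
    (hV : ∀ z, (s, z) ∈ Ω → ∀ i j, HasDerivAt (fun t => G t z i j) (V z i j) s) (k i j : Fin n) :
    partialDeriv k (fun z => ((G s z)⁻¹ * V z * (G s z)⁻¹) i j) y
      = ∑ l, ((christoffelVariation G s i k l y * (G s y)⁻¹ l j
            - christoffel (G s) i k l y * ((G s y)⁻¹ * V y * (G s y)⁻¹) l j)
          + ((G s y)⁻¹ i l * christoffelVariation G s j k l y
            - ((G s y)⁻¹ * V y * (G s y)⁻¹) i l * christoffel (G s) j k l y)) := by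
  have hI : ∀ i j z, (s, z) ∈ Ω → HasDerivAt (fun t => (G t z)⁻¹ i j)
      (-((G s z)⁻¹ * V z * (G s z)⁻¹) i j) s := fun i j z hz =>
    hasDerivAt_inv (hV z hz) (hG.det_pos _ hz).ne' i j
  have h1 := hasDerivAt_partialDeriv (u := fun t z => (G t z)⁻¹ i j) hG.isOpen
    (hG.contDiffOn_inv i j) hy (V := fun z => -((G s z)⁻¹ * V z * (G s z)⁻¹) i j) (hI i j) k
  have h2 : HasDerivAt (fun t => partialDeriv k (fun z => (G t z)⁻¹ i j) y) _ s :=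
    (HasDerivAt.fun_sum (u := Finset.univ) fun l _ =>
      ((hasDerivAt_christoffel hG hy i k l).mul (hI l j y hy)).add
        ((hI i l y hy).mul (hasDerivAt_christoffel hG hy j k l))).neg.congr_of_eventuallyEq (by
          filter_upwards [eventually_mem_left hG.isOpen hy] with t ht
          exact partialDeriv_inv (hG.slice t) ht k i j)
  have h3 := h1.unique h2
  have h4 : partialDeriv k (fun z => -((G s z)⁻¹ * V z * (G s z)⁻¹) i j) y
      = -partialDeriv k (fun z => ((G s z)⁻¹ * V z * (G s z)⁻¹) i j) y := by
    simp only [partialDeriv]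
    rw [fderiv_fun_neg]
    rfl
  rw [h4, neg_inj] at h3
  rw [h3]
  exact Finset.sum_congr rfl fun l _ => by ring

theorem hasDerivAt_density (hG : IsMetricFamilyOn Ω G) (hy : (s, y) ∈ Ω)
    (hV : ∀ z, (s, z) ∈ Ω → ∀ i j, HasDerivAt (fun t => G t z i j) (V z i j) s) :
    HasDerivAt (fun t => density (G t) y)
      (density (G s) y * (metricTrace (G s y) (V y) / 2)) s := by
  rw [metricTrace_eq_trace, variation_symm hG hy hV]
  exact hasDerivAt_sqrt_det (hV y hy) (hG.det_pos _ hy)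

theorem contDiffOn_metricTrace_variation (hG : IsMetricFamilyOn Ω G)
    (hV : ∀ z, (s, z) ∈ Ω → ∀ i j, HasDerivAt (fun t => G t z i j) (V z i j) s) :
    ContDiffOn ℝ ∞ (fun z => metricTrace (G s z) (V z)) {z | (s, z) ∈ Ω} := by
  have hV' : ∀ i j, ContDiffOn ℝ ∞ (fun z => V z i j) {z | (s, z) ∈ Ω} := fun i j =>
    contDiffOn_of_hasDerivAt (F := fun t z => G t z i j) hG.isOpen (hG.contDiffOn i j)
      fun z hz => hV z hz i j
  exact ContDiffOn.sum fun i _ => ContDiffOn.sum fun j _ =>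
    ((hG.slice s).contDiffOn_inv i j).mul (hV' i j)

/-- The mixed derivative of `√det g` is computed in both orders. The terms containing `Γ` itself
agree, and division by the positive density leaves `∂_k(v/2) = δΓ^l_kl`. -/
theorem partialDeriv_metricTrace_variation (hG : IsMetricFamilyOn Ω G) (hy : (s, y) ∈ Ω)
    (hV : ∀ z, (s, z) ∈ Ω → ∀ i j, HasDerivAt (fun t => G t z i j) (V z i j) s) (k : Fin n) :
    partialDeriv k (fun z => metricTrace (G s z) (V z) / 2) y
      = ∑ l, christoffelVariation G s l k l y := by
  have hs := hG.slice s
  have h1 := hasDerivAt_partialDeriv (u := fun t => density (G t)) hG.isOpen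
    hG.contDiffOn_density hy (fun z hz => hasDerivAt_density hG hz hV) k
  have h2 : HasDerivAt (fun t => partialDeriv k (density (G t)) y) _ s :=
    ((hasDerivAt_density hG hy hV).mul (HasDerivAt.fun_sum (u := Finset.univ) fun l _ =>
      hasDerivAt_christoffel hG hy l k l)).congr_of_eventuallyEq (by
          filter_upwards [eventually_mem_left hG.isOpen hy] with t ht
          exact partialDeriv_density (hG.slice t) ht k)
  have h3 := h1.unique h2
  have hd : DifferentiableAt ℝ (fun z => metricTrace (G s z) (V z) / 2) y := by
    simp only [div_eq_mul_inv]
    exact (differentiableAt_of_contDiffOn hs.isOpen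
      (contDiffOn_metricTrace_variation hG hV) hy).mul_const _
  rw [partialDeriv_mul (differentiableAt_of_contDiffOn hs.isOpen hs.contDiffOn_density hy) hd,
    partialDeriv_density hs hy] at h3
  have hp := (hs.density_pos hy).ne'
  apply mul_left_cancel₀ hp
  linear_combination h3

/-- The two contractions of `δΓ` enter here with the same sign and in `palatiniField` with opposite
signs. In the weighted divergence the first therefore disappears and the second is doubled. -/
theorem divergence_raised (hG : IsMetricFamilyOn Ω G) (hy : (s, y) ∈ Ω)
    (hV : ∀ z, (s, z) ∈ Ω → ∀ i j, HasDerivAt (fun t => G t z i j) (V z i j) s)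
    {u : EuclideanSpace ℝ (Fin n) → ℝ} (hu : ContDiffOn ℝ ∞ u {z | (s, z) ∈ Ω}) :
    ∑ i, partialDeriv i
        (fun z => ∑ j, ((G s z)⁻¹ * V z * (G s z)⁻¹) i j * partialDeriv j u z) y
        + ∑ i, (∑ l, christoffel (G s) l i l y)
          * ∑ j, ((G s y)⁻¹ * V y * (G s y)⁻¹) i j * partialDeriv j u y
      = metricPairing (G s y) (V y) (hessian (G s) u y)
        + ∑ i, partialDeriv i u y * (∑ j, ∑ k, (G s y)⁻¹ j k * christoffelVariation G s i j k y
            + ∑ j, (G s y)⁻¹ i j * ∑ k, christoffelVariation G s k k j y) := by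
  have hs := hG.slice s
  have hu' := fun j => contDiffOn_partialDeriv hs.isOpen hu j
  have d1 : ∀ i j, DifferentiableAt ℝ (fun z => ((G s z)⁻¹ * V z * (G s z)⁻¹) i j) y :=
    fun i j => differentiableAt_of_contDiffOn hs.isOpen (contDiffOn_raised hG hV i j) hy
  have d2 : ∀ j, DifferentiableAt ℝ (partialDeriv j u) y :=
    fun j => differentiableAt_of_contDiffOn hs.isOpen (hu' j) hy
  have e1 : ∀ i, partialDeriv i
      (fun z => ∑ j, ((G s z)⁻¹ * V z * (G s z)⁻¹) i j * partialDeriv j u z) y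
      = ∑ j, (partialDeriv i (fun z => ((G s z)⁻¹ * V z * (G s z)⁻¹) i j) y * partialDeriv j u y
        + ((G s y)⁻¹ * V y * (G s y)⁻¹) i j * partialDeriv i (partialDeriv j u) y) := fun i => by
    rw [partialDeriv_sum _ fun j _ => (d1 i j).fun_mul (d2 j)]
    exact Finset.sum_congr rfl fun j _ => partialDeriv_mul (d1 i j) (d2 j)
  simp only [e1, partialDeriv_raised hG hy hV, metricPairing_eq_sum (hG.symm s y)]
  generalize hW : (G s y)⁻¹ * V y * (G s y)⁻¹ = w
  simp only [hessian, Matrix.of_apply]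
  have hΓ := fun k i j => congrFun (christoffel_symm (hG.symm s) k i j) y
  have ha := fun i j => inv_symm (hG.symm s y) i j
  exact divergence_raised_algebra (a := fun i j => (G s y)⁻¹ i j) (w := fun i j => w i j)
    (Γ := fun k i j => christoffel (G s) k i j y)
    (C := fun k i j => christoffelVariation G s k i j y) (f := fun j => partialDeriv j u y)
    (D := fun i j => partialDeriv i (partialDeriv j u) y) ha hΓ

theorem divergence_smul_gradient {U : Set (EuclideanSpace ℝ (Fin n))}
    {A : EuclideanSpace ℝ (Fin n) → Matrix (Fin n) (Fin n) ℝ} (hA : IsMetricOn U A) (hy : y ∈ U)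
    {q u : EuclideanSpace ℝ (Fin n) → ℝ} (hq : DifferentiableAt ℝ q y)
    (hu : ContDiffOn ℝ ∞ u U) :
    ∑ i, partialDeriv i (fun z => q z * ∑ j, (A z)⁻¹ i j * partialDeriv j u z) y
        + ∑ i, (∑ l, christoffel A l i l y) * (q y * ∑ j, (A y)⁻¹ i j * partialDeriv j u y)
      = q y * localLaplacian A u y
        + ∑ i, partialDeriv i q y * ∑ j, (A y)⁻¹ i j * partialDeriv j u y := by
  have hu' := fun j => contDiffOn_partialDeriv hA.isOpen hu j
  have d1 : ∀ i j, DifferentiableAt ℝ (fun z => (A z)⁻¹ i j) y :=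
    fun i j => differentiableAt_of_contDiffOn hA.isOpen (hA.contDiffOn_inv i j) hy
  have d2 : ∀ j, DifferentiableAt ℝ (partialDeriv j u) y :=
    fun j => differentiableAt_of_contDiffOn hA.isOpen (hu' j) hy
  have d3 : ∀ i, DifferentiableAt ℝ (fun z => ∑ j, (A z)⁻¹ i j * partialDeriv j u z) y :=
    fun i => DifferentiableAt.fun_sum fun j _ => (d1 i j).fun_mul (d2 j)
  have e1 : ∀ i, partialDeriv i (fun z => ∑ j, (A z)⁻¹ i j * partialDeriv j u z) y
      = ∑ j, (partialDeriv i (fun z => (A z)⁻¹ i j) y * partialDeriv j u y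
        + (A y)⁻¹ i j * partialDeriv i (partialDeriv j u) y) := fun i => by
    rw [partialDeriv_sum _ fun j _ => (d1 i j).fun_mul (d2 j)]
    exact Finset.sum_congr rfl fun j _ => partialDeriv_mul (d1 i j) (d2 j)
  simp only [fun i => partialDeriv_mul (k := i) hq (d3 i), e1, partialDeriv_inv hA hy,
    localLaplacian, metricTrace, hessian, Matrix.of_apply]
  have hΓ := fun k i j => congrFun (christoffel_symm hA.symm k i j) y
  -- The inverse metric has the derivative rule of `w` with no variation terms, hence the choice `a
  -- = C = 0`.
  have key := divergence_raised_algebra (a := fun _ _ => 0) (w := fun i j => (A y)⁻¹ i j)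
    (Γ := fun k i j => christoffel A k i j y) (C := fun k i j => 0)
    (f := fun j => partialDeriv j u y)
    (D := fun i j => partialDeriv i (partialDeriv j u) y) (fun _ _ => rfl) hΓ
  simp only [mul_zero, Finset.sum_const_zero, zero_sub, add_zero, ← neg_add,
    Finset.sum_neg_distrib] at key
  rw [← key, mul_add, Finset.mul_sum, Finset.mul_sum, Finset.sum_add_distrib]
  have : ∀ i, (∑ l, christoffel A l i l y) * (q y * ∑ j, (A y)⁻¹ i j * partialDeriv j u y)
      = q y * ((∑ l, christoffel A l i l y) * ∑ j, (A y)⁻¹ i j * partialDeriv j u y) :=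
    fun i => by ring
  simp only [this]
  ring

end LocalVariation


/-! ### First variation of the entropy density in coordinates -/

section LocalFirstVariation

open scoped Topology

variable {n : ℕ} {Ω : Set (ℝ × EuclideanSpace ℝ (Fin n))}
  {G : ℝ → EuclideanSpace ℝ (Fin n) → Matrix (Fin n) (Fin n) ℝ} {s : ℝ}
  {V : EuclideanSpace ℝ (Fin n) → Matrix (Fin n) (Fin n) ℝ}
  {F : ℝ → EuclideanSpace ℝ (Fin n) → ℝ} {H : EuclideanSpace ℝ (Fin n) → ℝ}
  {y : EuclideanSpace ℝ (Fin n)} {τ : ℝ → ℝ} {σ : ℝ}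

theorem hasDerivAt_localScalar (hG : IsMetricFamilyOn Ω G) (hy : (s, y) ∈ Ω)
    (hV : ∀ z, (s, z) ∈ Ω → ∀ i j, HasDerivAt (fun t => G t z i j) (V z i j) s) :
    HasDerivAt (fun t => localScalar (G t) y)
      (-metricPairing (G s y) (V y) (ricci (G s) y)
        + ∑ j, ∑ k, (G s y)⁻¹ j k * ricciVariation G s j k y) s := by
  have hI : ∀ i j, HasDerivAt (fun t => (G t y)⁻¹ i j)
      (-((G s y)⁻¹ * V y * (G s y)⁻¹) i j) s := fun i j =>
    hasDerivAt_inv (hV y hy) (hG.det_pos _ hy).ne' i j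
  have h : HasDerivAt (fun t => localScalar (G t) y) _ s :=
    HasDerivAt.fun_sum (u := Finset.univ) fun i _ => HasDerivAt.fun_sum (u := Finset.univ)
      fun j _ => (hI i j).mul (hasDerivAt_ricci hG hy i j)
  refine h.congr_deriv ?_
  rw [metricPairing_eq_sum (hG.symm s y)]
  simp only [Finset.sum_add_distrib, neg_mul, Finset.sum_neg_distrib]

theorem hasDerivAt_localGradSq (hG : IsMetricFamilyOn Ω G) (hy : (s, y) ∈ Ω)
    (hV : ∀ z, (s, z) ∈ Ω → ∀ i j, HasDerivAt (fun t => G t z i j) (V z i j) s)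
    (hF : ContDiffOn ℝ ∞ (fun p : ℝ × _ => F p.1 p.2) Ω)
    (hH : ∀ z, (s, z) ∈ Ω → HasDerivAt (fun t => F t z) (H z) s) :
    HasDerivAt (fun t => localGradSq (G t) (F t) y)
      (-(∑ i, partialDeriv i (F s) y
          * ∑ j, ((G s y)⁻¹ * V y * (G s y)⁻¹) i j * partialDeriv j (F s) y)
        + 2 * ∑ i, partialDeriv i H y * ∑ j, (G s y)⁻¹ i j * partialDeriv j (F s) y) s := by
  have hI : ∀ i j, HasDerivAt (fun t => (G t y)⁻¹ i j)
      (-((G s y)⁻¹ * V y * (G s y)⁻¹) i j) s := fun i j =>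
    hasDerivAt_inv (hV y hy) (hG.det_pos _ hy).ne' i j
  have hd := fun i => hasDerivAt_partialDeriv hG.isOpen hF hy hH i
  have h : HasDerivAt (fun t => localGradSq (G t) (F t) y) _ s :=
    HasDerivAt.fun_sum (u := Finset.univ) fun i _ => HasDerivAt.fun_sum (u := Finset.univ)
      fun j _ => ((hI i j).mul (hd i)).mul (hd j)
  refine h.congr_deriv ?_
  have e1 : ∑ i, ∑ j, (G s y)⁻¹ i j * partialDeriv i (F s) y * partialDeriv j H y
      = ∑ i, partialDeriv i H y * ∑ j, (G s y)⁻¹ i j * partialDeriv j (F s) y := by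
    simp only [Finset.mul_sum]
    rw [Finset.sum_comm]
    refine Finset.sum_congr rfl fun i _ => Finset.sum_congr rfl fun j _ => ?_
    rw [inv_symm (hG.symm s y) j i]
    ring
  have e2 : ∑ i, ∑ j, (G s y)⁻¹ i j * partialDeriv i H y * partialDeriv j (F s) y
      = ∑ i, partialDeriv i H y * ∑ j, (G s y)⁻¹ i j * partialDeriv j (F s) y := by
    simp only [Finset.mul_sum]
    exact Finset.sum_congr rfl fun i _ => Finset.sum_congr rfl fun j _ => by ring
  have e3 : ∑ i, ∑ j, ((G s y)⁻¹ * V y * (G s y)⁻¹) i j * partialDeriv i (F s) y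
        * partialDeriv j (F s) y
      = ∑ i, partialDeriv i (F s) y
        * ∑ j, ((G s y)⁻¹ * V y * (G s y)⁻¹) i j * partialDeriv j (F s) y := by
    simp only [Finset.mul_sum]
    exact Finset.sum_congr rfl fun i _ => Finset.sum_congr rfl fun j _ => by ring
  simp only [Pi.mul_apply, add_mul, neg_mul, Finset.sum_add_distrib, Finset.sum_neg_distrib]
  linarith only [e1, e2, e3]

/-- The factor `v/2 - h - nσ/(2τ)`: the logarithmic derivative of `(4πτ)^(-n/2) e^(-f) dV`. -/
noncomputable def measureVariation
    (G : ℝ → EuclideanSpace ℝ (Fin n) → Matrix (Fin n) (Fin n) ℝ) (s : ℝ)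
    (V : EuclideanSpace ℝ (Fin n) → Matrix (Fin n) (Fin n) ℝ)
    (H : EuclideanSpace ℝ (Fin n) → ℝ) (c : ℝ) (y : EuclideanSpace ℝ (Fin n)) : ℝ :=
  metricTrace (G s y) (V y) / 2 - H y - c

/-- The vector field whose weighted divergence is the difference between the derivative of the
entropy density and the integrand of the first variation. -/
noncomputable def entropyField
    (G : ℝ → EuclideanSpace ℝ (Fin n) → Matrix (Fin n) (Fin n) ℝ) (s : ℝ)
    (u : EuclideanSpace ℝ (Fin n) → ℝ)
    (V : EuclideanSpace ℝ (Fin n) → Matrix (Fin n) (Fin n) ℝ)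
    (H : EuclideanSpace ℝ (Fin n) → ℝ) (c : ℝ) (i : Fin n) (y : EuclideanSpace ℝ (Fin n)) : ℝ :=
  palatiniField G s i y
    + ∑ j, ((G s y)⁻¹ * V y * (G s y)⁻¹) i j * partialDeriv j u y
    - 2 * (measureVariation G s V H c y * ∑ j, (G s y)⁻¹ i j * partialDeriv j u y)

theorem contDiffOn_measureVariation (hG : IsMetricFamilyOn Ω G)
    (hV : ∀ z, (s, z) ∈ Ω → ∀ i j, HasDerivAt (fun t => G t z i j) (V z i j) s)
    (hF : ContDiffOn ℝ ∞ (fun p : ℝ × _ => F p.1 p.2) Ω)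
    (hH : ∀ z, (s, z) ∈ Ω → HasDerivAt (fun t => F t z) (H z) s) (c : ℝ) :
    ContDiffOn ℝ ∞ (measureVariation G s V H c) {z | (s, z) ∈ Ω} :=
  (((contDiffOn_metricTrace_variation hG hV).div_const 2).sub
    (contDiffOn_of_hasDerivAt hG.isOpen hF hH)).sub contDiffOn_const

theorem contDiffOn_entropyField (hG : IsMetricFamilyOn Ω G)
    (hV : ∀ z, (s, z) ∈ Ω → ∀ i j, HasDerivAt (fun t => G t z i j) (V z i j) s)
    (hF : ContDiffOn ℝ ∞ (fun p : ℝ × _ => F p.1 p.2) Ω)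
    (hH : ∀ z, (s, z) ∈ Ω → HasDerivAt (fun t => F t z) (H z) s) (c : ℝ) (i : Fin n) :
    ContDiffOn ℝ ∞ (entropyField G s (F s) V H c i) {z | (s, z) ∈ Ω} := by
  have hs := hG.slice s
  have hu' := fun j => contDiffOn_partialDeriv hs.isOpen (contDiffOn_slice hF s) j
  exact ((contDiffOn_palatiniField hG s i).add (ContDiffOn.sum fun j _ =>
    (contDiffOn_raised hG hV i j).mul (hu' j))).sub
    (contDiffOn_const.mul ((contDiffOn_measureVariation hG hV hF hH c).mul
      (ContDiffOn.sum fun j _ => (hs.contDiffOn_inv i j).mul (hu' j))))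

/-- The pointwise identity behind the first variation formula. -/
theorem weighted_divergence_entropyField (hG : IsMetricFamilyOn Ω G) (hy : (s, y) ∈ Ω)
    (hV : ∀ z, (s, z) ∈ Ω → ∀ i j, HasDerivAt (fun t => G t z i j) (V z i j) s)
    (hF : ContDiffOn ℝ ∞ (fun p : ℝ × _ => F p.1 p.2) Ω)
    (hH : ∀ z, (s, z) ∈ Ω → HasDerivAt (fun t => F t z) (H z) s) (c : ℝ) :
    (∑ i, partialDeriv i (entropyField G s (F s) V H c i) y
        + ∑ i, (∑ l, christoffel (G s) l i l y) * entropyField G s (F s) V H c i y)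
        - ∑ i, partialDeriv i (F s) y * entropyField G s (F s) V H c i y
      = ∑ j, ∑ k, (G s y)⁻¹ j k * ricciVariation G s j k y
        + metricPairing (G s y) (V y) (hessian (G s) (F s) y)
        + (-(∑ i, partialDeriv i (F s) y
          * ∑ j, ((G s y)⁻¹ * V y * (G s y)⁻¹) i j * partialDeriv j (F s) y)
        + 2 * ∑ i, partialDeriv i H y * ∑ j, (G s y)⁻¹ i j * partialDeriv j (F s) y)
        - 2 * measureVariation G s V H c y
          * (localLaplacian (G s) (F s) y - localGradSq (G s) (F s) y) := by
  have hs := hG.slice s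
  have hu := contDiffOn_slice hF s
  have hu' := fun j => contDiffOn_partialDeriv hs.isOpen hu j
  have hq := differentiableAt_of_contDiffOn hs.isOpen
    (contDiffOn_measureVariation hG hV hF hH c) hy
  have d1 : ∀ i, DifferentiableAt ℝ (palatiniField G s i) y := fun i =>
    differentiableAt_of_contDiffOn hs.isOpen (contDiffOn_palatiniField hG s i) hy
  have d2 : ∀ i, DifferentiableAt ℝ
      (fun z => ∑ j, ((G s z)⁻¹ * V z * (G s z)⁻¹) i j * partialDeriv j (F s) z) y := fun i =>
    differentiableAt_of_contDiffOn hs.isOpen (ContDiffOn.sum fun j _ =>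
      (contDiffOn_raised hG hV i j).mul (hu' j)) hy
  have d3 : ∀ i, DifferentiableAt ℝ (fun z => measureVariation G s V H c z
      * ∑ j, (G s z)⁻¹ i j * partialDeriv j (F s) z) y := fun i =>
    differentiableAt_of_contDiffOn hs.isOpen ((contDiffOn_measureVariation hG hV hF hH c).mul
      (ContDiffOn.sum fun j _ => (hs.contDiffOn_inv i j).mul (hu' j))) hy
  have e : ∀ i, partialDeriv i (entropyField G s (F s) V H c i) y
      = partialDeriv i (palatiniField G s i) y
        + partialDeriv i
          (fun z => ∑ j, ((G s z)⁻¹ * V z * (G s z)⁻¹) i j * partialDeriv j (F s) z) y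
        - 2 * partialDeriv i (fun z => measureVariation G s V H c z
          * ∑ j, (G s z)⁻¹ i j * partialDeriv j (F s) z) y := fun i => by
    unfold entropyField
    simp only [partialDeriv] at d1 d2 d3 ⊢
    rw [fderiv_fun_sub ((d1 i).fun_add (d2 i)) ((d3 i).const_mul 2),
      fderiv_fun_add (d1 i) (d2 i), fderiv_const_mul (d3 i)]
    simp
  have eq : ∀ i, partialDeriv i (measureVariation G s V H c) y
      = ∑ l, christoffelVariation G s l i l y - partialDeriv i H y := fun i => by
    rw [← partialDeriv_metricTrace_variation hG hy hV]
    unfold measureVariation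
    have hd : DifferentiableAt ℝ (fun z => metricTrace (G s z) (V z) / 2) y := by
      simp only [div_eq_mul_inv]
      exact (differentiableAt_of_contDiffOn hs.isOpen
        (contDiffOn_metricTrace_variation hG hV) hy).mul_const _
    have hd2 : DifferentiableAt ℝ H y :=
      differentiableAt_of_contDiffOn hs.isOpen (contDiffOn_of_hasDerivAt hG.isOpen hF hH) hy
    simp only [partialDeriv]
    rw [fderiv_sub_const, fderiv_fun_sub hd hd2]
    rfl
  have h1 := divergence_palatiniField hG hy
  have h2 := divergence_raised hG hy hV hu
  have h3 := divergence_smul_gradient hs hy hq hu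
  simp only [eq] at h3
  simp only [e]
  set W := fun i => palatiniField G s i y with hW
  set X := fun i => ∑ j, ((G s y)⁻¹ * V y * (G s y)⁻¹) i j * partialDeriv j (F s) y with hX
  set N := fun i => ∑ j, (G s y)⁻¹ i j * partialDeriv j (F s) y with hN
  set A := fun i => ∑ j, ∑ k, (G s y)⁻¹ j k * christoffelVariation G s i j k y with hA
  set B := fun i => ∑ j, (G s y)⁻¹ i j * ∑ k, christoffelVariation G s k k j y with hB
  set q := measureVariation G s V H c y with hqd
  have eE : ∀ i, entropyField G s (F s) V H c i y = W i + X i - 2 * (q * N i) := fun i => rfl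
  have eW : ∀ i, W i = A i - B i := fun i => rfl
  -- The gradient of `v/2` inside `-2⟨∇q, ∇f⟩` is a trace of `δΓ`. It cancels the doubled trace term
  -- left by the Palatini field and `divergence_raised`, so that only `2⟨∇h, ∇f⟩` survives.
  have eB : ∑ i, (∑ l, christoffelVariation G s l i l y) * N i
      = ∑ i, partialDeriv i (F s) y * B i := by
    simp only [hB, hN, Finset.mul_sum, Finset.sum_mul]
    rw [Finset.sum_comm]
    refine Finset.sum_congr rfl fun i _ => Finset.sum_congr rfl fun j _ =>
      Finset.sum_congr rfl fun k _ => ?_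
    rw [inv_symm (hG.symm s y) j i, christoffelVariation_symm hG.symm k j k]
    ring
  have eN : localGradSq (G s) (F s) y = ∑ i, partialDeriv i (F s) y * N i := by
    simp only [localGradSq, hN, Finset.mul_sum]
    exact Finset.sum_congr rfl fun i _ => Finset.sum_congr rfl fun j _ => by ring
  have eA : ∑ i, partialDeriv i (F s) y * W i = ∑ i, partialDeriv i (F s) y * A i
      - ∑ i, partialDeriv i (F s) y * B i := by
    simp only [eW, mul_sub, Finset.sum_sub_distrib]
  have eQ : ∑ i, partialDeriv i (F s) y * (2 * (q * N i))
      = 2 * q * ∑ i, partialDeriv i (F s) y * N i := by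
    rw [Finset.mul_sum]
    exact Finset.sum_congr rfl fun i _ => by ring
  have eR : ∑ i, (∑ l, christoffel (G s) l i l y) * (2 * (q * N i))
      = 2 * ∑ i, (∑ l, christoffel (G s) l i l y) * (q * N i) := by
    rw [Finset.mul_sum]
    exact Finset.sum_congr rfl fun i _ => by ring
  simp only [sub_mul, Finset.sum_sub_distrib] at h3
  simp only [mul_add, Finset.sum_add_distrib] at h2
  simp only [eE, mul_add, mul_sub, Finset.sum_add_distrib, Finset.sum_sub_distrib,
    ← Finset.mul_sum, eA, eQ, eR, eN]
  change _ + ∑ i, (∑ l, christoffel (G s) l i l y) * W i = _ at h1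
  change _ + ∑ i, (∑ l, christoffel (G s) l i l y) * X i
    = _ + (∑ i, partialDeriv i (F s) y * A i + ∑ i, partialDeriv i (F s) y * B i) at h2
  linear_combination h1 + h2 - 2 * h3 - 2 * eB

/-- In coordinates, the entropy density changes by the integrand of the first variation and a
divergence. -/
theorem hasDerivAt_localEntropy (hG : IsMetricFamilyOn Ω G) (hy : (s, y) ∈ Ω)
    (hV : ∀ z, (s, z) ∈ Ω → ∀ i j, HasDerivAt (fun t => G t z i j) (V z i j) s)
    (hF : ContDiffOn ℝ ∞ (fun p : ℝ × _ => F p.1 p.2) Ω)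
    (hH : ∀ z, (s, z) ∈ Ω → HasDerivAt (fun t => F t z) (H z) s)
    (hτ : 0 < τ s) (hσ : HasDerivAt τ σ s) :
    HasDerivAt (fun t => localEntropy (G t) (F t) (τ t) y * density (G t) y)
      (localVariation (G s) (F s) (τ s) V H σ y * density (G s) y
        + τ s * (4 * Real.pi * τ s) ^ (-(n : ℝ) / 2) * ∑ i, partialDeriv i (fun z =>
          density (G s) z * Real.exp (-F s z)
            * entropyField G s (F s) V H (n * σ / (2 * τ s)) i z) y) s := by
  have hs := hG.slice s
  rw [sum_partialDeriv_weighted hs hy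
    (differentiableAt_of_contDiffOn hs.isOpen (contDiffOn_slice hF s) hy)
    (fun i => differentiableAt_of_contDiffOn hs.isOpen
      (contDiffOn_entropyField hG hV hF hH _ i) hy),
    weighted_divergence_entropyField hG hy hV hF hH]
  have hpos : 0 < 4 * Real.pi * τ s := by positivity
  -- The logarithmic derivative of `(4πτ)^(-n/2)` is `-nσ/(2τ)`; this is the constant `c` in the
  -- measure variation.
  have hc : HasDerivAt (fun t => (4 * Real.pi * τ t) ^ (-(n : ℝ) / 2))
      ((4 * Real.pi * τ s) ^ (-(n : ℝ) / 2) * (-(n * σ / (2 * τ s)))) s := by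
    refine ((hσ.const_mul (4 * Real.pi)).rpow_const (p := -(n : ℝ) / 2)
      (Or.inl hpos.ne')).congr_deriv ?_
    rw [Real.rpow_sub_one hpos.ne']
    have := Real.pi_pos
    field_simp
  have hFd := hH y hy
  have h := ((((hσ.mul ((hasDerivAt_localGradSq hG hy hV hF hH).add
    (hasDerivAt_localScalar hG hy hV))).add hFd).sub_const (n : ℝ)).mul
    (hc.mul hFd.neg.exp)).mul (hasDerivAt_density hG hy hV)
  refine h.congr_deriv ?_
  have hadd : metricPairing (G s y) (V y) (ricci (G s) y + hessian (G s) (F s) y)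
      = metricPairing (G s y) (V y) (ricci (G s) y)
        + metricPairing (G s y) (V y) (hessian (G s) (F s) y) := by
    simp only [metricPairing, Matrix.add_apply, mul_add, Finset.sum_add_distrib]
  simp only [localVariation, measureVariation, hadd, Pi.add_apply, Pi.mul_apply, Pi.neg_apply]
  ring

end LocalFirstVariation


/-! ### Coordinate-free form of the Christoffel symbols -/

theorem hasFDerivAt_sum_smul {X N ι : Type*} [NormedAddCommGroup X] [NormedSpace ℝ X]
    [NormedAddCommGroup N] [NormedSpace ℝ N] [Fintype ι] {c : ι → X → ℝ} (b : ι → N) {y : X}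
    (hc : ∀ i, DifferentiableAt ℝ (c i) y) :
    HasFDerivAt (fun z => ∑ i, c i z • b i) (∑ i, (fderiv ℝ (c i) y).smulRight (b i)) y :=
  HasFDerivAt.fun_sum fun i _ => (hc i).hasFDerivAt.smul_const (b i)

section Generic

variable {X N ι : Type*} [NormedAddCommGroup X] [NormedSpace ℝ X]
  [NormedAddCommGroup N] [NormedSpace ℝ N] [Fintype ι] {c : ι → X → ℝ} {y : X}

theorem differentiableAt_sum_smul_bilinear (b : ι → X →L[ℝ] X →L[ℝ] N)
    (hc : ∀ i, DifferentiableAt ℝ (c i) y) :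
    DifferentiableAt ℝ (fun z => ∑ i, c i z • b i) y :=
  (hasFDerivAt_sum_smul (N := X →L[ℝ] X →L[ℝ] N) b hc).differentiableAt

theorem fderiv_sum_smul_bilinear_apply (b : ι → X →L[ℝ] X →L[ℝ] N)
    (hc : ∀ i, DifferentiableAt ℝ (c i) y) (u v w : X) :
    fderiv ℝ (fun z => ∑ i, c i z • b i) y u v w = ∑ i, fderiv ℝ (c i) y u • b i v w := by
  rw [(hasFDerivAt_sum_smul (N := X →L[ℝ] X →L[ℝ] N) b hc).fderiv]
  simp [sum_apply]

end Generic

section BilinearForms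

open scoped Topology

variable {n : ℕ} {U : Set (EuclideanSpace ℝ (Fin n))}
  {G : EuclideanSpace ℝ (Fin n) → Matrix (Fin n) (Fin n) ℝ} {y : EuclideanSpace ℝ (Fin n)}

/-- The bilinear form with matrix `A`. -/
noncomputable def bilinearForm (A : Matrix (Fin n) (Fin n) ℝ) :
    EuclideanSpace ℝ (Fin n) →L[ℝ] EuclideanSpace ℝ (Fin n) →L[ℝ] ℝ :=
  ∑ p : Fin n × Fin n, A p.1 p.2 •
    (EuclideanSpace.proj p.1 : EuclideanSpace ℝ (Fin n) →L[ℝ] ℝ).smulRight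
      (EuclideanSpace.proj p.2 : EuclideanSpace ℝ (Fin n) →L[ℝ] ℝ)

@[simp]
theorem bilinearForm_apply (A : Matrix (Fin n) (Fin n) ℝ) (X Y : EuclideanSpace ℝ (Fin n)) :
    bilinearForm A X Y = ∑ i, ∑ j, A i j * (X i * Y j) := by
  simp [bilinearForm, Fintype.sum_prod_type]

/-- The Christoffel symbols as a vector-valued bilinear form. -/
noncomputable def connectionForm (G : EuclideanSpace ℝ (Fin n) → Matrix (Fin n) (Fin n) ℝ)
    (y : EuclideanSpace ℝ (Fin n)) :
    EuclideanSpace ℝ (Fin n) →L[ℝ] EuclideanSpace ℝ (Fin n) →L[ℝ] EuclideanSpace ℝ (Fin n) :=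
  ∑ p : Fin n × Fin n × Fin n, christoffel G p.1 p.2.1 p.2.2 y •
    (EuclideanSpace.proj p.2.1 : EuclideanSpace ℝ (Fin n) →L[ℝ] ℝ).smulRight
      ((EuclideanSpace.proj p.2.2 : EuclideanSpace ℝ (Fin n) →L[ℝ] ℝ).smulRight
        (EuclideanSpace.single p.1 (1 : ℝ)))

theorem connectionForm_apply (X Y : EuclideanSpace ℝ (Fin n)) (k : Fin n) :
    connectionForm G y X Y k = ∑ i, ∑ j, christoffel G k i j y * (X i * Y j) := by
  simp [connectionForm, Fintype.sum_prod_type, Finset.sum_apply, Pi.single_apply]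

theorem bilinearForm_symm {A : Matrix (Fin n) (Fin n) ℝ} (hA : A.IsSymm)
    (X Y : EuclideanSpace ℝ (Fin n)) : bilinearForm A X Y = bilinearForm A Y X := by
  rw [bilinearForm_apply, bilinearForm_apply, Finset.sum_comm]
  refine Finset.sum_congr rfl fun i _ => Finset.sum_congr rfl fun j _ => ?_
  rw [hA.apply]
  ring

theorem differentiableAt_bilinearForm (hG : IsMetricOn U G) (hy : y ∈ U) :
    DifferentiableAt ℝ (fun z => bilinearForm (G z)) y :=
  differentiableAt_sum_smul_bilinear _ fun p : Fin n × Fin n => hG.differentiableAt hy p.1 p.2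

theorem fderiv_bilinearForm (hG : IsMetricOn U G) (hy : y ∈ U)
    (X Y Z : EuclideanSpace ℝ (Fin n)) :
    fderiv ℝ (fun z => bilinearForm (G z)) y X Y Z
      = ∑ i, ∑ j, ∑ k, X k * partialDeriv k (fun z => G z i j) y * (Y i * Z j) := by
  refine (fderiv_sum_smul_bilinear_apply _
    (fun p : Fin n × Fin n => hG.differentiableAt hy p.1 p.2) X Y Z).trans ?_
  simp [fderiv_apply_eq_sum, Finset.sum_mul, Fintype.sum_prod_type]

/-- For constant vector fields the brackets in the Koszul formula vanish. Together with
nondegeneracy it determines the connection from the metric without indices, which is what the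
transformation law needs. -/
theorem koszul (hG : IsMetricOn U G) (hy : y ∈ U) (X Y Z : EuclideanSpace ℝ (Fin n)) :
    2 * bilinearForm (G y) Z (connectionForm G y X Y)
      = fderiv ℝ (fun z => bilinearForm (G z)) y X Y Z
        + fderiv ℝ (fun z => bilinearForm (G z)) y Y X Z
        - fderiv ℝ (fun z => bilinearForm (G z)) y Z X Y := by
  have e0 : bilinearForm (G y) Z (connectionForm G y X Y)
      = ∑ m, ∑ i, ∑ j, Z m * X i * Y j * ∑ k, G y m k * christoffel G k i j y := by
    rw [bilinearForm_apply]
    refine Finset.sum_congr rfl fun m _ => ?_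
    simp only [connectionForm_apply, Finset.mul_sum]
    refine Eq.trans ?_
      (sum_rotate₃ fun i j k => Z m * X i * Y j * (G y m k * christoffel G k i j y)).symm
    exact Finset.sum_congr rfl fun k _ => Finset.sum_congr rfl fun i _ =>
      Finset.sum_congr rfl fun j _ => by ring
  rw [e0, fderiv_bilinearForm hG hy, fderiv_bilinearForm hG hy, fderiv_bilinearForm hG hy]
  have e1 : ∑ j, ∑ m, ∑ i, X i * partialDeriv i (fun z => G z j m) y * (Y j * Z m)
      = ∑ m, ∑ i, ∑ j, X i * partialDeriv i (fun z => G z j m) y * (Y j * Z m) :=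
    sum_reindex₃ ⟨fun x => (x.2.1, x.2.2, x.1), fun x => (x.2.2, x.1, x.2.1),
      fun _ => rfl, fun _ => rfl⟩ fun i j k => rfl
  have e2 : ∑ i, ∑ m, ∑ j, Y j * partialDeriv j (fun z => G z i m) y * (X i * Z m)
      = ∑ m, ∑ i, ∑ j, Y j * partialDeriv j (fun z => G z i m) y * (X i * Z m) :=
    Finset.sum_comm
  have e3 : ∑ i, ∑ j, ∑ m, Z m * partialDeriv m (fun z => G z i j) y * (X i * Y j)
      = ∑ m, ∑ i, ∑ j, Z m * partialDeriv m (fun z => G z i j) y * (X i * Y j) :=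
    sum_rotate₃ _
  rw [e1, e2, e3]
  simp only [sum_mul_christoffel hG hy, Finset.mul_sum, ← Finset.sum_add_distrib,
    ← Finset.sum_sub_distrib]
  exact Finset.sum_congr rfl fun m _ => Finset.sum_congr rfl fun i _ =>
    Finset.sum_congr rfl fun j _ => by ring

theorem eq_of_bilinearForm_eq {A : Matrix (Fin n) (Fin n) ℝ} (hA : A.det ≠ 0)
    {v w : EuclideanSpace ℝ (Fin n)} (h : ∀ Z, bilinearForm A Z v = bilinearForm A Z w) :
    v = w := by
  have h1 : A.mulVec v.ofLp = A.mulVec w.ofLp := by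
    funext i
    have := h (EuclideanSpace.single i 1)
    simpa [Pi.single_apply, Matrix.mulVec, dotProduct] using this
  have h2 := congrArg (A⁻¹.mulVec) h1
  simp only [Matrix.mulVec_mulVec, Matrix.nonsing_inv_mul _ hA.isUnit, Matrix.one_mulVec] at h2
  ext i
  exact congrFun h2 i

theorem differentiableAt_connectionForm (hG : IsMetricOn U G) (hy : y ∈ U) :
    DifferentiableAt ℝ (connectionForm G) y :=
  differentiableAt_sum_smul_bilinear _ fun p : Fin n × Fin n × Fin n =>
    differentiableAt_of_contDiffOn hG.isOpen (hG.contDiffOn_christoffel p.1 p.2.1 p.2.2) hy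

theorem fderiv_connectionForm_apply (hG : IsMetricOn U G) (hy : y ∈ U) (l i j k : Fin n) :
    fderiv ℝ (connectionForm G) y (EuclideanSpace.single l 1) (EuclideanSpace.single i 1)
      (EuclideanSpace.single j 1) k = partialDeriv l (christoffel G k i j) y := by
  have h := fderiv_sum_smul_bilinear_apply (fun p : Fin n × Fin n × Fin n =>
    (EuclideanSpace.proj p.2.1 : EuclideanSpace ℝ (Fin n) →L[ℝ] ℝ).smulRight
      ((EuclideanSpace.proj p.2.2 : EuclideanSpace ℝ (Fin n) →L[ℝ] ℝ).smulRight
        (EuclideanSpace.single p.1 (1 : ℝ)))) (fun p => differentiableAt_of_contDiffOn hG.isOpen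
      (hG.contDiffOn_christoffel p.1 p.2.1 p.2.2) hy) (EuclideanSpace.single l 1)
      (EuclideanSpace.single i 1) (EuclideanSpace.single j 1)
  refine (congrArg (fun v : EuclideanSpace ℝ (Fin n) => v k) h).trans ?_
  simp only [ContinuousLinearMap.smulRight_apply, _root_.smul_apply]
  simp [Fintype.sum_prod_type, partialDeriv, Pi.single_apply]

end BilinearForms


/-! ### Transformation of connections and curvature under a change of coordinates -/

section ChangeOfCoordinates

open scoped Topology

variable {E N : Type*} [NormedAddCommGroup E] [NormedSpace ℝ E]
  [NormedAddCommGroup N] [NormedSpace ℝ N]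
  {g g' : E → E →L[ℝ] E →L[ℝ] ℝ} {Γ Γ' : E → E →L[ℝ] E →L[ℝ] E} {ψ : E → E} {y : E}

theorem hasFDerivAt_fderiv (hψ : ContDiffAt ℝ ∞ ψ y) :
    HasFDerivAt (fderiv ℝ ψ) (fderiv ℝ (fderiv ℝ ψ) y) y :=
  ((hψ.fderiv_right (m := 1) two_le_infty).differentiableAt one_ne_zero).hasFDerivAt

theorem fderiv_fderiv_symm (hψ : ContDiffAt ℝ ∞ ψ y) (X Y : E) :
    fderiv ℝ (fderiv ℝ ψ) y X Y = fderiv ℝ (fderiv ℝ ψ) y Y X :=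
  (hψ.isSymmSndFDerivAt (by simpa using two_le_infty)).eq X Y

theorem hasDerivAt_along {A : E → N} (hA : DifferentiableAt ℝ A y) (X : E) :
    HasDerivAt (fun t : ℝ => A (y + t • X)) (fderiv ℝ A y X) 0 :=
  hA.hasFDerivAt.hasLineDerivAt X

theorem hasDerivAt_along_comp {A : E → N} (hA : DifferentiableAt ℝ A (ψ y))
    (hψ : HasFDerivAt ψ (fderiv ℝ ψ y) y) (X : E) :
    HasDerivAt (fun t : ℝ => A (ψ (y + t • X))) (fderiv ℝ A (ψ y) (fderiv ℝ ψ y X)) 0 :=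
  (hA.hasFDerivAt.comp y hψ).hasLineDerivAt X

theorem hasDerivAt_along_bilinear {A : E → E →L[ℝ] E →L[ℝ] N} (hA : DifferentiableAt ℝ A y)
    (X : E) : HasDerivAt (fun t : ℝ => A (y + t • X)) (fderiv ℝ A y X) 0 := by
  have h := hasDerivAt_along (A := A) (y := y)
  exact h hA X

theorem hasDerivAt_along_comp_bilinear {A : E → E →L[ℝ] E →L[ℝ] N}
    (hA : DifferentiableAt ℝ A (ψ y)) (hψ : HasFDerivAt ψ (fderiv ℝ ψ y) y) (X : E) :
    HasDerivAt (fun t : ℝ => A (ψ (y + t • X))) (fderiv ℝ A (ψ y) (fderiv ℝ ψ y X)) 0 := by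
  have h := hasDerivAt_along_comp (A := A) (y := y) (ψ := ψ)
  exact h hA hψ X

theorem eventually_along {p : E → Prop} (X : E) (hp : ∀ᶠ z in 𝓝 y, p z) :
    ∀ᶠ t : ℝ in 𝓝 0, p (y + t • X) := by
  have : Filter.Tendsto (fun t : ℝ => y + t • X) (𝓝 0) (𝓝 y) := by
    have h : Continuous fun t : ℝ => y + t • X := by fun_prop
    simpa using h.tendsto 0
  exact this.eventually hp

/-- Product rule along the line `y + tX`; the second derivatives of `ψ` come from the two Jacobian
factors of the pullback. -/
theorem fderiv_pullback_apply (hψ : ContDiffAt ℝ ∞ ψ y) (hg : DifferentiableAt ℝ g (ψ y))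
    (hg' : DifferentiableAt ℝ g' y)
    (hpull : ∀ᶠ z in 𝓝 y, ∀ X Y, g' z X Y = g (ψ z) (fderiv ℝ ψ z X) (fderiv ℝ ψ z Y))
    (X Y Z : E) :
    fderiv ℝ g' y X Y Z
      = fderiv ℝ g (ψ y) (fderiv ℝ ψ y X) (fderiv ℝ ψ y Y) (fderiv ℝ ψ y Z)
        + g (ψ y) (fderiv ℝ (fderiv ℝ ψ) y X Y) (fderiv ℝ ψ y Z)
        + g (ψ y) (fderiv ℝ ψ y Y) (fderiv ℝ (fderiv ℝ ψ) y X Z) := by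
  have hd : HasFDerivAt ψ (fderiv ℝ ψ y) y := (hψ.differentiableAt (by simp)).hasFDerivAt
  have hJ := hasFDerivAt_fderiv hψ
  have h0 : y + (0 : ℝ) • X = y := by simp
  have h1 := ((hasDerivAt_along_bilinear hg' X).clm_apply (hasDerivAt_const 0 Y)).clm_apply
    (hasDerivAt_const 0 Z)
  have h2 := ((hasDerivAt_along_comp_bilinear hg hd X).clm_apply
    ((hasDerivAt_along hJ.differentiableAt X).clm_apply (hasDerivAt_const 0 Y))).clm_apply
      ((hasDerivAt_along hJ.differentiableAt X).clm_apply (hasDerivAt_const 0 Z))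
  have h3 := h1.unique (h2.congr_of_eventuallyEq (by
    filter_upwards [eventually_along X hpull] with t ht
    exact ht Y Z))
  simp only [h0, map_zero, add_zero] at h3
  rw [h3]
  simp only [_root_.add_apply]

/-- The derivatives of the pulled-back metric are inserted into its Koszul formula. Of the six terms
with second derivatives of `ψ`, four cancel in pairs by symmetry and the other two coincide, giving
the inhomogeneous term. Surjectivity of the differential and nondegeneracy of `g` allow testing
against all vectors. -/
theorem connection_transform (hψ : ContDiffAt ℝ ∞ ψ y) (hg : DifferentiableAt ℝ g (ψ y))
    (hg' : DifferentiableAt ℝ g' y) (hsymm : ∀ X Y, g (ψ y) X Y = g (ψ y) Y X)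
    (hpull : ∀ᶠ z in 𝓝 y, ∀ X Y, g' z X Y = g (ψ z) (fderiv ℝ ψ z X) (fderiv ℝ ψ z Y))
    (hΓ : ∀ X Y Z, 2 * g (ψ y) Z (Γ (ψ y) X Y)
      = fderiv ℝ g (ψ y) X Y Z + fderiv ℝ g (ψ y) Y X Z - fderiv ℝ g (ψ y) Z X Y)
    (hΓ' : ∀ X Y Z, 2 * g' y Z (Γ' y X Y)
      = fderiv ℝ g' y X Y Z + fderiv ℝ g' y Y X Z - fderiv ℝ g' y Z X Y)
    (hsurj : Function.Surjective (fderiv ℝ ψ y))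
    (hnd : ∀ v w, (∀ Z, g (ψ y) Z v = g (ψ y) Z w) → v = w) (X Y : E) :
    fderiv ℝ ψ y (Γ' y X Y)
      = Γ (ψ y) (fderiv ℝ ψ y X) (fderiv ℝ ψ y Y) + fderiv ℝ (fderiv ℝ ψ) y X Y := by
  refine hnd _ _ fun W => ?_
  obtain ⟨Z, rfl⟩ := hsurj W
  have h := hΓ' X Y Z
  simp only [fderiv_pullback_apply hψ hg hg' hpull, hpull.self_of_nhds] at h
  have h2 := hΓ (fderiv ℝ ψ y X) (fderiv ℝ ψ y Y) (fderiv ℝ ψ y Z)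
  rw [map_add]
  rw [fderiv_fderiv_symm hψ Y X, fderiv_fderiv_symm hψ Z X, fderiv_fderiv_symm hψ Z Y] at h
  have s1 := hsymm (fderiv ℝ (fderiv ℝ ψ) y X Y) (fderiv ℝ ψ y Z)
  have s2 := hsymm (fderiv ℝ (fderiv ℝ ψ) y X Z) (fderiv ℝ ψ y Y)
  linarith

/-- The curvature `R(X, Y) Z` of a connection, for constant vector fields. -/
noncomputable def curvatureForm (Γ : E → E →L[ℝ] E →L[ℝ] E) (y X Y Z : E) : E :=
  fderiv ℝ Γ y X Y Z - fderiv ℝ Γ y Y X Z + (Γ y X (Γ y Y Z) - Γ y Y (Γ y X Z))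

/-- The connection law is differentiated along `X` and antisymmetrized in `X` and `Y`. Third
derivatives of `ψ` drop out by symmetry, and the terms with second derivatives cancel once the law
itself is used to rewrite the quadratic part of the curvature. -/
theorem curvatureForm_transform (hψ : ContDiffAt ℝ ∞ ψ y) (hΓ : DifferentiableAt ℝ Γ (ψ y))
    (hΓ' : DifferentiableAt ℝ Γ' y)
    (h : ∀ᶠ z in 𝓝 y, ∀ X Y, fderiv ℝ ψ z (Γ' z X Y)
      = Γ (ψ z) (fderiv ℝ ψ z X) (fderiv ℝ ψ z Y) + fderiv ℝ (fderiv ℝ ψ) z X Y) (X Y Z : E) :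
    fderiv ℝ ψ y (curvatureForm Γ' y X Y Z)
      = curvatureForm Γ (ψ y) (fderiv ℝ ψ y X) (fderiv ℝ ψ y Y) (fderiv ℝ ψ y Z) := by
  have hd : HasFDerivAt ψ (fderiv ℝ ψ y) y := (hψ.differentiableAt (by simp)).hasFDerivAt
  have hJ := hasFDerivAt_fderiv hψ
  have hψ' : ContDiffAt ℝ ∞ (fderiv ℝ ψ) y := hψ.fderiv_right (by simp)
  have hJ2 : HasFDerivAt (fderiv ℝ (fderiv ℝ ψ)) (fderiv ℝ (fderiv ℝ (fderiv ℝ ψ)) y) y :=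
    ((hψ'.fderiv_right (m := 1) two_le_infty).differentiableAt one_ne_zero).hasFDerivAt
  have hs3 : ∀ X Y Z, fderiv ℝ (fderiv ℝ (fderiv ℝ ψ)) y X Y Z
      = fderiv ℝ (fderiv ℝ (fderiv ℝ ψ)) y Y X Z := fun X Y Z => by
    rw [(hψ'.isSymmSndFDerivAt (by simpa using two_le_infty)).eq X Y]
  have key : ∀ X Y Z, fderiv ℝ (fderiv ℝ ψ) y X (Γ' y Y Z) + fderiv ℝ ψ y (fderiv ℝ Γ' y X Y Z)
      = fderiv ℝ Γ (ψ y) (fderiv ℝ ψ y X) (fderiv ℝ ψ y Y) (fderiv ℝ ψ y Z)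
        + Γ (ψ y) (fderiv ℝ (fderiv ℝ ψ) y X Y) (fderiv ℝ ψ y Z)
        + Γ (ψ y) (fderiv ℝ ψ y Y) (fderiv ℝ (fderiv ℝ ψ) y X Z)
        + fderiv ℝ (fderiv ℝ (fderiv ℝ ψ)) y X Y Z := fun X Y Z => by
    have h0 : y + (0 : ℝ) • X = y := by simp
    have h1 := (hasDerivAt_along hJ.differentiableAt X).clm_apply
      (((hasDerivAt_along_bilinear hΓ' X).clm_apply (hasDerivAt_const 0 Y)).clm_apply
        (hasDerivAt_const 0 Z))
    have h2 := (((hasDerivAt_along_comp_bilinear hΓ hd X).clm_apply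
      ((hasDerivAt_along hJ.differentiableAt X).clm_apply (hasDerivAt_const 0 Y))).clm_apply
        ((hasDerivAt_along hJ.differentiableAt X).clm_apply (hasDerivAt_const 0 Z))).add
      (((hasDerivAt_along_bilinear hJ2.differentiableAt X).clm_apply (hasDerivAt_const 0 Y)).clm_apply
        (hasDerivAt_const 0 Z))
    have h3 := h1.unique (h2.congr_of_eventuallyEq (by
      filter_upwards [eventually_along X h] with t ht
      exact ht Y Z))
    simp only [h0, map_zero, add_zero] at h3
    rw [h3]
    simp only [_root_.add_apply]
  have h0 := h.self_of_nhds
  have k1 := key X Y Z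
  have k2 := key Y X Z
  rw [fderiv_fderiv_symm hψ Y X, hs3 Y X Z] at k2
  simp only [curvatureForm, map_add, map_sub, h0]
  -- The claim is the difference of the two instances of `key`, written as an identity in the
  -- additive group `E`.
  rw [← sub_eq_zero] at k1 k2 ⊢
  rw [← sub_zero (0 : E)]
  nth_rewrite 1 [← k1]
  rw [← k2]
  abel

theorem apply_sum_smul {ι : Type*} [Fintype ι] (L : E →L[ℝ] N) (c : ι → ℝ) (v : ι → E) :
    L (∑ i, c i • v i) = ∑ i, c i • L (v i) := by
  simp

theorem apply_sum_smul_apply {ι : Type*} [Fintype ι] (B : E →L[ℝ] E →L[ℝ] E) (c : ι → ℝ)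
    (v : ι → E) (Z : E) : B (∑ i, c i • v i) Z = ∑ i, c i • B (v i) Z := by
  simp only [map_sum, map_smul, sum_apply, _root_.smul_apply]

theorem fderiv_sum_apply {ι : Type*} [Fintype ι] (c : ι → ℝ) (v : ι → E) (Y Z : E) :
    fderiv ℝ Γ y (∑ i, c i • v i) Y Z = ∑ i, c i • fderiv ℝ Γ y (v i) Y Z := by
  have h := apply_sum_smul (ι := ι) (fderiv ℝ Γ y)
  rw [h c v]
  simp only [sum_apply, _root_.smul_apply]

theorem curvatureForm_sum₁ {ι : Type*} [Fintype ι] (c : ι → ℝ) (v : ι → E) (Y Z : E) :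
    curvatureForm Γ y (∑ i, c i • v i) Y Z = ∑ i, c i • curvatureForm Γ y (v i) Y Z := by
  unfold curvatureForm
  rw [fderiv_sum_apply]
  generalize fderiv ℝ Γ y Y = B
  rw [apply_sum_smul_apply B, apply_sum_smul_apply (Γ y),
    apply_sum_smul_apply (Γ y), apply_sum_smul]
  simp only [smul_add, smul_sub, Finset.sum_add_distrib, Finset.sum_sub_distrib]

theorem curvatureForm_sum₂ {ι : Type*} [Fintype ι] (c : ι → ℝ) (v : ι → E) (X Z : E) :
    curvatureForm Γ y X (∑ i, c i • v i) Z = ∑ i, c i • curvatureForm Γ y X (v i) Z := by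
  unfold curvatureForm
  rw [fderiv_sum_apply]
  generalize fderiv ℝ Γ y X = B
  rw [apply_sum_smul_apply B, apply_sum_smul_apply (Γ y),
    apply_sum_smul_apply (Γ y), apply_sum_smul]
  simp only [smul_add, smul_sub, Finset.sum_add_distrib, Finset.sum_sub_distrib]

theorem curvatureForm_sum₃ {ι : Type*} [Fintype ι] (c : ι → ℝ) (v : ι → E) (X Y : E) :
    curvatureForm Γ y X Y (∑ i, c i • v i) = ∑ i, c i • curvatureForm Γ y X Y (v i) := by
  simp only [curvatureForm, map_sum, map_smul, smul_add, smul_sub,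
    Finset.sum_add_distrib, Finset.sum_sub_distrib]

theorem fderiv_fderiv_comp {u : E → ℝ} (hψ : ContDiffAt ℝ ∞ ψ y) (hu : ContDiffAt ℝ ∞ u (ψ y))
    (X Y : E) :
    fderiv ℝ (fderiv ℝ (fun z => u (ψ z))) y X Y
      = fderiv ℝ (fderiv ℝ u) (ψ y) (fderiv ℝ ψ y X) (fderiv ℝ ψ y Y)
        + fderiv ℝ u (ψ y) (fderiv ℝ (fderiv ℝ ψ) y X Y) := by
  have hd : HasFDerivAt ψ (fderiv ℝ ψ y) y := (hψ.differentiableAt (by simp)).hasFDerivAt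
  have hcomp : ContDiffAt ℝ ∞ (fun z => u (ψ z)) y := hu.comp y hψ
  have h0 : y + (0 : ℝ) • X = y := by simp
  have hJ := hasFDerivAt_fderiv hψ
  have hdu : DifferentiableAt ℝ (fderiv ℝ u) (ψ y) :=
    (hu.fderiv_right (m := 1) two_le_infty).differentiableAt one_ne_zero
  have hdc : DifferentiableAt ℝ (fderiv ℝ (fun z => u (ψ z))) y :=
    (hcomp.fderiv_right (m := 1) two_le_infty).differentiableAt one_ne_zero
  have h1 := (hasDerivAt_along hdc X).clm_apply (hasDerivAt_const 0 Y)
  have h2 := (hasDerivAt_along_comp hdu hd X).clm_apply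
    ((hasDerivAt_along hJ.differentiableAt X).clm_apply (hasDerivAt_const 0 Y))
  have hev : ∀ᶠ z in 𝓝 y, fderiv ℝ (fun z => u (ψ z)) z Y
      = fderiv ℝ u (ψ z) (fderiv ℝ ψ z Y) := by
    have e1 : ∀ᶠ z in 𝓝 y, DifferentiableAt ℝ ψ z :=
      ((hψ.of_le (m := 1) (by simp)).eventually (by simp)).mono fun z hz =>
        hz.differentiableAt one_ne_zero
    have e2 : ∀ᶠ z in 𝓝 (ψ y), DifferentiableAt ℝ u z :=
      ((hu.of_le (m := 1) (by simp)).eventually (by simp)).mono fun z hz =>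
        hz.differentiableAt one_ne_zero
    filter_upwards [e1, hd.continuousAt.eventually e2] with z hz1 hz2
    rw [fderiv_fun_comp z hz2 hz1]
    rfl
  have h3 := h1.unique (h2.congr_of_eventuallyEq (by
    filter_upwards [eventually_along X hev] with t ht
    exact ht))
  simp only [h0, map_zero, add_zero] at h3
  rw [h3]

end ChangeOfCoordinates

/-! ### Transformation of Ricci tensors, Hessians and differentials -/

section Matrices

open scoped Topology

variable {n : ℕ} {U U' : Set (EuclideanSpace ℝ (Fin n))}
  {G G' : EuclideanSpace ℝ (Fin n) → Matrix (Fin n) (Fin n) ℝ}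
  {ψ : EuclideanSpace ℝ (Fin n) → EuclideanSpace ℝ (Fin n)} {y : EuclideanSpace ℝ (Fin n)}

/-- The Jacobian matrix `∂_i ψ^a`. -/
noncomputable def jacobian (ψ : EuclideanSpace ℝ (Fin n) → EuclideanSpace ℝ (Fin n))
    (y : EuclideanSpace ℝ (Fin n)) : Matrix (Fin n) (Fin n) ℝ :=
  Matrix.of fun a i => fderiv ℝ ψ y (EuclideanSpace.single i 1) a

theorem fderiv_single (i : Fin n) : fderiv ℝ ψ y (EuclideanSpace.single i 1)
    = ∑ a, jacobian ψ y a i • EuclideanSpace.single a (1 : ℝ) := by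
  ext b
  simp [jacobian, Finset.sum_apply, Pi.single_apply]

theorem fderiv_apply_eq_mulVec (X : EuclideanSpace ℝ (Fin n)) (a : Fin n) :
    fderiv ℝ ψ y X a = (jacobian ψ y).mulVec X.ofLp a := by
  have hX : X = ∑ k, X k • EuclideanSpace.single k (1 : ℝ) := by
    ext j
    simp [Finset.sum_apply, Pi.single_apply]
  conv_lhs => rw [hX]
  simp [jacobian, Matrix.mulVec, dotProduct, Finset.sum_apply, mul_comm]

theorem bilinearForm_eq_dotProduct (A : Matrix (Fin n) (Fin n) ℝ)
    (X Y : EuclideanSpace ℝ (Fin n)) :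
    bilinearForm A X Y = X.ofLp ⬝ᵥ A.mulVec Y.ofLp := by
  rw [bilinearForm_apply]
  simp only [dotProduct, Matrix.mulVec, Finset.mul_sum]
  exact Finset.sum_congr rfl fun i _ => Finset.sum_congr rfl fun j _ => by ring

theorem bilinearForm_pullback (A : Matrix (Fin n) (Fin n) ℝ) (X Y : EuclideanSpace ℝ (Fin n)) :
    bilinearForm ((jacobian ψ y).transpose * A * jacobian ψ y) X Y
      = bilinearForm A (fderiv ℝ ψ y X) (fderiv ℝ ψ y Y) := by
  have h : ∀ X, (fderiv ℝ ψ y X).ofLp = (jacobian ψ y).mulVec X.ofLp := fun X => by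
    funext a
    exact fderiv_apply_eq_mulVec X a
  rw [bilinearForm_eq_dotProduct, bilinearForm_eq_dotProduct, h, h, ← Matrix.mulVec_mulVec,
    ← Matrix.mulVec_mulVec, Matrix.dotProduct_mulVec, Matrix.vecMul_transpose]

/-- A change of coordinates between two matrices of metric coefficients. -/
structure IsCoordinateChange (U' U : Set (EuclideanSpace ℝ (Fin n)))
    (G' G : EuclideanSpace ℝ (Fin n) → Matrix (Fin n) (Fin n) ℝ)
    (ψ : EuclideanSpace ℝ (Fin n) → EuclideanSpace ℝ (Fin n)) : Prop where
  source : IsMetricOn U' G'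
  target : IsMetricOn U G
  contDiffOn : ContDiffOn ℝ ∞ ψ U'
  mapsTo : MapsTo ψ U' U
  pullback : ∀ z ∈ U', G' z = (jacobian ψ z).transpose * G (ψ z) * jacobian ψ z

namespace IsCoordinateChange

variable (h : IsCoordinateChange U' U G' G ψ)
include h

theorem contDiffAt (hy : y ∈ U') : ContDiffAt ℝ ∞ ψ y :=
  h.contDiffOn.contDiffAt (h.source.isOpen.mem_nhds hy)

/-- Invertibility of the differential is automatic: the pulled-back determinant is positive and
contains the Jacobian determinant as a factor. -/
theorem det_jacobian_ne_zero (hy : y ∈ U') : (jacobian ψ y).det ≠ 0 := by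
  intro h0
  have := h.source.det_pos y hy
  rw [h.pullback y hy, Matrix.det_mul, h0, mul_zero] at this
  exact this.false

theorem surjective (hy : y ∈ U') : Function.Surjective (fderiv ℝ ψ y) := by
  intro w
  refine ⟨WithLp.toLp 2 ((jacobian ψ y)⁻¹.mulVec w.ofLp), ?_⟩
  ext a
  rw [fderiv_apply_eq_mulVec]
  simp [Matrix.mulVec_mulVec, Matrix.mul_nonsing_inv _ (h.det_jacobian_ne_zero hy).isUnit]

theorem connectionForm_eq (hy : y ∈ U') (X Y : EuclideanSpace ℝ (Fin n)) :
    fderiv ℝ ψ y (connectionForm G' y X Y)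
      = connectionForm G (ψ y) (fderiv ℝ ψ y X) (fderiv ℝ ψ y Y)
        + fderiv ℝ (fderiv ℝ ψ) y X Y := by
  refine connection_transform (g := fun z => bilinearForm (G z))
    (g' := fun z => bilinearForm (G' z)) (h.contDiffAt hy)
    (differentiableAt_bilinearForm h.target (h.mapsTo hy)) (differentiableAt_bilinearForm h.source hy)
    (bilinearForm_symm (h.target.symm _)) ?_ (koszul h.target (h.mapsTo hy)) (koszul h.source hy)
    (h.surjective hy) (fun v w hvw => eq_of_bilinearForm_eq (h.target.det_pos _ (h.mapsTo hy)).ne' hvw)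
    X Y
  filter_upwards [h.source.isOpen.mem_nhds hy] with z hz X Y
  rw [h.pullback z hz, bilinearForm_pullback]

theorem curvatureForm_eq (hy : y ∈ U') (X Y Z : EuclideanSpace ℝ (Fin n)) :
    fderiv ℝ ψ y (curvatureForm (connectionForm G') y X Y Z)
      = curvatureForm (connectionForm G) (ψ y) (fderiv ℝ ψ y X) (fderiv ℝ ψ y Y)
        (fderiv ℝ ψ y Z) := by
  refine curvatureForm_transform (h.contDiffAt hy)
    (differentiableAt_connectionForm h.target (h.mapsTo hy))
    (differentiableAt_connectionForm h.source hy) ?_ X Y Z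
  filter_upwards [h.source.isOpen.mem_nhds hy] with z hz X Y
  exact h.connectionForm_eq hz X Y

end IsCoordinateChange

theorem riemann_eq_curvatureForm (hG : IsMetricOn U G) (hy : y ∈ U) (l k i j : Fin n) :
    riemann G l k i j y = curvatureForm (connectionForm G) y (EuclideanSpace.single i 1)
      (EuclideanSpace.single j 1) (EuclideanSpace.single k 1) l := by
  have e : ∀ a b, connectionForm G y (EuclideanSpace.single a 1) (EuclideanSpace.single b 1)
      = ∑ m, christoffel G m a b y • EuclideanSpace.single m (1 : ℝ) := fun a b => by
    ext m
    rw [connectionForm_apply]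
    simp [Finset.sum_apply, Pi.single_apply]
  have e2 : ∀ a b l, connectionForm G y (EuclideanSpace.single a 1) (EuclideanSpace.single b 1) l
      = christoffel G l a b y := fun a b l => by
    rw [connectionForm_apply]
    simp
  simp only [curvatureForm, PiLp.sub_apply, PiLp.add_apply, fderiv_connectionForm_apply hG hy,
    e j k, e i k, map_sum, map_smul, WithLp.ofLp_sum, Finset.sum_apply, PiLp.smul_apply, e2,
    smul_eq_mul, riemann, Finset.sum_sub_distrib]
  congr 1
  congr 1
  · exact Finset.sum_congr rfl fun m _ => mul_comm _ _
  · exact Finset.sum_congr rfl fun m _ => mul_comm _ _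

theorem transpose_mul_mul_apply (J A : Matrix (Fin n) (Fin n) ℝ) (i j : Fin n) :
    (J.transpose * A * J) i j = ∑ a, ∑ b, J a i * (J b j * A a b) := by
  simp only [Matrix.mul_apply, Matrix.transpose_apply, Finset.sum_mul]
  rw [Finset.sum_comm]
  exact Finset.sum_congr rfl fun a _ => Finset.sum_congr rfl fun b _ => by ring

/-- The Ricci tensor is the trace of `X ↦ R(X, ∂_j)∂_k`. The curvature law intertwines the two
endomorphisms, `J M' = M J`, so their traces agree; linearity in the two other slots then produces
the Jacobian factors. -/
theorem IsCoordinateChange.ricci_eq (h : IsCoordinateChange U' U G' G ψ) (hy : y ∈ U') :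
    ricci G' y = (jacobian ψ y).transpose * ricci G (ψ y) * jacobian ψ y := by
  ext j k
  rw [transpose_mul_mul_apply]
  simp only [ricci, Matrix.of_apply, riemann_eq_curvatureForm h.source hy,
    riemann_eq_curvatureForm h.target (h.mapsTo hy)]
  set J := jacobian ψ y with hJ
  set M' : Matrix (Fin n) (Fin n) ℝ := Matrix.of fun a i =>
    curvatureForm (connectionForm G') y (EuclideanSpace.single i 1)
      (EuclideanSpace.single j 1) (EuclideanSpace.single k 1) a with hM'
  set M : Matrix (Fin n) (Fin n) ℝ := Matrix.of fun a i =>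
    curvatureForm (connectionForm G) (ψ y) (EuclideanSpace.single i 1)
      (fderiv ℝ ψ y (EuclideanSpace.single j 1)) (fderiv ℝ ψ y (EuclideanSpace.single k 1)) a
    with hM
  have hJM : J * M' = M * J := by
    ext a i
    have h1 := congrArg (fun v : EuclideanSpace ℝ (Fin n) => v a)
      (h.curvatureForm_eq hy (EuclideanSpace.single i 1) (EuclideanSpace.single j 1)
        (EuclideanSpace.single k 1))
    simp only [fderiv_apply_eq_mulVec] at h1
    rw [fderiv_single i, curvatureForm_sum₁] at h1
    simp only [WithLp.ofLp_sum, Finset.sum_apply, PiLp.smul_apply, smul_eq_mul] at h1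
    refine Eq.trans ?_ (h1.trans ?_)
    · rfl
    · exact Finset.sum_congr rfl fun b _ => mul_comm _ _
  have htr : M'.trace = M.trace := by
    have hu := (h.det_jacobian_ne_zero hy).isUnit
    rw [← Matrix.nonsing_inv_mul_cancel_left J M' hu, hJM, Matrix.trace_mul_comm,
      Matrix.mul_assoc, Matrix.mul_nonsing_inv _ hu, Matrix.mul_one]
  refine Eq.trans (b := M'.trace) rfl (htr.trans ?_)
  simp only [Matrix.trace, Matrix.diag, hM, Matrix.of_apply]
  simp only [fderiv_single j, fderiv_single k, curvatureForm_sum₂, curvatureForm_sum₃,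
    WithLp.ofLp_sum, Finset.sum_apply, PiLp.smul_apply, smul_eq_mul, Finset.mul_sum]
  exact sum_reindex₃ ⟨fun x => (x.2.2, x.2.1, x.1), fun x => (x.2.2, x.2.1, x.1),
    fun _ => rfl, fun _ => rfl⟩ fun i c b => by dsimp only [Equiv.coe_fn_mk]; ring

theorem hessian_eq_fderiv {u : EuclideanSpace ℝ (Fin n) → ℝ} (hu : ContDiffAt ℝ ∞ u y)
    (i j : Fin n) : hessian G u y i j
      = fderiv ℝ (fderiv ℝ u) y (EuclideanSpace.single i 1) (EuclideanSpace.single j 1)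
        - fderiv ℝ u y (connectionForm G y (EuclideanSpace.single i 1)
            (EuclideanSpace.single j 1)) := by
  have e2 : ∀ l, connectionForm G y (EuclideanSpace.single i 1) (EuclideanSpace.single j 1) l
      = christoffel G l i j y := fun l => by
    rw [connectionForm_apply]
    simp
  have hd : DifferentiableAt ℝ (fderiv ℝ u) y :=
    (hu.fderiv_right (m := 1) two_le_infty).differentiableAt one_ne_zero
  rw [hessian, Matrix.of_apply, fderiv_apply_eq_sum]
  simp only [e2]
  congr 1
  simp only [partialDeriv]
  have := hd.hasFDerivAt.clm_apply (hasFDerivAt_const (EuclideanSpace.single j (1 : ℝ)) y)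
  change fderiv ℝ (fun z => fderiv ℝ u z (EuclideanSpace.single j 1)) y _ = _
  rw [this.fderiv]
  simp

/-- The second-derivative term of the chain rule cancels against the inhomogeneous term in the law
for the connection. -/
theorem IsCoordinateChange.hessian_eq (h : IsCoordinateChange U' U G' G ψ) (hy : y ∈ U')
    {u u' : EuclideanSpace ℝ (Fin n) → ℝ} (hu : ContDiffOn ℝ ∞ u U)
    (huu' : ∀ z ∈ U', u' z = u (ψ z)) :
    hessian G' u' y = (jacobian ψ y).transpose * hessian G u (ψ y) * jacobian ψ y := by
  have hev : u' =ᶠ[𝓝 y] fun z => u (ψ z) := by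
    filter_upwards [h.source.isOpen.mem_nhds hy] with z hz using huu' z hz
  have hu1 : ContDiffAt ℝ ∞ u (ψ y) :=
    hu.contDiffAt (h.target.isOpen.mem_nhds (h.mapsTo hy))
  have hψ := h.contDiffAt hy
  have hu2 : ContDiffAt ℝ ∞ u' y := (hu1.comp y hψ).congr_of_eventuallyEq hev
  have hd : fderiv ℝ u' y = (fderiv ℝ u (ψ y)).comp (fderiv ℝ ψ y) := by
    rw [hev.fderiv_eq]
    exact fderiv_comp y (hu1.differentiableAt (by simp)) (hψ.differentiableAt (by simp))
  ext i j
  rw [transpose_mul_mul_apply, hessian_eq_fderiv hu2, hev.fderiv.fderiv_eq,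
    fderiv_fderiv_comp hψ hu1, hd, ContinuousLinearMap.comp_apply, h.connectionForm_eq hy, map_add,
    add_sub_add_right_eq_sub]
  simp only [hessian_eq_fderiv hu1, fderiv_single]
  simp only [map_sum, map_smul, sum_apply, _root_.smul_apply, smul_eq_mul, mul_sub,
    Finset.sum_sub_distrib, Finset.mul_sum]
  congr 1 <;> rw [Finset.sum_comm] <;>
  exact Finset.sum_congr rfl fun a _ => Finset.sum_congr rfl fun b _ => by ring

theorem IsCoordinateChange.partialDeriv_eq (h : IsCoordinateChange U' U G' G ψ) (hy : y ∈ U')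
    {u u' : EuclideanSpace ℝ (Fin n) → ℝ} (hu : DifferentiableAt ℝ u (ψ y))
    (huu' : ∀ z ∈ U', u' z = u (ψ z)) (i : Fin n) :
    partialDeriv i u' y = ∑ a, jacobian ψ y a i * partialDeriv a u (ψ y) := by
  have hev : u' =ᶠ[𝓝 y] fun z => u (ψ z) := by
    filter_upwards [h.source.isOpen.mem_nhds hy] with z hz using huu' z hz
  rw [partialDeriv, hev.fderiv_eq, fderiv_fun_comp y hu ((h.contDiffAt hy).differentiableAt (by simp)),
    ContinuousLinearMap.comp_apply, fderiv_apply_eq_sum]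
  rfl

end Matrices


/-! ### Invariance of the integrands under changes of coordinates -/

section Invariance

open scoped Topology

variable {n : ℕ}

theorem metricTrace_pullback {J : Matrix (Fin n) (Fin n) ℝ} (hJ : J.det ≠ 0)
    (A T : Matrix (Fin n) (Fin n) ℝ) :
    metricTrace (J.transpose * A * J) (J.transpose * T * J) = metricTrace A T := by
  have hu : IsUnit J.det := hJ.isUnit
  have hu' : IsUnit J.transpose.det := by rwa [Matrix.det_transpose]
  simp only [metricTrace_eq_trace, Matrix.mul_inv_rev, Matrix.transpose_mul,
    Matrix.transpose_transpose, Matrix.mul_assoc]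
  rw [Matrix.nonsing_inv_mul_cancel_left _ _ hu', Matrix.trace_mul_comm]
  simp only [Matrix.mul_assoc, Matrix.mul_nonsing_inv _ hu, Matrix.mul_one]

theorem metricPairing_eq_trace {A : Matrix (Fin n) (Fin n) ℝ} (hA : A.IsSymm)
    (S T : Matrix (Fin n) (Fin n) ℝ) :
    metricPairing A S T = (A⁻¹ * S * A⁻¹ * T.transpose).trace := by
  rw [metricPairing_eq_sum hA]
  simp only [Matrix.trace, Matrix.diag, Matrix.mul_apply (N := T.transpose),
    Matrix.transpose_apply]

theorem metricPairing_pullback {J A : Matrix (Fin n) (Fin n) ℝ} (hJ : J.det ≠ 0) (hA : A.IsSymm)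
    (S T : Matrix (Fin n) (Fin n) ℝ) :
    metricPairing (J.transpose * A * J) (J.transpose * S * J) (J.transpose * T * J)
      = metricPairing A S T := by
  have hu : IsUnit J.det := hJ.isUnit
  have hu' : IsUnit J.transpose.det := by rwa [Matrix.det_transpose]
  have hA' : (J.transpose * A * J).IsSymm := by
    simp only [Matrix.IsSymm, Matrix.transpose_mul, Matrix.transpose_transpose, hA.eq,
      Matrix.mul_assoc]
  rw [metricPairing_eq_trace hA, metricPairing_eq_trace hA']
  simp only [Matrix.mul_inv_rev, Matrix.transpose_mul, Matrix.transpose_transpose,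
    Matrix.mul_assoc]
  rw [Matrix.mul_nonsing_inv_cancel_left _ _ hu, Matrix.nonsing_inv_mul_cancel_left _ _ hu',
    Matrix.nonsing_inv_mul_cancel_left _ _ hu', Matrix.trace_mul_comm]
  simp only [Matrix.mul_assoc, Matrix.mul_nonsing_inv _ hu, Matrix.mul_one]

theorem pullback_vecMulVec (J : Matrix (Fin n) (Fin n) ℝ) (a b : Fin n → ℝ) :
    Matrix.vecMulVec (fun i => ∑ k, J k i * a k) (fun i => ∑ k, J k i * b k)
      = J.transpose * Matrix.vecMulVec a b * J := by
  ext i j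
  rw [transpose_mul_mul_apply, Matrix.vecMulVec_apply, Finset.sum_mul_sum]
  exact Finset.sum_congr rfl fun k _ => Finset.sum_congr rfl fun l _ => by
    rw [Matrix.vecMulVec_apply]; ring

/-- The differential of a function in coordinates. -/
noncomputable def differential (u : EuclideanSpace ℝ (Fin n) → ℝ)
    (y : EuclideanSpace ℝ (Fin n)) (i : Fin n) : ℝ :=
  partialDeriv i u y

/-- Makes the pullback lemma for traces applicable to `|∇u|²`. -/
theorem localGradSq_eq_metricTrace (G : EuclideanSpace ℝ (Fin n) → Matrix (Fin n) (Fin n) ℝ)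
    (u : EuclideanSpace ℝ (Fin n) → ℝ) (y : EuclideanSpace ℝ (Fin n)) :
    localGradSq G u y
      = metricTrace (G y) (Matrix.vecMulVec (differential u y) (differential u y)) := by
  simp only [localGradSq, metricTrace, Matrix.vecMulVec_apply, differential, mul_assoc]

variable {U U' : Set (EuclideanSpace ℝ (Fin n))}
  {G G' : EuclideanSpace ℝ (Fin n) → Matrix (Fin n) (Fin n) ℝ}
  {ψ : EuclideanSpace ℝ (Fin n) → EuclideanSpace ℝ (Fin n)} {y : EuclideanSpace ℝ (Fin n)}
  {u u' : EuclideanSpace ℝ (Fin n) → ℝ}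

namespace IsCoordinateChange

variable (h : IsCoordinateChange U' U G' G ψ) (hy : y ∈ U')
include h hy

theorem density_eq : density G' y = |(jacobian ψ y).det| * density G (ψ y) := by
  rw [density, h.pullback y hy, Matrix.det_mul, Matrix.det_mul, Matrix.det_transpose,
    mul_right_comm, Real.sqrt_mul (mul_self_nonneg _), Real.sqrt_mul_self_eq_abs, density]

theorem localScalar_eq : localScalar G' y = localScalar G (ψ y) := by
  rw [localScalar, localScalar, h.ricci_eq hy, h.pullback y hy,
    metricTrace_pullback (h.det_jacobian_ne_zero hy)]

variable (hu : ContDiffOn ℝ ∞ u U) (huu' : ∀ z ∈ U', u' z = u (ψ z))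
include hu huu'

theorem differential_eq : differential u' y
    = fun i => ∑ a, jacobian ψ y a i * differential u (ψ y) a :=
  funext fun i => h.partialDeriv_eq hy
    (differentiableAt_of_contDiffOn h.target.isOpen hu (h.mapsTo hy)) huu' i

theorem localGradSq_eq : localGradSq G' u' y = localGradSq G u (ψ y) := by
  rw [localGradSq_eq_metricTrace, localGradSq_eq_metricTrace, h.differential_eq hy hu huu',
    pullback_vecMulVec, h.pullback y hy, metricTrace_pullback (h.det_jacobian_ne_zero hy)]

theorem localLaplacian_eq : localLaplacian G' u' y = localLaplacian G u (ψ y) := by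
  rw [localLaplacian, localLaplacian, h.hessian_eq hy hu huu', h.pullback y hy,
    metricTrace_pullback (h.det_jacobian_ne_zero hy)]

theorem localEntropy_eq (τ : ℝ) : localEntropy G' u' τ y = localEntropy G u τ (ψ y) := by
  rw [localEntropy, localEntropy, h.localGradSq_eq hy hu huu', h.localScalar_eq hy, huu' y hy]

theorem localVariation_eq {V V' : EuclideanSpace ℝ (Fin n) → Matrix (Fin n) (Fin n) ℝ}
    {H H' : EuclideanSpace ℝ (Fin n) → ℝ}
    (hV : V' y = (jacobian ψ y).transpose * V (ψ y) * jacobian ψ y) (hH : H' y = H (ψ y))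
    (τ σ : ℝ) : localVariation G' u' τ V' H' σ y = localVariation G u τ V H σ (ψ y) := by
  have hJ := h.det_jacobian_ne_zero hy
  rw [localVariation, localVariation, h.localGradSq_eq hy hu huu', h.localScalar_eq hy,
    h.localLaplacian_eq hy hu huu', huu' y hy, h.hessian_eq hy hu huu', h.ricci_eq hy, hV, hH,
    ← Matrix.add_mul, ← Matrix.mul_add, h.pullback y hy,
    metricPairing_pullback hJ (h.target.symm _), metricTrace_pullback hJ]

end IsCoordinateChange

end Invariance

/-! ### Chart independence of the flux -/

section Flux

open scoped Topology

variable {n : ℕ} {Ω Ω' : Set (ℝ × EuclideanSpace ℝ (Fin n))}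
  {G G' : ℝ → EuclideanSpace ℝ (Fin n) → Matrix (Fin n) (Fin n) ℝ} {s : ℝ}
  {V V' : EuclideanSpace ℝ (Fin n) → Matrix (Fin n) (Fin n) ℝ}
  {H H' : EuclideanSpace ℝ (Fin n) → ℝ}
  {y : EuclideanSpace ℝ (Fin n)}
  {U U' : Set (EuclideanSpace ℝ (Fin n))}
  {ψ : EuclideanSpace ℝ (Fin n) → EuclideanSpace ℝ (Fin n)}
  {u u' r r' : EuclideanSpace ℝ (Fin n) → ℝ}

/-- The derivative of a function along the vector field `entropyField`. -/
noncomputable def entropyFlux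
    (G : ℝ → EuclideanSpace ℝ (Fin n) → Matrix (Fin n) (Fin n) ℝ) (s : ℝ)
    (u : EuclideanSpace ℝ (Fin n) → ℝ)
    (V : EuclideanSpace ℝ (Fin n) → Matrix (Fin n) (Fin n) ℝ)
    (H : EuclideanSpace ℝ (Fin n) → ℝ) (c : ℝ) (r : EuclideanSpace ℝ (Fin n) → ℝ)
    (y : EuclideanSpace ℝ (Fin n)) : ℝ :=
  ∑ i, entropyField G s u V H c i y * partialDeriv i r y

/-- The variation of minus the Hessian of a function that does not vary. -/
noncomputable def connectionVariation
    (G : ℝ → EuclideanSpace ℝ (Fin n) → Matrix (Fin n) (Fin n) ℝ) (s : ℝ)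
    (r : EuclideanSpace ℝ (Fin n) → ℝ) (y : EuclideanSpace ℝ (Fin n)) :
    Matrix (Fin n) (Fin n) ℝ :=
  Matrix.of fun j k => ∑ i, christoffelVariation G s i j k y * partialDeriv i r y

theorem hasDerivAt_hessian_const (hG : IsMetricFamilyOn Ω G) (hy : (s, y) ∈ Ω) (j k : Fin n) :
    HasDerivAt (fun t => hessian (G t) r y j k) (-connectionVariation G s r y j k) s := by
  simp only [hessian, connectionVariation, Matrix.of_apply]
  exact (HasDerivAt.fun_sum fun i _ =>
    (hasDerivAt_christoffel hG hy i j k).mul_const _).const_sub _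

/-- For a function `r` that does not vary, minus `connectionVariation` is the parameter derivative
of the Hessian. The Hessian law holds for all nearby parameters with the same Jacobian, so it can be
differentiated term by term. -/
theorem connectionVariation_eq (hG : IsMetricFamilyOn Ω G) (hG' : IsMetricFamilyOn Ω' G')
    (hy' : (s, y) ∈ Ω') (hy : (s, ψ y) ∈ Ω)
    (h : ∀ᶠ t in 𝓝 s, IsCoordinateChange U' U (G' t) (G t) ψ) (hyU : y ∈ U')
    (hr : ContDiffOn ℝ ∞ r U) (hrr' : ∀ z ∈ U', r' z = r (ψ z)) :
    connectionVariation G' s r' y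
      = (jacobian ψ y).transpose * connectionVariation G s r (ψ y) * jacobian ψ y := by
  ext i j
  have h1 := hasDerivAt_hessian_const (r := r') hG' hy' i j
  have h2 : HasDerivAt (fun t => ∑ a, ∑ b, jacobian ψ y a i * (jacobian ψ y b j
      * hessian (G t) r (ψ y) a b)) _ s :=
    HasDerivAt.fun_sum (u := Finset.univ) fun a _ => HasDerivAt.fun_sum (u := Finset.univ) fun b _ =>
      ((hasDerivAt_hessian_const (r := r) hG hy a b).const_mul (jacobian ψ y b j)).const_mul
        (jacobian ψ y a i)
  have h3 := h1.unique (h2.congr_of_eventuallyEq (by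
    filter_upwards [h] with t ht
    rw [ht.hessian_eq hyU hr hrr', transpose_mul_mul_apply]))
  rw [transpose_mul_mul_apply, ← neg_inj, h3]
  simp only [mul_neg, Finset.sum_neg_distrib]

theorem sum_sum_mul_vecMulVec (A : Matrix (Fin n) (Fin n) ℝ) (a b : Fin n → ℝ) :
    ∑ i, (∑ j, A i j * a j) * b i = ∑ i, ∑ j, A i j * Matrix.vecMulVec b a i j := by
  simp only [Finset.sum_mul, Matrix.vecMulVec_apply]
  exact Finset.sum_congr rfl fun i _ => Finset.sum_congr rfl fun j _ => by ring

/-- Paired with `dr`, the non-invariant ingredients become tensors: the first contraction of `δΓ` is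
the trace of `connectionVariation`, and the second is the differential of the scalar `v/2`. Every
term is then a metric trace or pairing, to which the pullback lemmas apply. -/
theorem entropyFlux_eq_invariant (hG : IsMetricFamilyOn Ω G) (hy : (s, y) ∈ Ω)
    (hV : ∀ z, (s, z) ∈ Ω → ∀ i j, HasDerivAt (fun t => G t z i j) (V z i j) s) (c : ℝ) :
    entropyFlux G s u V H c r y
      = metricTrace (G s y) (connectionVariation G s r y)
        - metricTrace (G s y) (Matrix.vecMulVec (differential r y)
          (differential (fun z => metricTrace (G s z) (V z) / 2) y))
        + metricPairing (G s y) (V y) (Matrix.vecMulVec (differential r y) (differential u y))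
        - 2 * measureVariation G s V H c y
          * metricTrace (G s y) (Matrix.vecMulVec (differential r y) (differential u y)) := by
  have e1 : ∑ i, (∑ j, ∑ k, (G s y)⁻¹ j k * christoffelVariation G s i j k y) * partialDeriv i r y
      = metricTrace (G s y) (connectionVariation G s r y) := by
    simp only [metricTrace, connectionVariation, Matrix.of_apply, Finset.sum_mul, Finset.mul_sum]
    exact sum_reindex₃ ⟨fun x => (x.2.1, x.2.2, x.1), fun x => (x.2.2, x.1, x.2.1),
      fun _ => rfl, fun _ => rfl⟩ fun i j k => by dsimp only [Equiv.coe_fn_mk]; ring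
  have e2 : ∀ k, ∑ l, christoffelVariation G s l l k y
      = differential (fun z => metricTrace (G s z) (V z) / 2) y k := fun k => by
    rw [differential, partialDeriv_metricTrace_variation hG hy hV]
    exact Finset.sum_congr rfl fun l _ => christoffelVariation_symm hG.symm l l k
  rw [metricPairing_eq_sum (hG.symm s y)]
  simp only [metricTrace, ← sum_sum_mul_vecMulVec] at e1 ⊢
  rw [← e1]
  simp only [entropyFlux, entropyField, palatiniField, e2, sub_mul, add_mul,
    Finset.sum_sub_distrib, Finset.sum_add_distrib, mul_assoc, ← Finset.mul_sum]
  rfl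

theorem entropyFlux_eq (hG : IsMetricFamilyOn Ω G) (hG' : IsMetricFamilyOn Ω' G')
    (hΩ' : ∀ z ∈ U', (s, z) ∈ Ω') (hΩ : ∀ z ∈ U, (s, z) ∈ Ω)
    (hV : ∀ z, (s, z) ∈ Ω → ∀ i j, HasDerivAt (fun t => G t z i j) (V z i j) s)
    (hV' : ∀ z, (s, z) ∈ Ω' → ∀ i j, HasDerivAt (fun t => G' t z i j) (V' z i j) s)
    (h : ∀ᶠ t in 𝓝 s, IsCoordinateChange U' U (G' t) (G t) ψ) (hy : y ∈ U')
    (hVV' : ∀ z ∈ U', V' z = (jacobian ψ z).transpose * V (ψ z) * jacobian ψ z)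
    (hHH' : ∀ z ∈ U', H' z = H (ψ z))
    (hu : ContDiffOn ℝ ∞ u U) (huu' : ∀ z ∈ U', u' z = u (ψ z))
    (hr : ContDiffOn ℝ ∞ r U) (hrr' : ∀ z ∈ U', r' z = r (ψ z)) (c : ℝ) :
    entropyFlux G' s u' V' H' c r' y = entropyFlux G s u V H c r (ψ y) := by
  have hs := h.self_of_nhds
  have hyΩ := hΩ _ (hs.mapsTo hy)
  have hJ : ∀ {z}, z ∈ U' → (jacobian ψ z).det ≠ 0 := fun hz => hs.det_jacobian_ne_zero hz
  have htr : ∀ z ∈ U', metricTrace (G' s z) (V' z) = metricTrace (G s (ψ z)) (V (ψ z)) :=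
    fun z hz => by rw [hs.pullback z hz, hVV' z hz, metricTrace_pullback (hJ hz)]
  rw [entropyFlux_eq_invariant hG' (hΩ' y hy) hV', entropyFlux_eq_invariant hG hyΩ hV,
    connectionVariation_eq hG hG' (hΩ' y hy) hyΩ h hy hr hrr', hs.differential_eq hy hr hrr',
    hs.differential_eq hy hu huu', measureVariation, measureVariation, htr y hy, hHH' y hy,
    hs.differential_eq (u := fun z => metricTrace (G s z) (V z) / 2) hy
      (((contDiffOn_metricTrace_variation hG hV).div_const 2).mono hΩ)
      (fun z hz => by rw [htr z hz]),
    pullback_vecMulVec, pullback_vecMulVec, hs.pullback y hy, hVV' y hy,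
    metricTrace_pullback (hJ hy), metricTrace_pullback (hJ hy), metricTrace_pullback (hJ hy),
    metricPairing_pullback (hJ hy) (hs.target.symm _)]

end Flux


/-! ### Coordinates on the manifold -/

section Charts

open scoped Topology

variable {n : ℕ} {M : Type*} [TopologicalSpace M] [ChartedSpace (EuclideanSpace ℝ (Fin n)) M]
  [IsManifold (𝓡 n) ∞ M] {φ φ' : OpenPartialHomeomorph M (EuclideanSpace ℝ (Fin n))}
  {y : EuclideanSpace ℝ (Fin n)}

theorem contMDiffOn_chart_symm (hφ : φ ∈ atlas (EuclideanSpace ℝ (Fin n)) M) :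
    ContMDiffOn (𝓡 n) (𝓡 n) ∞ φ.symm φ.target :=
  contMDiffOn_symm_of_mem_maximalAtlas (StructureGroupoid.subset_maximalAtlas _ hφ)

theorem contMDiffOn_chart_of_mem_atlas (hφ : φ ∈ atlas (EuclideanSpace ℝ (Fin n)) M) :
    ContMDiffOn (𝓡 n) (𝓡 n) ∞ φ φ.source :=
  contMDiffOn_of_mem_maximalAtlas (StructureGroupoid.subset_maximalAtlas _ hφ)

theorem mdifferentiableAt_chart_symm (hφ : φ ∈ atlas (EuclideanSpace ℝ (Fin n)) M)
    (hy : y ∈ φ.target) : MDifferentiableAt (𝓡 n) (𝓡 n) φ.symm y :=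
  ((contMDiffOn_chart_symm hφ).contMDiffAt (φ.open_target.mem_nhds hy)).mdifferentiableAt
    (by simp)

theorem mdifferentiableAt_chart (hφ : φ ∈ atlas (EuclideanSpace ℝ (Fin n)) M) {x : M}
    (hx : x ∈ φ.source) : MDifferentiableAt (𝓡 n) (𝓡 n) φ x :=
  ((contMDiffOn_chart_of_mem_atlas hφ).contMDiffAt (φ.open_source.mem_nhds hx)).mdifferentiableAt
    (by simp)

theorem contMDiffOn_coordVector (hφ : φ ∈ atlas (EuclideanSpace ℝ (Fin n)) M) (i : Fin n) :
    ContMDiffOn (𝓡 n) ((𝓡 n).prod 𝓘(ℝ, EuclideanSpace ℝ (Fin n))) ∞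
      (fun y => Bundle.TotalSpace.mk' (EuclideanSpace ℝ (Fin n))
        (E := fun x : M => TangentSpace (𝓡 n) x) (φ.symm y) (coordVector φ y i)) φ.target := by
  have h1 := (contMDiffOn_chart_symm hφ).contMDiffOn_tangentMapWithin (m := ∞) (by simp)
    φ.open_target.uniqueMDiffOn
  have h2 : ContMDiff (𝓡 n) (𝓡 n).tangent ∞ (fun y : EuclideanSpace ℝ (Fin n) =>
      (⟨y, (EuclideanSpace.single i 1 : EuclideanSpace ℝ (Fin n))⟩ :
        TangentBundle (𝓡 n) (EuclideanSpace ℝ (Fin n)))) :=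
    contMDiff_vectorSpace_iff_contDiff.2 contDiff_const
  refine (h1.comp h2.contMDiffOn fun y hy => hy).congr fun y hy => ?_
  simp only [Function.comp, tangentMapWithin, coordVector]
  rw [mfderivWithin_of_isOpen φ.open_target hy]

theorem contDiffOn_coeff {ε : ℝ} {g : ℝ → Metric n M}
    (hg : ContMDiffOn (𝓘(ℝ, ℝ).prod (𝓡 n))
      ((𝓡 n).prod
        𝓘(ℝ, EuclideanSpace ℝ (Fin n) →L[ℝ] EuclideanSpace ℝ (Fin n) →L[ℝ] ℝ)) ∞
      (fun p : ℝ × M => Bundle.TotalSpace.mk'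
        (EuclideanSpace ℝ (Fin n) →L[ℝ] EuclideanSpace ℝ (Fin n) →L[ℝ] ℝ)
        (E := fun x : M => TangentSpace (𝓡 n) x →L[ℝ] TangentSpace (𝓡 n) x →L[ℝ] ℝ)
        p.2 ((g p.1).inner p.2))
      (Set.Ioo (-ε) ε ×ˢ Set.univ))
    (hφ : φ ∈ atlas (EuclideanSpace ℝ (Fin n)) M) (i j : Fin n) :
    ContDiffOn ℝ ∞ (fun p : ℝ × EuclideanSpace ℝ (Fin n) => coeff φ (g p.1).inner p.2 i j)
      (Set.Ioo (-ε) ε ×ˢ φ.target) := by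
  rw [← contMDiffOn_iff_contDiffOn, modelWithCornersSelf_prod, ← chartedSpaceSelf_prod]
  have hmap : ContMDiffOn (𝓘(ℝ, ℝ).prod (𝓡 n)) (𝓘(ℝ, ℝ).prod (𝓡 n)) ∞
      (fun p : ℝ × EuclideanSpace ℝ (Fin n) => ((p.1, φ.symm p.2) : ℝ × M))
      (Set.Ioo (-ε) ε ×ˢ φ.target) :=
    contMDiffOn_fst.prodMk ((contMDiffOn_chart_symm hφ).comp contMDiffOn_snd fun p hp => hp.2)
  have hψ := hg.comp hmap fun p hp => ⟨hp.1, mem_univ _⟩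
  have hv := fun i => (contMDiffOn_coordVector hφ i).comp
    (contMDiffOn_snd (I := 𝓘(ℝ, ℝ)) (s := Set.Ioo (-ε) ε ×ˢ φ.target)) fun p hp => hp.2
  -- The coefficient is viewed as a section of the trivial line bundle, obtained by applying the
  -- smooth metric section to two smooth coordinate fields; its fibre component is the desired
  -- function.
  have : ContMDiffOn (𝓘(ℝ, ℝ).prod (𝓡 n)) ((𝓡 n).prod 𝓘(ℝ, ℝ)) ∞
      (fun p : ℝ × EuclideanSpace ℝ (Fin n) => Bundle.TotalSpace.mk' ℝ (E := Bundle.Trivial M ℝ)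
        (φ.symm p.2) ((g p.1).inner (φ.symm p.2) (coordVector φ p.2 i) (coordVector φ p.2 j)))
      (Set.Ioo (-ε) ε ×ˢ φ.target) := by
    apply ContMDiffOn.clm_bundle_apply₂ (F₁ := EuclideanSpace ℝ (Fin n))
      (F₂ := EuclideanSpace ℝ (Fin n)) (E₁ := fun x : M => TangentSpace (𝓡 n) x)
      (E₂ := fun x : M => TangentSpace (𝓡 n) x)
    · exact hψ
    · exact hv i
    · exact hv j
  intro p hp
  have := this p hp
  simp only [Bundle.contMDiffWithinAt_totalSpace] at this
  exact this.2

theorem coeff_isSymm (g : Metric n M) (y : EuclideanSpace ℝ (Fin n)) :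
    (coeff φ g.inner y).IsSymm := by
  ext i j
  exact g.symm _ _ _

/-- The differential of the inverse of a chart, as a map between model spaces. -/
noncomputable def chartDeriv (φ : OpenPartialHomeomorph M (EuclideanSpace ℝ (Fin n)))
    (y : EuclideanSpace ℝ (Fin n)) : EuclideanSpace ℝ (Fin n) →L[ℝ] EuclideanSpace ℝ (Fin n) :=
  mfderiv (𝓡 n) (𝓡 n) φ.symm y

/-- A covariant 2-tensor at a point, as a bilinear form on the model space. -/
def tensorForm (T : TensorField n M) (x : M) :
    EuclideanSpace ℝ (Fin n) →L[ℝ] EuclideanSpace ℝ (Fin n) →L[ℝ] ℝ := T x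

omit [IsManifold (𝓡 n) ∞ M] in
theorem coeff_apply (T : TensorField n M) (y : EuclideanSpace ℝ (Fin n)) (i j : Fin n) :
    coeff φ T y i j = tensorForm T (φ.symm y) (chartDeriv φ y (EuclideanSpace.single i 1))
      (chartDeriv φ y (EuclideanSpace.single j 1)) := rfl

theorem chartDeriv_injective (hφ : φ ∈ atlas (EuclideanSpace ℝ (Fin n)) M) (hy : y ∈ φ.target) :
    Function.Injective (chartDeriv φ y) := by
  have h := mfderiv_comp (I := 𝓡 n) (I' := 𝓡 n) (I'' := 𝓡 n) y
    (mdifferentiableAt_chart hφ (φ.map_target hy)) (mdifferentiableAt_chart_symm hφ hy)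
  have hid : (φ ∘ φ.symm : EuclideanSpace ℝ (Fin n) → EuclideanSpace ℝ (Fin n)) =ᶠ[𝓝 y] id := by
    filter_upwards [φ.open_target.mem_nhds hy] with z hz using φ.right_inv hz
  rw [hid.mfderiv_eq, mfderiv_id] at h
  intro X Y hXY
  have e := fun Z => congrArg (fun L : EuclideanSpace ℝ (Fin n) →L[ℝ] EuclideanSpace ℝ (Fin n) =>
    L Z) h
  exact (e X).trans ((congrArg (mfderiv (𝓡 n) (𝓡 n) φ (φ.symm y)) hXY).trans (e Y).symm)

theorem apply_eq_sum_single (L : EuclideanSpace ℝ (Fin n) →L[ℝ] EuclideanSpace ℝ (Fin n))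
    (X : EuclideanSpace ℝ (Fin n)) : L X = ∑ k, X k • L (EuclideanSpace.single k 1) := by
  have hX : X = ∑ k, X k • EuclideanSpace.single k (1 : ℝ) := by
    ext j
    simp [Finset.sum_apply, Pi.single_apply]
  conv_lhs => rw [hX]
  simp

omit [IsManifold (𝓡 n) ∞ M] in
theorem bilinearForm_coeff (T : TensorField n M) (y X Y : EuclideanSpace ℝ (Fin n)) :
    bilinearForm (coeff φ T y) X Y
      = tensorForm T (φ.symm y) (chartDeriv φ y X) (chartDeriv φ y Y) := by
  rw [bilinearForm_apply, apply_eq_sum_single (chartDeriv φ y) X,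
    apply_eq_sum_single (chartDeriv φ y) Y]
  simp only [map_sum, map_smul, sum_apply, _root_.smul_apply, smul_eq_mul, coeff_apply,
    Finset.mul_sum]
  rw [Finset.sum_comm]
  exact Finset.sum_congr rfl fun i _ => Finset.sum_congr rfl fun j _ => by ring

/-- The coefficient matrix is the Gram matrix of the metric under the injective differential of the
inverse chart, hence positive definite. -/
theorem det_coeff_pos (hφ : φ ∈ atlas (EuclideanSpace ℝ (Fin n)) M) (g : Metric n M)
    (hy : y ∈ φ.target) : 0 < (coeff φ g.inner y).det := by
  refine Matrix.PosDef.det_pos (Matrix.PosDef.of_dotProduct_mulVec_pos ?_ fun X hX => ?_)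
  · rw [Matrix.IsHermitian, Matrix.conjTranspose_eq_transpose_of_trivial]
    exact coeff_isSymm g y
  · have h : bilinearForm (coeff φ g.inner y) (WithLp.toLp 2 X) (WithLp.toLp 2 X)
        = X ⬝ᵥ (coeff φ g.inner y).mulVec X := bilinearForm_eq_dotProduct _ _ _
    rw [star_trivial, ← h, bilinearForm_coeff]
    refine g.pos _ _ fun h0 => hX ?_
    have := chartDeriv_injective hφ hy (h0.trans (map_zero (chartDeriv φ y)).symm)
    simpa using congrArg WithLp.ofLp this

/-- The transition map from the chart `φ'` to the chart `φ`. -/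
def transition (φ' φ : OpenPartialHomeomorph M (EuclideanSpace ℝ (Fin n)))
    (y : EuclideanSpace ℝ (Fin n)) : EuclideanSpace ℝ (Fin n) := φ (φ'.symm y)

omit [ChartedSpace (EuclideanSpace ℝ (Fin n)) M] [IsManifold (𝓡 n) ∞ M] in
theorem isOpen_transition_source (φ' φ : OpenPartialHomeomorph M (EuclideanSpace ℝ (Fin n))) :
    IsOpen (φ'.symm.trans φ).source := (φ'.symm.trans φ).open_source

theorem contDiffOn_transition (hφ' : φ' ∈ atlas (EuclideanSpace ℝ (Fin n)) M)
    (hφ : φ ∈ atlas (EuclideanSpace ℝ (Fin n)) M) :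
    ContDiffOn ℝ ∞ (transition φ' φ) (φ'.symm.trans φ).source := by
  rw [← contMDiffOn_iff_contDiffOn]
  refine (contMDiffOn_chart_of_mem_atlas hφ).comp ((contMDiffOn_chart_symm hφ').mono ?_) ?_
  · intro z hz
    simp only [mfld_simps] at hz
    exact hz.1
  · intro z hz
    simp only [mfld_simps] at hz
    exact hz.2

theorem chartDeriv_eq_comp (hφ' : φ' ∈ atlas (EuclideanSpace ℝ (Fin n)) M)
    (hφ : φ ∈ atlas (EuclideanSpace ℝ (Fin n)) M) (hy : y ∈ (φ'.symm.trans φ).source)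
    (X : EuclideanSpace ℝ (Fin n)) :
    chartDeriv φ' y X = chartDeriv φ (transition φ' φ y) (fderiv ℝ (transition φ' φ) y X) := by
  have hy' := hy
  simp only [mfld_simps] at hy'
  have hd : MDifferentiableAt (𝓡 n) (𝓡 n) (transition φ' φ) y :=
    ((contDiffOn_transition hφ' hφ).contDiffAt
      ((isOpen_transition_source φ' φ).mem_nhds hy)).differentiableAt (by simp)
      |>.mdifferentiableAt
  have h := mfderiv_comp (I := 𝓡 n) (I' := 𝓡 n) (I'' := 𝓡 n) y
    (mdifferentiableAt_chart_symm hφ (φ.map_source hy'.2)) hd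
  have he : (φ.symm ∘ transition φ' φ : EuclideanSpace ℝ (Fin n) → M) =ᶠ[𝓝 y] φ'.symm := by
    filter_upwards [(isOpen_transition_source φ' φ).mem_nhds hy] with z hz
    simp only [mfld_simps] at hz
    exact φ.left_inv hz.2
  rw [he.mfderiv_eq, mfderiv_eq_fderiv] at h
  exact congrArg (fun L : EuclideanSpace ℝ (Fin n) →L[ℝ] EuclideanSpace ℝ (Fin n) => L X) h

theorem coeff_pullback (hφ' : φ' ∈ atlas (EuclideanSpace ℝ (Fin n)) M)
    (hφ : φ ∈ atlas (EuclideanSpace ℝ (Fin n)) M) (hy : y ∈ (φ'.symm.trans φ).source)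
    (T : TensorField n M) :
    coeff φ' T y = (jacobian (transition φ' φ) y).transpose * coeff φ T (transition φ' φ y)
      * jacobian (transition φ' φ) y := by
  have hy' := hy
  simp only [mfld_simps] at hy'
  have hb : φ.symm (transition φ' φ y) = φ'.symm y := φ.left_inv hy'.2
  have h : ∀ X Y, bilinearForm (coeff φ' T y) X Y
      = bilinearForm ((jacobian (transition φ' φ) y).transpose
        * coeff φ T (transition φ' φ y) * jacobian (transition φ' φ) y) X Y := fun X Y => by
    rw [bilinearForm_pullback, bilinearForm_coeff, bilinearForm_coeff, hb,
      chartDeriv_eq_comp hφ' hφ hy, chartDeriv_eq_comp hφ' hφ hy]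
  ext i j
  have := h (EuclideanSpace.single i 1) (EuclideanSpace.single j 1)
  simpa [bilinearForm_eq_dotProduct] using this

theorem isMetricFamilyOn_coeff {ε : ℝ} {g : ℝ → Metric n M}
    (hg : ContMDiffOn (𝓘(ℝ, ℝ).prod (𝓡 n))
      ((𝓡 n).prod
        𝓘(ℝ, EuclideanSpace ℝ (Fin n) →L[ℝ] EuclideanSpace ℝ (Fin n) →L[ℝ] ℝ)) ∞
      (fun p : ℝ × M => Bundle.TotalSpace.mk'
        (EuclideanSpace ℝ (Fin n) →L[ℝ] EuclideanSpace ℝ (Fin n) →L[ℝ] ℝ)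
        (E := fun x : M => TangentSpace (𝓡 n) x →L[ℝ] TangentSpace (𝓡 n) x →L[ℝ] ℝ)
        p.2 ((g p.1).inner p.2))
      (Set.Ioo (-ε) ε ×ˢ Set.univ))
    (hφ : φ ∈ atlas (EuclideanSpace ℝ (Fin n)) M) :
    IsMetricFamilyOn (Set.Ioo (-ε) ε ×ˢ φ.target) (fun s => coeff φ (g s).inner) where
  isOpen := isOpen_Ioo.prod φ.open_target
  contDiffOn := contDiffOn_coeff hg hφ
  symm s := coeff_isSymm (g s)
  det_pos p hp := det_coeff_pos hφ (g p.1) hp.2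

theorem contDiffOn_comp_chart_symm {ε : ℝ} {f : ℝ → M → ℝ}
    (hf : ContMDiffOn (𝓘(ℝ, ℝ).prod (𝓡 n)) 𝓘(ℝ, ℝ) ∞ (fun p : ℝ × M => f p.1 p.2)
      (Set.Ioo (-ε) ε ×ˢ Set.univ))
    (hφ : φ ∈ atlas (EuclideanSpace ℝ (Fin n)) M) :
    ContDiffOn ℝ ∞ (fun p : ℝ × EuclideanSpace ℝ (Fin n) => (f p.1 ∘ φ.symm) p.2)
      (Set.Ioo (-ε) ε ×ˢ φ.target) := by
  rw [← contMDiffOn_iff_contDiffOn, modelWithCornersSelf_prod, ← chartedSpaceSelf_prod]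
  exact hf.comp (contMDiffOn_fst.prodMk
    ((contMDiffOn_chart_symm hφ).comp contMDiffOn_snd fun p hp => hp.2))
      fun p hp => ⟨hp.1, mem_univ _⟩

theorem IsMetricOn.mono {U U' : Set (EuclideanSpace ℝ (Fin n))}
    {G : EuclideanSpace ℝ (Fin n) → Matrix (Fin n) (Fin n) ℝ} (hG : IsMetricOn U G)
    (hU' : IsOpen U') (h : U' ⊆ U) : IsMetricOn U' G where
  isOpen := hU'
  contDiffOn i j := (hG.contDiffOn i j).mono h
  symm := hG.symm
  det_pos y hy := hG.det_pos y (h hy)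

theorem isCoordinateChange_transition {g : Metric n M}
    (hφ' : φ' ∈ atlas (EuclideanSpace ℝ (Fin n)) M) (hφ : φ ∈ atlas (EuclideanSpace ℝ (Fin n)) M)
    (hG' : IsMetricOn φ'.target (coeff φ' g.inner)) (hG : IsMetricOn φ.target (coeff φ g.inner)) :
    IsCoordinateChange (φ'.symm.trans φ).source φ.target (coeff φ' g.inner) (coeff φ g.inner)
      (transition φ' φ) where
  source := hG'.mono (isOpen_transition_source φ' φ) fun z hz => by
    simp only [mfld_simps] at hz
    exact hz.1
  target := hG
  contDiffOn := contDiffOn_transition hφ' hφ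
  mapsTo z hz := by
    simp only [mfld_simps] at hz
    exact φ.map_source hz.2
  pullback z hz := coeff_pullback hφ' hφ hz g.inner

end Charts


/-! ### The Riemannian volume measure in coordinates -/

section Volume

open scoped Topology ENNReal

theorem measurableSet_inter_preimage_of_continuousOn {α β : Type*} [TopologicalSpace α]
    [MeasurableSpace α] [OpensMeasurableSpace α] [TopologicalSpace β] [MeasurableSpace β]
    [BorelSpace β] {f : α → β} {s : Set α} {t : Set β} (hs : MeasurableSet s)
    (hf : ContinuousOn f s) (ht : MeasurableSet t) : MeasurableSet (s ∩ f ⁻¹' t) := by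
  have h := hf.domRestrict.measurable ht
  have := hs.subtype_image h
  rwa [Set.domRestrict_eq, preimage_comp, Subtype.image_preimage_coe] at this

variable {n : ℕ} {M : Type*} [TopologicalSpace M] [ChartedSpace (EuclideanSpace ℝ (Fin n)) M]
  [IsManifold (𝓡 n) ∞ M] {φ φ' : OpenPartialHomeomorph M (EuclideanSpace ℝ (Fin n))}

theorem isMetricOn_coeff (g : Metric n M) (hφ : φ ∈ atlas (EuclideanSpace ℝ (Fin n)) M) :
    IsMetricOn φ.target (coeff φ g.inner) := by
  have h := (isMetricFamilyOn_coeff (ε := 1) (g := fun _ => g)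
    (g.contMDiff.comp contMDiff_snd).contMDiffOn hφ).slice 0
  simpa using h

variable [MeasurableSpace M] [BorelSpace M]

omit [ChartedSpace (EuclideanSpace ℝ (Fin n)) M] [IsManifold (𝓡 n) ∞ M] in
theorem aemeasurable_chart_symm (φ : OpenPartialHomeomorph M (EuclideanSpace ℝ (Fin n)))
    (ρ : EuclideanSpace ℝ (Fin n) → ℝ≥0∞) :
    AEMeasurable φ.symm ((volume.restrict φ.target).withDensity ρ) :=
  (φ.continuousOn_symm.aemeasurable φ.open_target.measurableSet).mono_ac
    (withDensity_absolutelyContinuous _ _)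

theorem chartVolume_apply (g : Metric n M)
    (φ : OpenPartialHomeomorph M (EuclideanSpace ℝ (Fin n))) {S : Set M} (hS : MeasurableSet S) :
    chartVolume g φ S = ∫⁻ y in φ.target ∩ φ.symm ⁻¹' S,
      ENNReal.ofReal (density (coeff φ g.inner) y) := by
  rw [chartVolume, Measure.map_apply_of_aemeasurable (aemeasurable_chart_symm φ _) hS,
    withDensity_apply', Measure.restrict_restrict' φ.open_target.measurableSet, inter_comm]
  rfl

theorem det_fderiv_eq_det_jacobian (ψ : EuclideanSpace ℝ (Fin n) → EuclideanSpace ℝ (Fin n))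
    (y : EuclideanSpace ℝ (Fin n)) : (fderiv ℝ ψ y).det = (jacobian ψ y).det := by
  rw [ContinuousLinearMap.det,
    ← LinearMap.det_toMatrix (EuclideanSpace.basisFun (Fin n) ℝ).toBasis]
  congr 1

/-- Change of variables: the absolute Jacobian determinant is exactly the factor by which the
densities differ. -/
theorem chartVolume_eq_of_subset (g : Metric n M)
    (hφ : φ ∈ atlas (EuclideanSpace ℝ (Fin n)) M) (hφ' : φ' ∈ atlas (EuclideanSpace ℝ (Fin n)) M)
    {S : Set M} (hS : MeasurableSet S) (hSφ : S ⊆ φ.source) (hSφ' : S ⊆ φ'.source) :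
    chartVolume g φ S = chartVolume g φ' S := by
  have hch := isCoordinateChange_transition hφ' hφ (isMetricOn_coeff g hφ')
    (isMetricOn_coeff g hφ)
  have hsub : φ'.target ∩ φ'.symm ⁻¹' S ⊆ (φ'.symm.trans φ).source := fun y hy => by
    simp only [mfld_simps]
    exact ⟨hy.1, hSφ hy.2⟩
  have himg : transition φ' φ '' (φ'.target ∩ φ'.symm ⁻¹' S) = φ.target ∩ φ.symm ⁻¹' S := by
    ext z
    constructor
    · rintro ⟨y, hy, rfl⟩
      have := hSφ hy.2
      refine ⟨φ.map_source this, ?_⟩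
      simpa only [mem_preimage, transition, φ.left_inv this] using hy.2
    · rintro ⟨hz, hzS⟩
      have := hSφ' hzS
      refine ⟨φ' (φ.symm z), ⟨φ'.map_source this, ?_⟩, ?_⟩
      · simpa only [mem_preimage, φ'.left_inv this] using hzS
      · simp only [transition, φ'.left_inv this, φ.right_inv hz]
  have hinj : InjOn (transition φ' φ) (φ'.target ∩ φ'.symm ⁻¹' S) := fun y hy z hz h =>
    φ'.symm.injOn hy.1 hz.1 (φ.injOn (hSφ hy.2) (hSφ hz.2) h)
  have hm := measurableSet_inter_preimage_of_continuousOn φ'.open_target.measurableSet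
    φ'.continuousOn_symm hS
  rw [chartVolume_apply g φ hS, chartVolume_apply g φ' hS, ← himg,
    lintegral_image_eq_lintegral_abs_det_fderiv_mul volume hm (f' := fderiv ℝ (transition φ' φ))
      (fun y hy => ((hch.contDiffAt (hsub hy)).differentiableAt
        (by simp)).hasFDerivAt.hasFDerivWithinAt) hinj]
  refine setLIntegral_congr_fun hm fun y hy => ?_
  have hdet : (fderiv ℝ (transition φ' φ) y).det = (jacobian (transition φ' φ) y).det := 
    det_fderiv_eq_det_jacobian _ _
  simp only [hch.density_eq (hsub hy), hdet, ENNReal.ofReal_mul (abs_nonneg _)]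

theorem chartVolume_inter_source (g : Metric n M)
    (φ : OpenPartialHomeomorph M (EuclideanSpace ℝ (Fin n))) {S : Set M} (hS : MeasurableSet S) :
    chartVolume g φ (S ∩ φ.source) = chartVolume g φ S := by
  rw [chartVolume_apply g φ (hS.inter φ.open_source.measurableSet), chartVolume_apply g φ hS]
  congr 2
  ext y
  simp only [mem_inter_iff, mem_preimage]
  exact ⟨fun h => ⟨h.1, h.2.1⟩, fun h => ⟨h.1, h.2, φ.map_target h.1⟩⟩

/-- Only the upper bound is at issue, since the supremum runs over a possibly uncountable atlas.
Countably many chart domains are made disjoint, and the chart volumes on the pieces are glued to a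
measure `μ`. By overlap invariance `μ` agrees with every chart volume on the domain of that chart,
so it bounds them all and hence their supremum. -/
theorem riemannianVolume_apply [CompactSpace M] (g : Metric n M)
    (hφ : φ ∈ atlas (EuclideanSpace ℝ (Fin n)) M) {S : Set M} (hS : MeasurableSet S)
    (hSφ : S ⊆ φ.source) : riemannianVolume g S = chartVolume g φ S := by
  refine le_antisymm ?_ (Measure.le_iff'.1 (le_iSup₂_of_le φ hφ le_rfl) S)
  -- The countable cover is enumerated by a sequence below, which requires it to be nonempty.
  rcases isEmpty_or_nonempty M with hM | hM
  · rw [Set.eq_empty_of_isEmpty S, measure_empty]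
    exact bot_le
  obtain ⟨t, ht, htu⟩ := countable_cover_nhds_of_sigmaCompact
    (f := fun x : M => (chartAt (EuclideanSpace ℝ (Fin n)) x).source)
    fun x => chart_source_mem_nhds _ x
  have htn : t.Nonempty := by
    rw [nonempty_iff_ne_empty]
    rintro rfl
    simp only [mem_empty_iff_false, iUnion_of_empty, iUnion_empty] at htu
    exact empty_ne_univ htu
  obtain ⟨c, rfl⟩ := ht.exists_eq_range htn
  set D := disjointed fun k => (chartAt (EuclideanSpace ℝ (Fin n)) (c k)).source with hD
  have hDm : ∀ k, MeasurableSet (D k) := fun k =>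
    MeasurableSet.disjointed (fun k => (chartAt _ (c k)).open_source.measurableSet) k
  have hDu : ⋃ k, D k = univ := by
    rw [hD, iUnion_disjointed]
    simpa using htu
  set μ : Measure M := Measure.sum fun k =>
    (chartVolume g (chartAt (EuclideanSpace ℝ (Fin n)) (c k))).restrict (D k) with hμ
  have key : ∀ φ ∈ atlas (EuclideanSpace ℝ (Fin n)) M, ∀ S : Set M, MeasurableSet S →
      chartVolume g φ S = μ (S ∩ φ.source) := fun φ hφ S hS => by
    have hS' := hS.inter φ.open_source.measurableSet
    rw [hμ, Measure.sum_apply _ hS', ← chartVolume_inter_source g φ hS]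
    have hsum : chartVolume g φ (S ∩ φ.source)
        = ∑' k, chartVolume g φ (S ∩ φ.source ∩ D k) := by
      rw [← measure_iUnion ((disjoint_disjointed _).mono fun i j h =>
        h.mono inter_subset_right inter_subset_right) fun k => hS'.inter (hDm k),
        ← inter_iUnion, hDu, inter_univ]
    rw [hsum]
    refine tsum_congr fun k => ?_
    rw [Measure.restrict_apply hS']
    exact chartVolume_eq_of_subset g hφ (chart_mem_atlas _ _) (hS'.inter (hDm k))
      (inter_subset_left.trans inter_subset_right)
      (inter_subset_right.trans (disjointed_subset _ k))
  have hle : riemannianVolume g ≤ μ := iSup₂_le fun φ hφ => Measure.le_iff.2 fun S hS => by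
    rw [key φ hφ S hS]
    exact measure_mono inter_subset_left
  refine (hle S).trans ?_
  rw [key φ hφ S hS, inter_eq_left.2 hSφ]

theorem restrict_riemannianVolume [CompactSpace M] (g : Metric n M)
    (hφ : φ ∈ atlas (EuclideanSpace ℝ (Fin n)) M) :
    (riemannianVolume g).restrict φ.source = chartVolume g φ := by
  ext S hS
  rw [Measure.restrict_apply hS, riemannianVolume_apply g hφ
    (hS.inter φ.open_source.measurableSet) inter_subset_right, chartVolume_inter_source g φ hS]

/-- Integration of a continuous function supported in the domain of a chart. -/
theorem integral_riemannianVolume_eq [CompactSpace M] (g : Metric n M)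
    (hφ : φ ∈ atlas (EuclideanSpace ℝ (Fin n)) M) {F : M → ℝ} (hF : Continuous F)
    (hsupp : tsupport F ⊆ φ.source) :
    Integrable F (riemannianVolume g) ∧
      ∫ x, F x ∂(riemannianVolume g)
        = ∫ y in φ.target, F (φ.symm y) * density (coeff φ g.inner) y := by
  have hzero : ∀ x, x ∉ φ.source → F x = 0 := fun x hx =>
    image_eq_zero_of_notMem_tsupport fun h => hx (hsupp h)
  have hG := isMetricOn_coeff g hφ
  have hcont : ContinuousOn (fun y => F (φ.symm y) * density (coeff φ g.inner) y) φ.target :=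
    (hF.comp_continuousOn φ.continuousOn_symm).mul hG.contDiffOn_density.continuousOn
  have hK : IsCompact (φ '' tsupport F) :=
    (isClosed_tsupport F).isCompact.image_of_continuousOn (φ.continuousOn.mono hsupp)
  have hKsub : φ '' tsupport F ⊆ φ.target := by
    rintro _ ⟨x, hx, rfl⟩
    exact φ.map_source (hsupp hx)
  have hint : IntegrableOn (fun y => F (φ.symm y) * density (coeff φ g.inner) y) φ.target :=
    ((hcont.mono hKsub).integrableOn_compact hK).of_forall_sdiff_eq_zero
      φ.open_target.measurableSet fun y hy => by
        have : F (φ.symm y) = 0 := image_eq_zero_of_notMem_tsupport fun h =>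
          hy.2 ⟨φ.symm y, h, φ.right_inv hy.1⟩
        simp [this]
  have hdm : AEMeasurable (fun y => ENNReal.ofReal (Real.sqrt (coeff φ g.inner y).det))
      (volume.restrict φ.target) :=
    (hG.contDiffOn_density.continuousOn.aemeasurable φ.open_target.measurableSet).ennreal_ofReal
  have hconv : ∀ y, (ENNReal.ofReal (Real.sqrt (coeff φ g.inner y).det)).toReal • F (φ.symm y)
      = F (φ.symm y) * density (coeff φ g.inner) y := fun y => by
    rw [ENNReal.toReal_ofReal (Real.sqrt_nonneg _), smul_eq_mul, mul_comm, density]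
  constructor
  · rw [← integrableOn_iff_integrable_of_support_subset
      (s := φ.source) fun x hx => by_contra fun h => hx (hzero x h), IntegrableOn,
      restrict_riemannianVolume g hφ, chartVolume,
      integrable_map_measure hF.aestronglyMeasurable (aemeasurable_chart_symm φ _),
      integrable_withDensity_iff_integrable_smul₀' hdm (by simp)]
    simp only [Function.comp_apply, hconv]
    exact hint
  · rw [← setIntegral_eq_integral_of_forall_compl_eq_zero hzero, restrict_riemannianVolume g hφ,
      chartVolume, integral_map (aemeasurable_chart_symm φ _) hF.aestronglyMeasurable,
      integral_withDensity_eq_integral_toReal_smul₀ hdm (by simp)]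
    simp only [hconv]

end Volume


/-! ### Integrals of compactly supported functions in coordinates -/

section CompactSupport

open scoped Topology

variable {n : ℕ} {U K : Set (EuclideanSpace ℝ (Fin n))} {P : EuclideanSpace ℝ (Fin n) → ℝ}

theorem integrableOn_of_isCompact (hU : IsOpen U) (hK : IsCompact K) (hKU : K ⊆ U)
    (hP : ContinuousOn P U) (hzero : ∀ y ∈ U \ K, P y = 0) : IntegrableOn P U :=
  ((hP.mono hKU).integrableOn_compact hK).of_forall_sdiff_eq_zero hU.measurableSet hzero

theorem indicator_eventuallyEq_zero (hK : IsCompact K) (hKU : K ⊆ U)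
    (hzero : ∀ y ∈ U \ K, P y = 0) {y : EuclideanSpace ℝ (Fin n)} (hy : y ∉ U) :
    U.indicator P =ᶠ[𝓝 y] fun _ => 0 := by
  filter_upwards [hK.isClosed.isOpen_compl.mem_nhds fun h => hy (hKU h)] with z hz
  by_cases hzU : z ∈ U
  · rw [indicator_of_mem hzU, hzero z ⟨hzU, hz⟩]
  · rw [indicator_of_notMem hzU]

theorem indicator_eventuallyEq (hU : IsOpen U) {y : EuclideanSpace ℝ (Fin n)} (hy : y ∈ U) :
    U.indicator P =ᶠ[𝓝 y] P := by
  filter_upwards [hU.mem_nhds hy] with z hz using indicator_of_mem hz P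

theorem contDiff_indicator (hU : IsOpen U) (hK : IsCompact K) (hKU : K ⊆ U)
    (hP : ContDiffOn ℝ ∞ P U) (hzero : ∀ y ∈ U \ K, P y = 0) :
    ContDiff ℝ ∞ (U.indicator P) := by
  refine contDiff_iff_contDiffAt.2 fun y => ?_
  by_cases hy : y ∈ U
  · exact (hP.contDiffAt (hU.mem_nhds hy)).congr_of_eventuallyEq (indicator_eventuallyEq hU hy)
  · exact contDiffAt_const.congr_of_eventuallyEq (indicator_eventuallyEq_zero hK hKU hzero hy)

/-- Extended by zero, `P` is smooth with compact support on the whole space, where integration by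
parts against the constant `1` applies. -/
theorem setIntegral_partialDeriv_eq_zero (hU : IsOpen U) (hK : IsCompact K) (hKU : K ⊆ U)
    (hP : ContDiffOn ℝ ∞ P U) (hzero : ∀ y ∈ U \ K, P y = 0) (i : Fin n) :
    ∫ y in U, partialDeriv i P y = 0 := by
  set Q := U.indicator P with hQ
  have hQd : ContDiff ℝ ∞ Q := contDiff_indicator hU hK hKU hP hzero
  have hQs : HasCompactSupport Q := HasCompactSupport.intro hK fun y hy => by
    by_cases hyU : y ∈ U
    · rw [hQ, indicator_of_mem hyU, hzero y ⟨hyU, hy⟩]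
    · rw [hQ, indicator_of_notMem hyU]
  have h1 : ∫ y in U, partialDeriv i P y = ∫ y, partialDeriv i Q y := by
    rw [← integral_indicator hU.measurableSet]
    congr 1
    funext y
    by_cases hy : y ∈ U
    · rw [indicator_of_mem hy, partialDeriv_congr (indicator_eventuallyEq hU hy)]
    · rw [indicator_of_notMem hy, partialDeriv_congr (indicator_eventuallyEq_zero hK hKU hzero hy),
        partialDeriv_const]
  have hcont : Continuous (partialDeriv i Q) :=
    (hQd.continuous_fderiv (by simp)).clm_apply continuous_const
  have hint : Integrable (partialDeriv i Q) :=
    hcont.integrable_of_hasCompactSupport (hQs.fderiv_apply ℝ _)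
  have h2 := integral_bilinear_hasLineDerivAt_right_eq_neg_left_of_integrable
    (μ := (volume : Measure (EuclideanSpace ℝ (Fin n)))) (B := ContinuousLinearMap.mul ℝ ℝ)
    (f := fun _ => (1 : ℝ)) (f' := fun _ => 0) (g := Q) (g' := partialDeriv i Q)
    (v := EuclideanSpace.single i (1 : ℝ)) (by simp) (by simpa using hint)
    (by simpa using hQd.continuous.integrable_of_hasCompactSupport hQs)
    (fun x _ => (hasFDerivAt_const (1 : ℝ) x).hasLineDerivAt _)
    fun x _ => ((hQd.differentiable (by simp)) x).hasFDerivAt.hasLineDerivAt _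
  rw [h1]
  simpa using h2

/-- The integrand lives on the compact set `K`, and on `[-ε/2, ε/2] × K` the parameter derivative is
bounded by a constant. That constant dominates on the finite-measure set `K`, so differentiation
under the integral is allowed. -/
theorem hasDerivAt_setIntegral {ε : ℝ} (hε : 0 < ε) (hU : IsOpen U) (hK : IsCompact K)
    (hKU : K ⊆ U) {L : ℝ → EuclideanSpace ℝ (Fin n) → ℝ}
    (hL : ContDiffOn ℝ ∞ (fun p : ℝ × EuclideanSpace ℝ (Fin n) => L p.1 p.2) (Ioo (-ε) ε ×ˢ U))
    (hzero : ∀ s, ∀ y ∈ U \ K, L s y = 0) :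
    HasDerivAt (fun s => ∫ y in U, L s y) (∫ y in U, deriv (fun t => L t y) 0) 0 := by
  have hΩ : IsOpen (Ioo (-ε) ε ×ˢ U) := isOpen_Ioo.prod hU
  have e1 : ∀ s, ∫ y in U, L s y = ∫ y in K, L s y := fun s =>
    setIntegral_eq_of_subset_of_forall_sdiff_eq_zero hU.measurableSet hKU (hzero s)
  have e2 : ∫ y in U, deriv (fun t => L t y) 0 = ∫ y in K, deriv (fun t => L t y) 0 :=
    setIntegral_eq_of_subset_of_forall_sdiff_eq_zero hU.measurableSet hKU fun y hy => by
      simp only [hzero _ y hy, deriv_const]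
  simp only [e1, e2]
  have hmem : ∀ {s}, s ∈ Icc (-(ε / 2)) (ε / 2) → s ∈ Ioo (-ε) ε := fun hs =>
    ⟨by linarith [hs.1], by linarith [hs.2]⟩
  have hd := contDiffOn_deriv_slice hΩ hL
  obtain ⟨C, hC⟩ := ((isCompact_Icc (a := -(ε / 2)) (b := ε / 2)).prod hK).exists_bound_of_continuousOn
    (hd.continuousOn.mono (prod_mono (fun s hs => hmem hs) hKU))
  have hslice : ∀ {s}, s ∈ Ioo (-ε) ε → ContinuousOn (L s) K := fun {s} hs =>
    hL.continuousOn.comp (Continuous.prodMk_right s).continuousOn fun y hy => ⟨hs, hKU hy⟩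
  have h0 : (0 : ℝ) ∈ Ioo (-ε) ε := ⟨by linarith, hε⟩
  have hnhds : Icc (-(ε / 2)) (ε / 2) ∈ 𝓝 (0 : ℝ) := Icc_mem_nhds (by linarith) (by linarith)
  have hsliced : ContinuousOn (fun y => deriv (fun t => L t y) 0) K :=
    hd.continuousOn.comp (Continuous.prodMk_right (0 : ℝ)).continuousOn fun y hy => ⟨h0, hKU hy⟩
  refine (hasDerivAt_integral_of_dominated_loc_of_deriv_le (μ := volume.restrict K)
    (F := L) (F' := fun s y => deriv (fun t => L t y) s) (bound := fun _ => C) hnhds ?_ ?_ ?_ ?_ ?_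
    ?_).2
  · filter_upwards [hnhds] with s hs
    exact (hslice (hmem hs)).aestronglyMeasurable hK.measurableSet
  · exact (hslice h0).integrableOn_compact hK
  · exact hsliced.aestronglyMeasurable hK.measurableSet
  · exact (ae_restrict_iff' hK.measurableSet).2 (.of_forall fun y hy s hs => hC (s, y) ⟨hs, hy⟩)
  · exact integrableOn_const hK.measure_lt_top.ne
  · exact (ae_restrict_iff' hK.measurableSet).2 (.of_forall fun y hy s hs =>
      (hasDerivAt_slice hΩ hL (show (s, y) ∈ Ioo (-ε) ε ×ˢ U from
        ⟨hmem hs, hKU hy⟩)).differentiableAt.hasDerivAt)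

end CompactSupport


/-! ### The entropy integrands in arbitrary charts -/

section Smoothness

variable {n : ℕ} {Ω : Set (ℝ × EuclideanSpace ℝ (Fin n))}
  {G : ℝ → EuclideanSpace ℝ (Fin n) → Matrix (Fin n) (Fin n) ℝ} {s : ℝ}
  {V : EuclideanSpace ℝ (Fin n) → Matrix (Fin n) (Fin n) ℝ}
  {F : ℝ → EuclideanSpace ℝ (Fin n) → ℝ} {H : EuclideanSpace ℝ (Fin n) → ℝ} {τ : ℝ → ℝ}

theorem IsMetricFamilyOn.contDiffOn_localScalar (hG : IsMetricFamilyOn Ω G) :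
    ContDiffOn ℝ ∞ (fun p : ℝ × _ => localScalar (G p.1) p.2) Ω := by
  unfold localScalar metricTrace
  exact ContDiffOn.sum fun i _ => ContDiffOn.sum fun j _ =>
    (hG.contDiffOn_inv i j).mul (hG.contDiffOn_ricci i j)

theorem IsMetricFamilyOn.contDiffOn_localGradSq (hG : IsMetricFamilyOn Ω G)
    (hF : ContDiffOn ℝ ∞ (fun p : ℝ × _ => F p.1 p.2) Ω) :
    ContDiffOn ℝ ∞ (fun p : ℝ × _ => localGradSq (G p.1) (F p.1) p.2) Ω :=
  ContDiffOn.sum fun i _ => ContDiffOn.sum fun j _ =>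
    ((hG.contDiffOn_inv i j).mul (contDiffOn_partialDeriv_slice hG.isOpen hF i)).mul
      (contDiffOn_partialDeriv_slice hG.isOpen hF j)

theorem IsMetricFamilyOn.contDiffOn_localLaplacian (hG : IsMetricFamilyOn Ω G)
    (hF : ContDiffOn ℝ ∞ (fun p : ℝ × _ => F p.1 p.2) Ω) :
    ContDiffOn ℝ ∞ (fun p : ℝ × _ => localLaplacian (G p.1) (F p.1) p.2) Ω := by
  unfold localLaplacian metricTrace
  exact ContDiffOn.sum fun i _ => ContDiffOn.sum fun j _ =>
    (hG.contDiffOn_inv i j).mul (hG.contDiffOn_hessian hF i j)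

theorem IsMetricFamilyOn.contDiffOn_localEntropy (hG : IsMetricFamilyOn Ω G)
    (hF : ContDiffOn ℝ ∞ (fun p : ℝ × _ => F p.1 p.2) Ω)
    (hτ : ContDiffOn ℝ ∞ (fun p : ℝ × EuclideanSpace ℝ (Fin n) => τ p.1) Ω)
    (hpos : ∀ p ∈ Ω, 0 < τ p.1) :
    ContDiffOn ℝ ∞ (fun p : ℝ × _ => localEntropy (G p.1) (F p.1) (τ p.1) p.2) Ω := by
  have hc : ContDiffOn ℝ ∞ (fun p : ℝ × EuclideanSpace ℝ (Fin n) =>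
      (4 * Real.pi * τ p.1) ^ (-(n : ℝ) / 2)) Ω :=
    (contDiffOn_const.mul hτ).rpow_const_of_ne fun p hp => by
      have := hpos p hp
      have := Real.pi_pos
      positivity
  exact (((hτ.mul ((hG.contDiffOn_localGradSq hF).add hG.contDiffOn_localScalar)).add hF).sub
    contDiffOn_const).mul (hc.mul hF.neg.exp)

theorem contDiffOn_localVariation (hG : IsMetricFamilyOn Ω G)
    (hV : ∀ z, (s, z) ∈ Ω → ∀ i j, HasDerivAt (fun t => G t z i j) (V z i j) s)
    (hF : ContDiffOn ℝ ∞ (fun p : ℝ × _ => F p.1 p.2) Ω)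
    (hH : ∀ z, (s, z) ∈ Ω → HasDerivAt (fun t => F t z) (H z) s) (c σ : ℝ) :
    ContDiffOn ℝ ∞ (localVariation (G s) (F s) c V H σ) {z | (s, z) ∈ Ω} := by
  have hs := hG.slice s
  have hFs := contDiffOn_slice hF s
  have hV' : ∀ i j, ContDiffOn ℝ ∞ (fun z => V z i j) {z | (s, z) ∈ Ω} := fun i j =>
    contDiffOn_of_hasDerivAt (F := fun t z => G t z i j) hG.isOpen (hG.contDiffOn i j)
      fun z hz => hV z hz i j
  have hH' := contDiffOn_of_hasDerivAt hG.isOpen hF hH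
  have hR := contDiffOn_slice (u := fun s => localScalar (G s)) hG.contDiffOn_localScalar s
  have hN := contDiffOn_slice (u := fun s => localGradSq (G s) (F s))
    (hG.contDiffOn_localGradSq hF) s
  have hL := contDiffOn_slice (u := fun s => localLaplacian (G s) (F s))
    (hG.contDiffOn_localLaplacian hF) s
  have hT : ∀ i j, ContDiffOn ℝ ∞ (fun z => (ricci (G s) z + hessian (G s) (F s) z) i j)
      {z | (s, z) ∈ Ω} := fun i j =>
    (contDiffOn_slice (u := fun s z => ricci (G s) z i j) (hG.contDiffOn_ricci i j) s).add
      (contDiffOn_slice (u := fun s z => hessian (G s) (F s) z i j)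
        (hG.contDiffOn_hessian hF i j) s)
  have hP : ContDiffOn ℝ ∞ (fun z => metricPairing (G s z) (V z)
      (ricci (G s) z + hessian (G s) (F s) z)) {z | (s, z) ∈ Ω} :=
    ContDiffOn.sum fun i _ => ContDiffOn.sum fun j _ => ContDiffOn.sum fun k _ =>
      ContDiffOn.sum fun l _ => (((hs.contDiffOn_inv i k).mul (hs.contDiffOn_inv j l)).mul
        (hV' i j)).mul (hT k l)
  have htr := contDiffOn_metricTrace_variation hG hV
  exact ((((contDiffOn_const.mul (hR.add hN)).sub (contDiffOn_const.mul hP)).add hH').add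
    (((contDiffOn_const.mul (((contDiffOn_const.mul hL).sub hN).add hR)).add hFs).sub
      contDiffOn_const |>.mul (((htr.div_const 2).sub hH').sub contDiffOn_const))).mul
    (contDiffOn_const.mul hFs.neg.exp)

theorem contDiffOn_entropyFlux (hG : IsMetricFamilyOn Ω G)
    (hV : ∀ z, (s, z) ∈ Ω → ∀ i j, HasDerivAt (fun t => G t z i j) (V z i j) s)
    (hF : ContDiffOn ℝ ∞ (fun p : ℝ × _ => F p.1 p.2) Ω)
    (hH : ∀ z, (s, z) ∈ Ω → HasDerivAt (fun t => F t z) (H z) s) (c : ℝ)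
    {r : EuclideanSpace ℝ (Fin n) → ℝ} (hr : ContDiffOn ℝ ∞ r {z | (s, z) ∈ Ω}) :
    ContDiffOn ℝ ∞ (entropyFlux G s (F s) V H c r) {z | (s, z) ∈ Ω} :=
  ContDiffOn.sum fun i _ => (contDiffOn_entropyField hG hV hF hH c i).mul
    (contDiffOn_partialDeriv (hG.slice s).isOpen hr i)

end Smoothness

section Manifold

open scoped Topology

variable {n : ℕ} {M : Type*} [TopologicalSpace M] [ChartedSpace (EuclideanSpace ℝ (Fin n)) M]
  [IsManifold (𝓡 n) ∞ M]

/-- A smooth one-parameter family of a metric, a function and a scale, with its first variation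
at the parameter `0`. -/
structure IsVariation (ε : ℝ) (g : ℝ → Metric n M) (f : ℝ → M → ℝ) (τ : ℝ → ℝ)
    (v : TensorField n M) (h : M → ℝ) (σ : ℝ) : Prop where
  pos : 0 < ε
  metric : ContMDiffOn (𝓘(ℝ, ℝ).prod (𝓡 n))
      ((𝓡 n).prod
        𝓘(ℝ, EuclideanSpace ℝ (Fin n) →L[ℝ] EuclideanSpace ℝ (Fin n) →L[ℝ] ℝ)) ∞
      (fun p : ℝ × M => Bundle.TotalSpace.mk'
        (EuclideanSpace ℝ (Fin n) →L[ℝ] EuclideanSpace ℝ (Fin n) →L[ℝ] ℝ)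
        (E := fun x : M => TangentSpace (𝓡 n) x →L[ℝ] TangentSpace (𝓡 n) x →L[ℝ] ℝ)
        p.2 ((g p.1).inner p.2))
      (Set.Ioo (-ε) ε ×ˢ Set.univ)
  function : ContMDiffOn (𝓘(ℝ, ℝ).prod (𝓡 n)) 𝓘(ℝ, ℝ) ∞ (fun p : ℝ × M => f p.1 p.2)
      (Set.Ioo (-ε) ε ×ˢ Set.univ)
  scale : ContDiffOn ℝ ∞ τ (Set.Ioo (-ε) ε)
  scale_pos : ∀ s ∈ Set.Ioo (-ε) ε, 0 < τ s
  hasDerivAt_metric : ∀ (x : M) (X Y : TangentSpace (𝓡 n) x),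
      HasDerivAt (fun s => (g s).inner x X Y) (v x X Y) 0
  hasDerivAt_function : ∀ x : M, HasDerivAt (fun s => f s x) (h x) 0
  hasDerivAt_scale : HasDerivAt τ σ 0

variable {ε : ℝ} {g : ℝ → Metric n M} {f : ℝ → M → ℝ} {τ : ℝ → ℝ} {v : TensorField n M}
  {h : M → ℝ} {σ : ℝ} {φ : OpenPartialHomeomorph M (EuclideanSpace ℝ (Fin n))}

-- A quantity defined at each point in the preferred chart of that point need not look continuous,
-- as the chart jumps. Agreement with a continuous expression in one fixed chart on its whole domain
-- repairs this.
omit [IsManifold (𝓡 n) ∞ M] in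
theorem continuous_of_charts {F : M → ℝ}
    (k : OpenPartialHomeomorph M (EuclideanSpace ℝ (Fin n)) → EuclideanSpace ℝ (Fin n) → ℝ)
    (hk : ∀ φ ∈ atlas (EuclideanSpace ℝ (Fin n)) M, ContinuousOn (k φ) φ.target)
    (hF : ∀ φ ∈ atlas (EuclideanSpace ℝ (Fin n)) M, ∀ x ∈ φ.source, F x = k φ (φ x)) :
    Continuous F := continuous_iff_continuousAt.2 fun x => by
  set φ := chartAt (EuclideanSpace ℝ (Fin n)) x
  have hφ : φ ∈ atlas (EuclideanSpace ℝ (Fin n)) M := chart_mem_atlas _ x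
  have hx : φ.source ∈ 𝓝 x := chart_source_mem_nhds _ x
  refine ContinuousAt.congr (f := k φ ∘ φ) ?_ ?_
  · exact ((hk φ hφ).comp φ.continuousOn φ.mapsTo).continuousAt hx
  · filter_upwards [hx] with z hz using (hF φ hφ z hz).symm

theorem contDiffOn_function_comp_chart_symm {ρ : M → ℝ}
    (hρ : ContMDiff (𝓡 n) 𝓘(ℝ, ℝ) ∞ ρ) (hφ : φ ∈ atlas (EuclideanSpace ℝ (Fin n)) M) :
    ContDiffOn ℝ ∞ (ρ ∘ φ.symm) φ.target :=
  contMDiffOn_iff_contDiffOn.1 (hρ.comp_contMDiffOn (contMDiffOn_chart_symm hφ))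

omit [ChartedSpace (EuclideanSpace ℝ (Fin n)) M] [IsManifold (𝓡 n) ∞ M] in
theorem mem_transition_source {φ' φ : OpenPartialHomeomorph M (EuclideanSpace ℝ (Fin n))} {x : M}
    (hx' : x ∈ φ'.source) (hx : x ∈ φ.source) : φ' x ∈ (φ'.symm.trans φ).source := by
  simp only [mfld_simps]
  exact ⟨φ'.map_source hx', by simpa only [φ'.left_inv hx'] using hx⟩

omit [ChartedSpace (EuclideanSpace ℝ (Fin n)) M] [IsManifold (𝓡 n) ∞ M] in
theorem transition_apply {φ' φ : OpenPartialHomeomorph M (EuclideanSpace ℝ (Fin n))} {x : M}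
    (hx' : x ∈ φ'.source) : transition φ' φ (φ' x) = φ x := by
  rw [transition, φ'.left_inv hx']

omit [ChartedSpace (EuclideanSpace ℝ (Fin n)) M] [IsManifold (𝓡 n) ∞ M] in
theorem comp_chart_symm_transition (ρ : M → ℝ)
    {φ' φ : OpenPartialHomeomorph M (EuclideanSpace ℝ (Fin n))} {y : EuclideanSpace ℝ (Fin n)}
    (hy : y ∈ (φ'.symm.trans φ).source) :
    (ρ ∘ φ'.symm) y = (ρ ∘ φ.symm) (transition φ' φ y) := by
  simp only [mfld_simps] at hy
  simp only [Function.comp_apply, transition, φ.left_inv hy.2]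

/-- The flux `e^(-f) Y·ρ` of the field `entropyField` in the chart `φ`. -/
noncomputable def chartFlux (g : ℝ → Metric n M) (f : M → ℝ) (v : TensorField n M) (h : M → ℝ)
    (c : ℝ) (ρ : M → ℝ) (φ : OpenPartialHomeomorph M (EuclideanSpace ℝ (Fin n)))
    (y : EuclideanSpace ℝ (Fin n)) : ℝ :=
  Real.exp (-(f ∘ φ.symm) y)
    * entropyFlux (fun s => coeff φ (g s).inner) 0 (f ∘ φ.symm) (coeff φ v) (h ∘ φ.symm) c
      (ρ ∘ φ.symm) y

/-- The flux `e^(-f) Y·ρ` at a point. -/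
noncomputable def fluxAt (g : ℝ → Metric n M) (f : M → ℝ) (v : TensorField n M) (h : M → ℝ)
    (c : ℝ) (ρ : M → ℝ) (x : M) : ℝ :=
  chartFlux g f v h c ρ (chartAt (EuclideanSpace ℝ (Fin n)) x)
    (chartAt (EuclideanSpace ℝ (Fin n)) x x)

namespace IsVariation

variable (D : IsVariation ε g f τ v h σ)
include D

theorem zero_mem : (0 : ℝ) ∈ Ioo (-ε) ε := ⟨neg_lt_zero.2 D.pos, D.pos⟩

theorem isMetricFamilyOn (hφ : φ ∈ atlas (EuclideanSpace ℝ (Fin n)) M) :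
    IsMetricFamilyOn (Ioo (-ε) ε ×ˢ φ.target) (fun s => coeff φ (g s).inner) :=
  isMetricFamilyOn_coeff D.metric hφ

theorem contDiffOn_function (hφ : φ ∈ atlas (EuclideanSpace ℝ (Fin n)) M) :
    ContDiffOn ℝ ∞ (fun p : ℝ × EuclideanSpace ℝ (Fin n) => (f p.1 ∘ φ.symm) p.2)
      (Ioo (-ε) ε ×ˢ φ.target) :=
  contDiffOn_comp_chart_symm D.function hφ

omit [ChartedSpace (EuclideanSpace ℝ (Fin n)) M] [IsManifold (𝓡 n) ∞ M] D in
theorem slice_eq {s : ℝ} (hs : s ∈ Ioo (-ε) ε)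
    (φ : OpenPartialHomeomorph M (EuclideanSpace ℝ (Fin n))) :
    {z | (s, z) ∈ Ioo (-ε) ε ×ˢ φ.target} = φ.target := by
  ext z
  simp only [mem_ofPred_eq, mem_prod, hs, true_and]

theorem contDiffOn_function_slice (hφ : φ ∈ atlas (EuclideanSpace ℝ (Fin n)) M) {s : ℝ}
    (hs : s ∈ Ioo (-ε) ε) : ContDiffOn ℝ ∞ (f s ∘ φ.symm) φ.target := by
  have := contDiffOn_slice (u := fun s => f s ∘ φ.symm) (D.contDiffOn_function hφ) s
  rwa [slice_eq hs] at this

theorem hasDerivAt_coeff (φ : OpenPartialHomeomorph M (EuclideanSpace ℝ (Fin n)))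
    (z : EuclideanSpace ℝ (Fin n)) (_ : (0, z) ∈ Ioo (-ε) ε ×ˢ φ.target) (i j : Fin n) :
    HasDerivAt (fun t => coeff φ (g t).inner z i j) (coeff φ v z i j) 0 :=
  D.hasDerivAt_metric _ _ _

theorem hasDerivAt_comp (φ : OpenPartialHomeomorph M (EuclideanSpace ℝ (Fin n)))
    (z : EuclideanSpace ℝ (Fin n)) (_ : (0, z) ∈ Ioo (-ε) ε ×ˢ φ.target) :
    HasDerivAt (fun t => (f t ∘ φ.symm) z) ((h ∘ φ.symm) z) 0 :=
  D.hasDerivAt_function _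

theorem contDiffOn_localEntropy (hφ : φ ∈ atlas (EuclideanSpace ℝ (Fin n)) M) :
    ContDiffOn ℝ ∞ (fun p : ℝ × EuclideanSpace ℝ (Fin n) =>
      localEntropy (coeff φ (g p.1).inner) (f p.1 ∘ φ.symm) (τ p.1) p.2)
      (Ioo (-ε) ε ×ˢ φ.target) :=
  (D.isMetricFamilyOn hφ).contDiffOn_localEntropy (F := fun s => f s ∘ φ.symm)
    (D.contDiffOn_function hφ) (D.scale.comp contDiffOn_fst fun _ hp => hp.1)
    fun _ hp => D.scale_pos _ hp.1

/-- Coordinate invariance replaces the preferred chart at `x`, which varies with `x`, by one fixed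
chart in which the integrand can be integrated and differentiated. -/
theorem entropyIntegrand_eq {s : ℝ} (hs : s ∈ Ioo (-ε) ε)
    (hφ : φ ∈ atlas (EuclideanSpace ℝ (Fin n)) M) {x : M} (hx : x ∈ φ.source) :
    entropyIntegrand (g s) (f s) (τ s) x
      = localEntropy (coeff φ (g s).inner) (f s ∘ φ.symm) (τ s) (φ x) := by
  set φ' := chartAt (EuclideanSpace ℝ (Fin n)) x with hφ'd
  have hφ' : φ' ∈ atlas (EuclideanSpace ℝ (Fin n)) M := chart_mem_atlas _ x
  have hx' : x ∈ φ'.source := mem_chart_source _ x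
  have hc := isCoordinateChange_transition hφ' hφ (isMetricOn_coeff (g s) hφ')
    (isMetricOn_coeff (g s) hφ)
  have e := hc.localEntropy_eq (mem_transition_source hx' hx) (D.contDiffOn_function_slice hφ hs)
    (fun z hz => comp_chart_symm_transition (f s) hz) (τ s)
  rw [transition_apply hx'] at e
  rw [← e, localEntropy, Function.comp_apply, φ'.left_inv hx']
  rfl

theorem variationIntegrand_eq (hφ : φ ∈ atlas (EuclideanSpace ℝ (Fin n)) M) {x : M}
    (hx : x ∈ φ.source) :
    variationIntegrand (g 0) (f 0) (τ 0) v h σ x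
      = localVariation (coeff φ (g 0).inner) (f 0 ∘ φ.symm) (τ 0) (coeff φ v) (h ∘ φ.symm) σ
        (φ x) := by
  set φ' := chartAt (EuclideanSpace ℝ (Fin n)) x with hφ'd
  have hφ' : φ' ∈ atlas (EuclideanSpace ℝ (Fin n)) M := chart_mem_atlas _ x
  have hx' : x ∈ φ'.source := mem_chart_source _ x
  have hc := isCoordinateChange_transition hφ' hφ (isMetricOn_coeff (g 0) hφ')
    (isMetricOn_coeff (g 0) hφ)
  have hm := mem_transition_source hx' hx
  have e := hc.localVariation_eq hm (D.contDiffOn_function_slice hφ D.zero_mem)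
    (fun z hz => comp_chart_symm_transition (f 0) hz) (coeff_pullback hφ' hφ hm v)
    (comp_chart_symm_transition h hm) (τ 0) σ
  rw [transition_apply hx'] at e
  rw [← e, localVariation, Function.comp_apply, Function.comp_apply, φ'.left_inv hx']
  rfl

theorem chartFlux_eq {ρ : M → ℝ} (hρ : ContMDiff (𝓡 n) 𝓘(ℝ, ℝ) ∞ ρ) (c : ℝ)
    (hφ : φ ∈ atlas (EuclideanSpace ℝ (Fin n)) M) {x : M} (hx : x ∈ φ.source) :
    fluxAt g (f 0) v h c ρ x = chartFlux g (f 0) v h c ρ φ (φ x) := by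
  rw [fluxAt]
  set φ' := chartAt (EuclideanSpace ℝ (Fin n)) x with hφ'd
  have hφ' : φ' ∈ atlas (EuclideanSpace ℝ (Fin n)) M := chart_mem_atlas _ x
  have hx' : x ∈ φ'.source := mem_chart_source _ x
  have hm := mem_transition_source hx' hx
  have e := entropyFlux_eq (D.isMetricFamilyOn hφ) (D.isMetricFamilyOn hφ')
    (U' := (φ'.symm.trans φ).source) (U := φ.target) (ψ := transition φ' φ)
    (V := coeff φ v) (V' := coeff φ' v) (H := h ∘ φ.symm) (H' := h ∘ φ'.symm)
    (u := f 0 ∘ φ.symm) (u' := f 0 ∘ φ'.symm) (r := ρ ∘ φ.symm) (r' := ρ ∘ φ'.symm)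
    (s := 0)
    (fun z hz => ⟨D.zero_mem, by simp only [mfld_simps] at hz; exact hz.1⟩)
    (fun z hz => ⟨D.zero_mem, hz⟩) (D.hasDerivAt_coeff φ) (D.hasDerivAt_coeff φ')
    (.of_forall fun t => isCoordinateChange_transition hφ' hφ (isMetricOn_coeff (g t) hφ')
      (isMetricOn_coeff (g t) hφ)) hm
    (fun z hz => coeff_pullback hφ' hφ hz v) (fun z hz => comp_chart_symm_transition h hz)
    (D.contDiffOn_function_slice hφ D.zero_mem)
    (fun z hz => comp_chart_symm_transition (f 0) hz)
    (contDiffOn_function_comp_chart_symm hρ hφ)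
    (fun z hz => comp_chart_symm_transition ρ hz) c
  rw [chartFlux, chartFlux, e, transition_apply hx', Function.comp_apply, Function.comp_apply,
    φ'.left_inv hx', φ.left_inv hx]

theorem continuous_entropyIntegrand {s : ℝ} (hs : s ∈ Ioo (-ε) ε) :
    Continuous (entropyIntegrand (g s) (f s) (τ s)) :=
  continuous_of_charts (fun φ => localEntropy (coeff φ (g s).inner) (f s ∘ φ.symm) (τ s))
    (fun _ hφ => (D.contDiffOn_localEntropy hφ).continuousOn.comp
      (Continuous.prodMk_right s).continuousOn fun _ hy => ⟨hs, hy⟩)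
    fun _ hφ _ hx => D.entropyIntegrand_eq hs hφ hx

theorem continuousOn_localVariation (hφ : φ ∈ atlas (EuclideanSpace ℝ (Fin n)) M) :
    ContinuousOn (localVariation (coeff φ (g 0).inner) (f 0 ∘ φ.symm) (τ 0) (coeff φ v)
      (h ∘ φ.symm) σ) φ.target := by
  have := contDiffOn_localVariation (D.isMetricFamilyOn hφ) (D.hasDerivAt_coeff φ)
    (F := fun s => f s ∘ φ.symm) (D.contDiffOn_function hφ) (D.hasDerivAt_comp φ) (τ 0) σ
  rw [slice_eq D.zero_mem] at this
  exact this.continuousOn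

theorem continuous_variationIntegrand :
    Continuous (variationIntegrand (g 0) (f 0) (τ 0) v h σ) :=
  continuous_of_charts _ (fun _ hφ => D.continuousOn_localVariation hφ)
    fun _ hφ _ hx => D.variationIntegrand_eq hφ hx

theorem continuous_fluxAt {ρ : M → ℝ} (hρ : ContMDiff (𝓡 n) 𝓘(ℝ, ℝ) ∞ ρ) (c : ℝ) :
    Continuous (fluxAt g (f 0) v h c ρ) := by
  refine continuous_of_charts _ (fun φ hφ => ?_) fun _ hφ _ hx => D.chartFlux_eq hρ c hφ hx
  have hr : ContDiffOn ℝ ∞ (ρ ∘ φ.symm) {z | ((0 : ℝ), z) ∈ Ioo (-ε) ε ×ˢ φ.target} := by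
    rw [slice_eq D.zero_mem]
    exact contDiffOn_function_comp_chart_symm hρ hφ
  have := contDiffOn_entropyFlux (D.isMetricFamilyOn hφ) (D.hasDerivAt_coeff φ)
    (F := fun s => f s ∘ φ.symm) (D.contDiffOn_function hφ) (D.hasDerivAt_comp φ) c hr
  rw [slice_eq D.zero_mem] at this
  exact ((D.contDiffOn_function_slice hφ D.zero_mem).neg.exp.mul this).continuousOn

end IsVariation

end Manifold


/-! ### The first variation against a cutoff function supported in a chart -/

section Localized

open scoped Topology

variable {n : ℕ} {M : Type*} [TopologicalSpace M] [ChartedSpace (EuclideanSpace ℝ (Fin n)) M]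
  [IsManifold (𝓡 n) ∞ M] {ε : ℝ} {g : ℝ → Metric n M} {f : ℝ → M → ℝ} {τ : ℝ → ℝ}
  {v : TensorField n M} {h : M → ℝ} {σ : ℝ}
  {φ : OpenPartialHomeomorph M (EuclideanSpace ℝ (Fin n))} {ρ : M → ℝ}

omit [ChartedSpace (EuclideanSpace ℝ (Fin n)) M] [IsManifold (𝓡 n) ∞ M] in
theorem partialDeriv_comp_chart_symm_eq_zero {y : EuclideanSpace ℝ (Fin n)} (hy : y ∈ φ.target)
    (hρ : φ.symm y ∉ tsupport ρ) (i : Fin n) : partialDeriv i (ρ ∘ φ.symm) y = 0 := by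
  have : ρ ∘ φ.symm =ᶠ[𝓝 y] fun _ => 0 :=
    (φ.symm.continuousAt hy).eventually (notMem_tsupport_iff_eventuallyEq.1 hρ)
  rw [partialDeriv_congr this, partialDeriv_const]

theorem fluxAt_eq_zero {x : M} (hx : x ∉ tsupport ρ) (f : M → ℝ) (c : ℝ) :
    fluxAt g f v h c ρ x = 0 := by
  have hx' : (chartAt (EuclideanSpace ℝ (Fin n)) x).symm
      (chartAt (EuclideanSpace ℝ (Fin n)) x x) ∉ tsupport ρ := by
    rwa [(chartAt (EuclideanSpace ℝ (Fin n)) x).left_inv (mem_chart_source _ x)]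
  simp only [fluxAt, chartFlux, entropyFlux, partialDeriv_comp_chart_symm_eq_zero
    (mem_chart_target _ x) hx', mul_zero, Finset.sum_const_zero]

theorem tsupport_fluxAt_subset (f : M → ℝ) (c : ℝ) :
    tsupport (fluxAt g f v h c ρ) ⊆ tsupport ρ :=
  closure_minimal (fun _ hx => by_contra fun hx' => hx (fluxAt_eq_zero hx' f c))
    (isClosed_tsupport ρ)

namespace IsVariation

variable [CompactSpace M]
variable (D : IsVariation ε g f τ v h σ) (hφ : φ ∈ atlas (EuclideanSpace ℝ (Fin n)) M)
  (hρ : ContMDiff (𝓡 n) 𝓘(ℝ, ℝ) ∞ ρ) (hsupp : tsupport ρ ⊆ φ.source)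
include D hφ hρ hsupp

/-- Integration by parts in a chart. -/
theorem setIntegral_mul_divergence (c : ℝ) :
    IntegrableOn (fun y => (ρ ∘ φ.symm) y * ∑ i, partialDeriv i (fun z =>
        density (coeff φ (g 0).inner) z * Real.exp (-(f 0 ∘ φ.symm) z)
          * entropyField (fun s => coeff φ (g s).inner) 0 (f 0 ∘ φ.symm) (coeff φ v) (h ∘ φ.symm)
            c i z) y) φ.target ∧
    ∫ y in φ.target, (ρ ∘ φ.symm) y * ∑ i, partialDeriv i (fun z =>
        density (coeff φ (g 0).inner) z * Real.exp (-(f 0 ∘ φ.symm) z)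
          * entropyField (fun s => coeff φ (g s).inner) 0 (f 0 ∘ φ.symm) (coeff φ v) (h ∘ φ.symm)
            c i z) y
      = -∫ y in φ.target, chartFlux g (f 0) v h c ρ φ y * density (coeff φ (g 0).inner) y := by
  have hU := φ.open_target
  have hK : IsCompact (φ '' tsupport ρ) :=
    (isClosed_tsupport ρ).isCompact.image_of_continuousOn (φ.continuousOn.mono hsupp)
  have hKU : φ '' tsupport ρ ⊆ φ.target := by
    rintro _ ⟨x, hx, rfl⟩
    exact φ.map_source (hsupp hx)
  have hnot : ∀ y ∈ φ.target \ φ '' tsupport ρ, φ.symm y ∉ tsupport ρ := fun y hy h =>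
    hy.2 ⟨φ.symm y, h, φ.right_inv hy.1⟩
  have hr := contDiffOn_function_comp_chart_symm hρ hφ
  have hr0 : ∀ y ∈ φ.target \ φ '' tsupport ρ, (ρ ∘ φ.symm) y = 0 := fun y hy =>
    image_eq_zero_of_notMem_tsupport (f := ρ) (hnot y hy)
  have hr0' : ∀ i, ∀ y ∈ φ.target \ φ '' tsupport ρ, partialDeriv i (ρ ∘ φ.symm) y = 0 :=
    fun i y hy => partialDeriv_comp_chart_symm_eq_zero hy.1 (hnot y hy) i
  set X : Fin n → EuclideanSpace ℝ (Fin n) → ℝ := fun i z =>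
    density (coeff φ (g 0).inner) z * Real.exp (-(f 0 ∘ φ.symm) z)
      * entropyField (fun s => coeff φ (g s).inner) 0 (f 0 ∘ φ.symm) (coeff φ v) (h ∘ φ.symm)
        c i z with hXdef
  have hX : ∀ i, ContDiffOn ℝ ∞ (X i) φ.target := fun i => by
    have h1 := contDiffOn_entropyField (D.isMetricFamilyOn hφ) (D.hasDerivAt_coeff φ)
      (F := fun s => f s ∘ φ.symm) (D.contDiffOn_function hφ) (D.hasDerivAt_comp φ) c i
    rw [slice_eq D.zero_mem] at h1
    exact ((isMetricOn_coeff (g 0) hφ).contDiffOn_density.mul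
      (D.contDiffOn_function_slice hφ D.zero_mem).neg.exp).mul h1
  have i1 : ∀ i, IntegrableOn (fun y => (ρ ∘ φ.symm) y * partialDeriv i (X i) y) φ.target :=
    fun i => integrableOn_of_isCompact hU hK hKU
      (hr.mul (contDiffOn_partialDeriv hU (hX i) i)).continuousOn
      fun y hy => by rw [hr0 y hy, zero_mul]
  have i2 : ∀ i, IntegrableOn (fun y => partialDeriv i (ρ ∘ φ.symm) y * X i y) φ.target :=
    fun i => integrableOn_of_isCompact hU hK hKU
      ((contDiffOn_partialDeriv hU hr i).mul (hX i)).continuousOn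
      fun y hy => by rw [hr0' i y hy, zero_mul]
  -- The product of the cutoff with `X i` has compact support in the chart, so the integral of its
  -- partial derivative vanishes.
  have parts : ∀ i, ∫ y in φ.target, (ρ ∘ φ.symm) y * partialDeriv i (X i) y
      = -∫ y in φ.target, partialDeriv i (ρ ∘ φ.symm) y * X i y := fun i => by
    rw [eq_neg_iff_add_eq_zero, ← integral_add (i1 i) (i2 i),
      ← setIntegral_partialDeriv_eq_zero hU hK hKU (hr.mul (hX i))
        (fun y hy => by rw [hr0 y hy, zero_mul]) i]
    refine setIntegral_congr_fun hU.measurableSet fun y hy => ?_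
    rw [partialDeriv_mul (differentiableAt_of_contDiffOn hU hr hy)
      (differentiableAt_of_contDiffOn hU (hX i) hy)]
    ring
  constructor
  · simp only [Finset.mul_sum]
    exact integrable_finsetSum _ fun i _ => i1 i
  · simp only [Finset.mul_sum]
    rw [integral_finsetSum _ fun i _ => i1 i]
    simp only [parts, Finset.sum_neg_distrib]
    rw [← integral_finsetSum _ fun i _ => i2 i]
    congr 2
    funext y
    simp only [chartFlux, entropyFlux, Finset.mul_sum, Finset.sum_mul, hXdef]
    exact Finset.sum_congr rfl fun i _ => by ring

variable [MeasurableSpace M] [BorelSpace M]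

omit D in
theorem integral_localized {F : M → ℝ} (hF : Continuous F) {k : EuclideanSpace ℝ (Fin n) → ℝ}
    (hk : ∀ x ∈ φ.source, F x = k (φ x)) (s : ℝ) :
    Integrable (fun x => ρ x * F x) (riemannianVolume (g s)) ∧
      ∫ x, ρ x * F x ∂(riemannianVolume (g s))
        = ∫ y in φ.target, (ρ ∘ φ.symm) y * (k y * density (coeff φ (g s).inner) y) := by
  have := integral_riemannianVolume_eq (g s) hφ (F := fun x => ρ x * F x)
    (hρ.continuous.mul hF) ((tsupport_mul_subset_left).trans hsupp)
  refine ⟨this.1, this.2.trans (setIntegral_congr_fun φ.open_target.measurableSet fun y hy => ?_)⟩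
  rw [hk _ (φ.map_target hy), φ.right_inv hy, Function.comp_apply, mul_assoc]

theorem integral_fluxAt (c : ℝ) :
    Integrable (fluxAt g (f 0) v h c ρ) (riemannianVolume (g 0)) ∧
      ∫ x, fluxAt g (f 0) v h c ρ x ∂(riemannianVolume (g 0))
        = ∫ y in φ.target, chartFlux g (f 0) v h c ρ φ y * density (coeff φ (g 0).inner) y := by
  have := integral_riemannianVolume_eq (g 0) hφ (D.continuous_fluxAt hρ c)
    ((tsupport_fluxAt_subset (f 0) c).trans hsupp)
  refine ⟨this.1, this.2.trans (setIntegral_congr_fun φ.open_target.measurableSet fun y hy => ?_)⟩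
  rw [D.chartFlux_eq hρ c hφ (φ.map_target hy), φ.right_inv hy]

/-- The cutoff reduces everything to a coordinate integral, differentiated under the integral sign.
The divergence in `hasDerivAt_localEntropy` is moved onto `ρ`; the resulting flux does not vanish
for a single cutoff, only after summation over the partition of unity. -/
theorem hasDerivAt_integral_localized :
    HasDerivAt (fun s => ∫ x, ρ x * entropyIntegrand (g s) (f s) (τ s) x ∂(riemannianVolume (g s)))
      (∫ x, ρ x * variationIntegrand (g 0) (f 0) (τ 0) v h σ x ∂(riemannianVolume (g 0))
        - τ 0 * (4 * Real.pi * τ 0) ^ (-(n : ℝ) / 2)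
          * ∫ x, fluxAt g (f 0) v h (n * σ / (2 * τ 0)) ρ x ∂(riemannianVolume (g 0))) 0 := by
  have hU := φ.open_target
  have hK : IsCompact (φ '' tsupport ρ) :=
    (isClosed_tsupport ρ).isCompact.image_of_continuousOn (φ.continuousOn.mono hsupp)
  have hKU : φ '' tsupport ρ ⊆ φ.target := by
    rintro _ ⟨x, hx, rfl⟩
    exact φ.map_source (hsupp hx)
  have hr := contDiffOn_function_comp_chart_symm hρ hφ
  have hr0 : ∀ y ∈ φ.target \ φ '' tsupport ρ, (ρ ∘ φ.symm) y = 0 := fun y hy =>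
    image_eq_zero_of_notMem_tsupport (f := ρ) fun h => hy.2 ⟨φ.symm y, h, φ.right_inv hy.1⟩
  have hG := D.isMetricFamilyOn hφ
  have hL : ContDiffOn ℝ ∞ (fun p : ℝ × EuclideanSpace ℝ (Fin n) => (ρ ∘ φ.symm) p.2
      * (localEntropy (coeff φ (g p.1).inner) (f p.1 ∘ φ.symm) (τ p.1) p.2
        * density (coeff φ (g p.1).inner) p.2)) (Ioo (-ε) ε ×ˢ φ.target) :=
    (hr.comp contDiffOn_snd fun p hp => hp.2).mul
      ((D.contDiffOn_localEntropy hφ).mul hG.contDiffOn_density)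
  have hmain := hasDerivAt_setIntegral D.pos hU hK hKU (L := fun s y => (ρ ∘ φ.symm) y
      * (localEntropy (coeff φ (g s).inner) (f s ∘ φ.symm) (τ s) y
        * density (coeff φ (g s).inner) y)) hL fun s y hy => by rw [hr0 y hy, zero_mul]
  have hev : (fun s => ∫ x, ρ x * entropyIntegrand (g s) (f s) (τ s) x ∂(riemannianVolume (g s)))
      =ᶠ[𝓝 0] fun s => ∫ y in φ.target, (ρ ∘ φ.symm) y
        * (localEntropy (coeff φ (g s).inner) (f s ∘ φ.symm) (τ s) y
          * density (coeff φ (g s).inner) y) := by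
    filter_upwards [Ioo_mem_nhds D.zero_mem.1 D.zero_mem.2] with s hs
    exact (integral_localized (g := g) hφ hρ hsupp (D.continuous_entropyIntegrand hs)
      (fun x hx => D.entropyIntegrand_eq hs hφ hx) s).2
  refine (hmain.congr_of_eventuallyEq hev).congr_deriv ?_
  have hparts := D.setIntegral_mul_divergence hφ hρ hsupp (n * σ / (2 * τ 0))
  have hvar := integral_localized (g := g) hφ hρ hsupp D.continuous_variationIntegrand
    (fun x hx => D.variationIntegrand_eq hφ hx) 0
  have hvar_int : IntegrableOn (fun y => (ρ ∘ φ.symm) y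
      * (localVariation (coeff φ (g 0).inner) (f 0 ∘ φ.symm) (τ 0) (coeff φ v) (h ∘ φ.symm) σ y
        * density (coeff φ (g 0).inner) y)) φ.target :=
    integrableOn_of_isCompact hU hK hKU (hr.continuousOn.mul ((D.continuousOn_localVariation hφ).mul
      (isMetricOn_coeff (g 0) hφ).contDiffOn_density.continuousOn))
      fun y hy => by rw [hr0 y hy, zero_mul]
  rw [hvar.2, (D.integral_fluxAt hφ hρ hsupp _).2, sub_eq_add_neg, ← mul_neg, ← hparts.2,
    ← integral_const_mul, ← integral_add hvar_int (hparts.1.const_mul _)]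
  refine setIntegral_congr_fun hU.measurableSet fun y hy => ?_
  have hd := ((hasDerivAt_localEntropy hG (show ((0 : ℝ), y) ∈ Ioo (-ε) ε ×ˢ φ.target from
    ⟨D.zero_mem, hy⟩) (D.hasDerivAt_coeff φ) (F := fun s => f s ∘ φ.symm)
    (D.contDiffOn_function hφ) (D.hasDerivAt_comp φ) (D.scale_pos 0 D.zero_mem)
    D.hasDerivAt_scale).const_mul ((ρ ∘ φ.symm) y)).deriv
  rw [hd]
  ring

end IsVariation

/-- The fluxes of a partition of unity add up to zero. -/
theorem sum_fluxAt_eq_zero {ι : Type*} {t : Finset ι} {ρ : ι → M → ℝ}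
    (hρ : ∀ a, ContMDiff (𝓡 n) 𝓘(ℝ, ℝ) ∞ (ρ a)) (hsum : ∀ x, ∑ a ∈ t, ρ a x = 1)
    (f : M → ℝ) (c : ℝ) (x : M) : ∑ a ∈ t, fluxAt g f v h c (ρ a) x = 0 := by
  set φ := chartAt (EuclideanSpace ℝ (Fin n)) x with hφd
  have hφ : φ ∈ atlas (EuclideanSpace ℝ (Fin n)) M := chart_mem_atlas _ x
  have hd : ∀ a, DifferentiableAt ℝ (ρ a ∘ φ.symm) (φ x) := fun a =>
    differentiableAt_of_contDiffOn φ.open_target (contDiffOn_function_comp_chart_symm (hρ a) hφ)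
      (mem_chart_target _ x)
  have hz : ∀ i, ∑ a ∈ t, partialDeriv i (ρ a ∘ φ.symm) (φ x) = 0 := fun i => by
    rw [← partialDeriv_const (k := i) (y := φ x) (1 : ℝ)]
    have : (fun _ => (1 : ℝ)) = fun y => ∑ a ∈ t, (ρ a ∘ φ.symm) y := by
      funext y
      exact (hsum _).symm
    rw [this, partialDeriv, fderiv_fun_sum fun a _ => hd a, sum_apply]
    rfl
  simp only [fluxAt, chartFlux, entropyFlux, ← hφd]
  rw [← Finset.mul_sum, Finset.sum_comm]
  simp only [← Finset.mul_sum, hz, mul_zero, Finset.sum_const_zero]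

end Localized

end PerelmanEntropy

/-! ### Globalization by a partition of unity -/

theorem theorem1p5 {n : ℕ} {M : Type*} [TopologicalSpace M] [T2Space M] [CompactSpace M]
    [ChartedSpace (EuclideanSpace ℝ (Fin n)) M] [IsManifold (𝓡 n) ∞ M]
    [MeasurableSpace M] [BorelSpace M]
    (ε : ℝ) (hε : 0 < ε)
    (g : ℝ → PerelmanEntropy.Metric n M) (f : ℝ → M → ℝ) (τ : ℝ → ℝ)
    (hg : ContMDiffOn (𝓘(ℝ, ℝ).prod (𝓡 n))
      ((𝓡 n).prod
        𝓘(ℝ, EuclideanSpace ℝ (Fin n) →L[ℝ] EuclideanSpace ℝ (Fin n) →L[ℝ] ℝ)) ∞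
      (fun p : ℝ × M => Bundle.TotalSpace.mk'
        (EuclideanSpace ℝ (Fin n) →L[ℝ] EuclideanSpace ℝ (Fin n) →L[ℝ] ℝ)
        (E := fun x : M => TangentSpace (𝓡 n) x →L[ℝ] TangentSpace (𝓡 n) x →L[ℝ] ℝ)
        p.2 ((g p.1).inner p.2))
      (Set.Ioo (-ε) ε ×ˢ Set.univ))
    (hf : ContMDiffOn (𝓘(ℝ, ℝ).prod (𝓡 n)) 𝓘(ℝ, ℝ) ∞ (fun p : ℝ × M => f p.1 p.2)
      (Set.Ioo (-ε) ε ×ˢ Set.univ))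
    (hτ : ContDiffOn ℝ ∞ τ (Set.Ioo (-ε) ε))
    (hτ_pos : ∀ s ∈ Set.Ioo (-ε) ε, 0 < τ s)
    (v : PerelmanEntropy.TensorField n M) (h : M → ℝ) (σ : ℝ)
    (hv : ∀ (x : M) (X Y : TangentSpace (𝓡 n) x),
      HasDerivAt (fun s => (g s).inner x X Y) (v x X Y) 0)
    (hh : ∀ x : M, HasDerivAt (fun s => f s x) (h x) 0)
    (hσ : HasDerivAt τ σ 0) :
    (∀ s ∈ Set.Ioo (-ε) ε,
      Integrable (entropyIntegrand (g s) (f s) (τ s)) (riemannianVolume (g s))) ∧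
    Integrable (variationIntegrand (g 0) (f 0) (τ 0) v h σ) (riemannianVolume (g 0)) ∧
    HasDerivAt (fun s => entropyW (g s) (f s) (τ s))
      (∫ x, variationIntegrand (g 0) (f 0) (τ 0) v h σ x ∂(riemannianVolume (g 0))) 0 := by
  have D : IsVariation ε g f τ v h σ := ⟨hε, hg, hf, hτ, hτ_pos, hv, hh, hσ⟩
  obtain ⟨ρ, hsub⟩ := SmoothPartitionOfUnity.exists_isSubordinate_chartAt_source (𝓡 n) M
  -- By compactness only finitely many functions of the locally finite partition are nonzero, so
  -- sums, integrals and derivatives can be exchanged freely.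
  set t : Finset M := ρ.locallyFinite.finite_nonempty_of_compact.toFinset
  have hsum : ∀ x, ∑ a ∈ t, ρ a x = 1 := fun x => by
    rw [← ρ.sum_eq_one (mem_univ x)]
    refine (finsum_eq_sum_of_support_subset _ fun a ha => ?_).symm
    simp only [t, Finite.coe_toFinset, mem_ofPred_eq]
    exact ⟨x, ha⟩
  have hρ : ∀ a, ContMDiff (𝓡 n) 𝓘(ℝ, ℝ) ∞ (ρ a) := fun a => (ρ a).contMDiff
  have hat : ∀ a : M, chartAt (EuclideanSpace ℝ (Fin n)) a ∈ atlas (EuclideanSpace ℝ (Fin n)) M :=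
    fun a => chart_mem_atlas _ a
  have hsplit : ∀ F : M → ℝ, F = fun x => ∑ a ∈ t, ρ a x * F x := fun F => by
    funext x
    rw [← Finset.sum_mul, hsum x, one_mul]
  have iE : ∀ s ∈ Ioo (-ε) ε, ∀ a, Integrable
      (fun x => ρ a x * entropyIntegrand (g s) (f s) (τ s) x) (riemannianVolume (g s)) :=
    fun s hs a => (IsVariation.integral_localized (hat a) (hρ a) (hsub a)
      (D.continuous_entropyIntegrand hs) (fun x hx => D.entropyIntegrand_eq hs (hat a) hx) s).1
  have iV : ∀ a, Integrable (fun x => ρ a x * variationIntegrand (g 0) (f 0) (τ 0) v h σ x)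
      (riemannianVolume (g 0)) := fun a =>
    (IsVariation.integral_localized (hat a) (hρ a) (hsub a) D.continuous_variationIntegrand
      (fun x hx => D.variationIntegrand_eq (hat a) hx) 0).1
  have iZ := fun a => (D.integral_fluxAt (hat a) (hρ a) (hsub a) (n * σ / (2 * τ 0))).1
  refine ⟨fun s hs => ?_, ?_, ?_⟩
  · rw [hsplit (entropyIntegrand (g s) (f s) (τ s))]
    exact integrable_finsetSum _ fun a _ => iE s hs a
  · rw [hsplit (variationIntegrand (g 0) (f 0) (τ 0) v h σ)]
    exact integrable_finsetSum _ fun a _ => iV a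
  · have hev : (fun s => entropyW (g s) (f s) (τ s)) =ᶠ[nhds 0] fun s => ∑ a ∈ t,
        ∫ x, ρ a x * entropyIntegrand (g s) (f s) (τ s) x ∂(riemannianVolume (g s)) := by
      filter_upwards [Ioo_mem_nhds D.zero_mem.1 D.zero_mem.2] with s hs
      rw [← integral_finsetSum _ fun a _ => iE s hs a]
      exact congrArg (fun F => ∫ x, F x ∂(riemannianVolume (g s))) (hsplit _)
    refine ((HasDerivAt.fun_sum fun a _ => D.hasDerivAt_integral_localized (hat a) (hρ a)
      (hsub a)).congr_of_eventuallyEq hev).congr_deriv ?_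
    -- The prefactor of the flux is the same for every cutoff, so the fluxes can be added under one
    -- integral, where they cancel pointwise.
    rw [Finset.sum_sub_distrib, ← Finset.mul_sum, ← integral_finsetSum _ fun a _ => iV a,
      ← integral_finsetSum _ fun a _ => iZ a]
    simp only [sum_fluxAt_eq_zero (g := g) (v := v) (h := h) hρ hsum, integral_zero, mul_zero,
      sub_zero]
    exact congrArg (fun F => ∫ x, F x ∂(riemannianVolume (g 0))) (hsplit _).symm
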